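/- Let $\ell(y|\cdot):\mathbb R^n\to(0,\infty)$ be the likelihood of the observed data $y$, let $p:\mathbb R^n\to(0,\infty)$ be a prior probability density with $\int \ell(y|x)p(x)\,dx<\infty$, and let $\pi\propto \ell(y|\cdot)\,p$ be the posterior distribution. For $\sigma>0$ let $p_\sigma(x)=\int_{\mathbb R^n}p(z)\,\phi_\sigma(x-z)\,dz$, where $\phi_\sigma$ is the density of $\mathcal N(0,\sigma^2 I)$, and let $S_\theta(\cdot,\sigma):\mathbb R^n\to\mathbb R^n$ be a score network. With $\|\cdot\|$ the Euclidean norm, assume that for all $x,x_1,x_2\in\mathbb R^n$: 1. $\log\ell(y|\cdot)$ is differentiable and $\|\nabla\log\ell(y|x_1)-\nabla\log\ell(y|x_2)\|\le L_g\|x_1-x_2\|$, with $L_g>0$; 2. $\log p$ is differentiable and $\|\nabla\log p(x_1)-\nabla\log p(x_2)\|\le L_p\|x_1-x_2\|$, with $L_p>0$; 3. $\|S_\theta(x_1,\sigma)-S_\theta(x_2,\sigma)\|\le L_\sigma\|x_1-x_2\|$ with $L_\sigma>0$, and $\|S_\theta(x,\sigma)-\nabla\log p_\sigma(x)\|\le\varepsilon_\sigma$;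 4. $\|\nabla\log p_\sigma(x)-\nabla\log p(x)\|\le\sigma C$. Let $L=L_g+\max\{L_\sigma,L_p\}$, let $\gamma>0$ satisfy $\gamma L\le 1/\sqrt{32}$, and let $N\ge 1$ be an integer. Put $\mathcal G(x)=-\nabla\log\ell(y|x)-S_\theta(x,\sigma)$. Let $x_0$ be a random vector in $\mathbb R^n$ with law $\nu_0$, let $(B_t)_{t\ge0}$ be a standard Brownian motion in $\mathbb R^n$ independent of $x_0$, and let $\nu_t$ be the law of $x_t$, where $$x_t=x_{k\gamma}-(t-k\gamma)\,\mathcal G(x_{k\gamma})+\sqrt2\,(B_t-B_{k\gamma}),\qquad t\in[k\gamma,(k+1)\gamma],\quad k=0,1,2,\dots$$ (so that $X_k:=x_{k\gamma}$ are the PMC-RED iterates $X_{k+1}=X_k-\gamma\,\mathcal G(X_k)+\sqrt{2\gamma}\,Z_k$ with the i.i.d. standard normal vectors $Z_k=\gamma^{-1/2}(B_{(k+1)\gamma}-B_{k\gamma})$). Then $$\frac1{N\gamma}\int_0^{N\gamma}\mathrm{FI}(\nu_t\,\|\,\pi)\,dt\;\le\;\frac{4\,\mathrm{KL}(\nu_0\,\|\,\pi)}{N\gamma}+24nL^2\gamma+24C^2\sigma^2+24\varepsilon_\sigma^2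 ,$$ where $\mathrm{KL}(\nu\|\pi)=\int\log\frac{d\nu}{d\pi}\,d\nu$ (equal to $+\infty$ if $\nu\not\ll\pi$) and $\mathrm{FI}(\nu\|\pi)=\int\big\|\nabla\log\frac{d\nu}{d\pi}\big\|^2\,d\nu$ when $\nu$ has a positive continuously differentiable density $\frac{d\nu}{d\pi}$ with respect to $\pi$, and $\mathrm{FI}(\nu\|\pi)=+\infty$ otherwise. -/

import Mathlib

open MeasureTheory ProbabilityTheory
open scoped ENNReal NNReal

noncomputable section

/-- The Euclidean space `ℝⁿ`, with the `ℓ²` norm. -/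
abbrev Rn (n : ℕ) : Type := EuclideanSpace ℝ (Fin n)

/-- The density `φ_σ` of the Gaussian distribution `N(0, σ² I)` on `ℝⁿ`. -/
def gaussianDensity {n : ℕ} (σ : ℝ) (x : Rn n) : ℝ :=
  (2 * Real.pi * σ ^ 2) ^ (-(n : ℝ) / 2) * Real.exp (-‖x‖ ^ 2 / (2 * σ ^ 2))

/-- The smoothed prior `p_σ(x) = ∫ p(z) φ_σ(x - z) dz`. -/
def smoothedPrior {n : ℕ} (p : Rn n → ℝ) (σ : ℝ) (x : Rn n) : ℝ :=
  ∫ z, p z * gaussianDensity σ (x - z)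

/-- The score `∇ log q` of a positive density (or likelihood) `q`. -/
def score {n : ℕ} (q : Rn n → ℝ) (x : Rn n) : Rn n :=
  gradient (fun z => Real.log (q z)) x

/-- The posterior distribution `π ∝ ℓ p`, for the likelihood `x ↦ ℓ(x) = ℓ(y | x)` of the observed
data `y` and the prior density `p`. -/
def posteriorMeasure {n : ℕ} (ℓ p : Rn n → ℝ) : Measure (Rn n) :=
  volume.withDensity fun x => ENNReal.ofReal (ℓ x * p x / ∫ z, ℓ z * p z)

/-- The relative Fisher information `FI(ν ‖ π) = ∫ ‖∇ log (ν / π)‖² dν`, where `ν / π` is the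
positive `C¹` density of `ν` with respect to `π`; it is `∞` if there is no such density.
(Two such densities agree on the support of `π`, so for a measure `π` of full support the infimum is
over at most one function.) -/
def fisherInfo {n : ℕ} (ν π : Measure (Rn n)) : ℝ≥0∞ :=
  ⨅ (r : Rn n → ℝ) (_ : ContDiff ℝ 1 r) (_ : ∀ x, 0 < r x)
    (_ : ν = π.withDensity fun x => ENNReal.ofReal (r x)),
    ∫⁻ x, ENNReal.ofReal (‖gradient (fun z => Real.log (r z)) x‖ ^ 2) ∂ν

/-- Standard `n`-dimensional Brownian motion: the coordinates are independent standard real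
Brownian motions. -/
structure IsBrownianRn {n : ℕ} {Ω : Type*} [MeasurableSpace Ω] (B : ℝ≥0 → Ω → Rn n)
    (P : Measure Ω) : Prop where
  coord : ∀ i, IsBrownianReal (fun t ω => B t ω i) P
  indep : iIndepFun (fun i ω (t : ℝ≥0) => B t ω i) P

/-- The drift `𝒢(x) = ∇g(x) - S(x, σ)` of PMC-RED, where `g = -log ℓ`. -/
def pmcRedDrift {n : ℕ} (ℓ : Rn n → ℝ) (S : Rn n → ℝ → Rn n) (σ : ℝ) (x : Rn n) : Rn n :=
  gradient (fun z => -Real.log (ℓ z)) x - S x σ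

/-- The PMC-RED iterates `x_{k+1} = x_k - γ 𝒢(x_k) + √(2γ) Z_k`. -/
def pmcRedIterate {n : ℕ} {Ω : Type*} (ℓ : Rn n → ℝ) (S : Rn n → ℝ → Rn n) (σ γ : ℝ)
    (X₀ : Ω → Rn n) (Z : ℕ → Ω → Rn n) : ℕ → Ω → Rn n
  | 0 => X₀
  | k + 1 => fun ω =>
      pmcRedIterate ℓ S σ γ X₀ Z k ω
        - γ • pmcRedDrift ℓ S σ (pmcRedIterate ℓ S σ γ X₀ Z k ω)
        + Real.sqrt (2 * γ) • Z k ω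

/-- The noise `Z_k = γ^{-1/2} (B_{(k+1)γ} - B_{kγ})`; for a standard Brownian motion `B` and `γ > 0`
these are i.i.d. `N(0, I)`. -/
def brownianNoise {n : ℕ} {Ω : Type*} (B : ℝ≥0 → Ω → Rn n) (γ : ℝ) (k : ℕ) (ω : Ω) : Rn n :=
  (Real.sqrt γ)⁻¹ • (B (Real.toNNReal ((k + 1 : ℝ) * γ)) ω - B (Real.toNNReal (k * γ)) ω)

/-- The linear interpolation of PMC-RED: with `x_{kγ}` the `k`-th iterate,
`x_t = x_{kγ} - (t - kγ) 𝒢(x_{kγ}) + √2 (B_t - B_{kγ})` for `t ∈ [kγ, (k+1)γ]`. -/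
def pmcRedInterp {n : ℕ} {Ω : Type*} (ℓ : Rn n → ℝ) (S : Rn n → ℝ → Rn n) (σ γ : ℝ)
    (X₀ : Ω → Rn n) (B : ℝ≥0 → Ω → Rn n) (t : ℝ) (ω : Ω) : Rn n :=
  pmcRedIterate ℓ S σ γ X₀ (brownianNoise B γ) ⌊t / γ⌋₊ ω
    - (t - ⌊t / γ⌋₊ * γ) •
        pmcRedDrift ℓ S σ (pmcRedIterate ℓ S σ γ X₀ (brownianNoise B γ) ⌊t / γ⌋₊ ω)
    + Real.sqrt 2 • (B (Real.toNNReal t) ω - B (Real.toNNReal (⌊t / γ⌋₊ * γ)) ω)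

end

/-! Write `π = exp (-V)` and let `x_t = z - t b(z) + √(2t) ξ` be one step of the scheme, with `z ∼
ν` and `ξ` an independent standard Gaussian. For `t > 0` its law has a positive `C¹` density `q_t`.
The argument is entropy dissipation. Formally, the derivative of `KL(q_t ‖ π)` is `-FI +
E⟨∇log(q_t/π)(x_t), ∇V(x_t) - b(z)⟩`, the noise having been turned into the score of `q_t` by
Tweedie's formula (`integral_inner_noise_eq`). By Young's inequality this is at most `-FI/2 +
E‖∇V(x_t) - b(z)‖²/2`. The last expectation is controlled by the drift error `δ = sup ‖b - ∇V‖` and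
by `L` times the displacement `x_t - z`, hence by the second moment of `∇V(x_t)`, which is at most
`FI + 2nL` (`integral_norm_sq_gradient_le`). For `tL ≤ 1/√32` the Fisher information on the right is
absorbed, and the derivative is at most `-FI/4 + 3δ² + 6nL²t` (`stepEnergyDeriv_le`). Integrating
over a step, telescoping over the steps and inserting `δ ≤ εσ + σC` gives the theorem.

Four devices make this rigorous. The Fokker-Planck equation is avoided by freezing `log q_t` and
moving only the law: Gibbs' inequality compares the frozen energy with the true one and bounds the
right difference quotients of the entropy (`stepEnergy_sub_le`). Stochastic calculus is avoided
because only the marginal laws matter, so that a Brownian increment may be replaced by `√(2t) ξ`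
with one fixed `ξ`. Integrability comes from starting in a ball, where `log q_t` grows at most
quadratically; the general start is reached by restricting `ν` to balls and applying Fatou's lemma
to the entropy and to the Fisher information (`klDiv_stepLaw_add_lintegral_fisher_le`). Time `0`,
where the density has no regularity, is reached through an upper bound on the entropy after a short
step (`integral_log_stepDensity_le`). -/

set_option linter.unusedSectionVars false

/-! ### The heat kernel as a Gaussian density. -/

section HeatKernel

open Module Filter Topology
open scoped RealInnerProductSpace

variable {E : Type*} [NormedAddCommGroup E] [InnerProductSpace ℝ E] [FiniteDimensional ℝ E]

/-- The heat kernel: the density of the Gaussian distribution `N(0, 2 t I)`. -/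
noncomputable def heatKernel (t : ℝ) (u : E) : ℝ :=
  (4 * Real.pi * t) ^ (-(finrank ℝ E : ℝ) / 2) * Real.exp (-‖u‖ ^ 2 / (4 * t))

lemma heatKernel_pos {t : ℝ} (ht : 0 < t) (u : E) : 0 < heatKernel t u := by
  unfold heatKernel; positivity

lemma heatKernel_le {t : ℝ} (ht : 0 < t) (u : E) :
    heatKernel t u ≤ (4 * Real.pi * t) ^ (-(finrank ℝ E : ℝ) / 2) := by
  unfold heatKernel
  refine mul_le_of_le_one_right (by positivity) (Real.exp_le_one_iff.2 ?_)
  exact div_nonpos_of_nonpos_of_nonneg (by simp) (by positivity)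

/-- The left side is the norm of the gradient of the kernel. Scaling by `√t` reduces the bound to `y
exp (-y²) ≤ 1`. As it does not depend on `u`, it is a dominating constant for every finite measure.
-/
lemma norm_mul_heatKernel_le {t : ℝ} (ht : 0 < t) (u : E) :
    ‖u‖ / (2 * t) * heatKernel t u
      ≤ (4 * Real.pi * t) ^ (-(finrank ℝ E : ℝ) / 2) * (Real.sqrt t)⁻¹ := by
  unfold heatKernel
  have h1 : ‖u‖ / (2 * t) * Real.exp (-‖u‖ ^ 2 / (4 * t)) ≤ (Real.sqrt t)⁻¹ := by
    set y := ‖u‖ / (2 * Real.sqrt t) with hy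
    have hs : 0 < Real.sqrt t := Real.sqrt_pos.2 ht
    have hst : Real.sqrt t ^ 2 = t := Real.sq_sqrt ht.le
    have e1 : ‖u‖ / (2 * t) = y * (Real.sqrt t)⁻¹ := by
      rw [hy]; conv_lhs => rw [← hst]
      field_simp
    have e2 : -‖u‖ ^ 2 / (4 * t) = -y ^ 2 := by
      rw [hy]; conv_lhs => rw [← hst]
      field_simp; ring
    rw [e1, e2]
    have h2 : y * Real.exp (-y ^ 2) ≤ 1 := by
      rw [Real.exp_neg, ← div_eq_mul_inv, div_le_one (Real.exp_pos _)]
      nlinarith [Real.add_one_le_exp (y ^ 2), sq_nonneg (y - 1)]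
    calc _ = (y * Real.exp (-y ^ 2)) * (Real.sqrt t)⁻¹ := by ring
      _ ≤ 1 * (Real.sqrt t)⁻¹ := by gcongr
      _ = _ := one_mul _
  calc _ = (4 * Real.pi * t) ^ (-(finrank ℝ E : ℝ) / 2)
        * (‖u‖ / (2 * t) * Real.exp (-‖u‖ ^ 2 / (4 * t))) := by ring
    _ ≤ _ := by gcongr

lemma continuousOn_heatKernel :
    ContinuousOn (fun y : ℝ × E => heatKernel y.1 y.2) (Set.Ioi 0 ×ˢ Set.univ) := by
  unfold heatKernel
  have h4 : ∀ y ∈ (Set.Ioi (0 : ℝ)) ×ˢ (Set.univ : Set E), 4 * y.1 ≠ 0 := fun y hy =>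
    (mul_pos four_pos hy.1).ne'
  refine ContinuousOn.mul (ContinuousOn.rpow_const (by fun_prop) ?_) ?_
  · rintro y hy
    have : (0 : ℝ) < y.1 := hy.1
    left; positivity
  · exact Real.continuous_exp.comp_continuousOn (ContinuousOn.div (by fun_prop) (by fun_prop) h4)

lemma hasGradientAt_heatKernel (t : ℝ) (u : E) :
    HasGradientAt (heatKernel t) (-(heatKernel t u / (2 * t)) • u) u := by
  rw [hasGradientAt_iff_hasFDerivAt]
  have h1 : HasFDerivAt (fun x : E => ‖x‖ ^ 2) (2 • innerSL ℝ u) u :=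
    (hasStrictFDerivAt_norm_sq u).hasFDerivAt
  have h2 := (((h1.neg.mul_const (4 * t)⁻¹).exp).const_mul
    ((4 * Real.pi * t) ^ (-(finrank ℝ E : ℝ) / 2)))
  refine (h2.congr_fderiv ?_).congr_of_eventuallyEq ?_
  · ext v
    simp only [heatKernel, div_eq_mul_inv, Pi.neg_apply, smul_apply,
      neg_apply, innerSL_apply_apply, smul_eq_mul, nsmul_eq_mul,
      InnerProductSpace.toDual_apply_apply, inner_smul_left, mul_inv, RCLike.conj_to_real]
    norm_num [real_inner_comm]
    ring
  · filter_upwards with x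
    simp [heatKernel, div_eq_mul_inv]

variable [MeasurableSpace E] [BorelSpace E]

lemma measurable_heatKernel : Measurable (fun y : ℝ × E => heatKernel y.1 y.2) := by
  unfold heatKernel; fun_prop

lemma integral_heatKernel_sub {t : ℝ} (ht : 0 < t) (h : E) :
    ∫ x, heatKernel t (x - h) = 1 := by
  rw [integral_sub_right_eq_self (fun x => heatKernel t x)]
  unfold heatKernel
  rw [integral_const_mul]
  have : ∀ x : E, Real.exp (-‖x‖ ^ 2 / (4 * t)) = Real.exp (-(4 * t)⁻¹ * ‖x‖ ^ 2) := by
    intro x; congr 1; rw [div_eq_mul_inv]; ring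
  simp_rw [this]
  rw [GaussianFourier.integral_rexp_neg_mul_sq_norm (by positivity), div_inv_eq_mul,
    show Real.pi * (4 * t) = 4 * Real.pi * t by ring, ← Real.rpow_add (by positivity)]
  simp [neg_div]

lemma integrable_heatKernel_sub {t : ℝ} (ht : 0 < t) (h : E) :
    Integrable (fun x => heatKernel t (x - h)) := by
  -- A non-integrable function would have integral `0` by convention.
  by_contra hn
  have := integral_heatKernel_sub ht h
  rw [integral_undef hn] at this
  exact zero_ne_one this

lemma lintegral_heatKernel_sub {t : ℝ} (ht : 0 < t) (h : E) :
    ∫⁻ x, ENNReal.ofReal (heatKernel t (x - h)) = 1 := by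
  rw [← ofReal_integral_eq_lintegral_ofReal (integrable_heatKernel_sub ht h)
    (.of_forall fun x => (heatKernel_pos ht _).le), integral_heatKernel_sub ht, ENNReal.ofReal_one]

lemma measurable_heatKernel_sub (t : ℝ) (h : E) : Measurable fun x => heatKernel t (x - h) := by
  unfold heatKernel; fun_prop

/-- The law of `h + √(2t) ξ`, with `ξ` standard Gaussian, has the heat kernel as its density. -/
lemma map_stdGaussian_eq_withDensity_heatKernel {t : ℝ} (ht : 0 < t) (h : E) :
    (stdGaussian E).map (fun ξ => h + Real.sqrt (2 * t) • ξ)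
      = volume.withDensity fun x => ENNReal.ofReal (heatKernel t (x - h)) := by
  have hprob : IsFiniteMeasure
      (volume.withDensity fun x : E => ENNReal.ofReal (heatKernel t (x - h))) :=
    ⟨by simp [lintegral_heatKernel_sub ht]⟩
  -- Characteristic functions are compared: the shift `h` contributes the same phase on both sides,
  -- and the Fourier transform of a centred Gaussian remains.
  apply Measure.ext_of_charFun
  ext s
  have hc : (fun ξ : E => h + Real.sqrt (2 * t) • ξ)
    = (fun ξ => h + ξ) ∘ (fun ξ => Real.sqrt (2 * t) • ξ) := rfl
  rw [hc, ← Measure.map_map (by fun_prop) (by fun_prop), charFun_map_const_add, charFun_map_smul,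
    charFun_stdGaussian, charFun_apply, integral_withDensity_eq_integral_toReal_smul
      (measurable_heatKernel_sub t h).ennreal_ofReal (by simp)]
  have e1 : ∀ x : E, (ENNReal.ofReal (heatKernel t (x - h))).toReal
      • Complex.exp (⟪x, s⟫ * Complex.I)
      = Complex.exp (⟪h, s⟫ * Complex.I) * ((4 * Real.pi * t) ^ (-(finrank ℝ E : ℝ) / 2) : ℝ)
        * Complex.exp (-((4 * t : ℝ)⁻¹ : ℂ) * ‖x - h‖ ^ 2 + Complex.I * ⟪s, x - h⟫) := by
    intro x
    rw [ENNReal.toReal_ofReal (heatKernel_pos ht _).le, Complex.real_smul, heatKernel,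
      real_inner_comm s x]
    have : ⟪s, x⟫ = ⟪h, s⟫ + ⟪s, x - h⟫ := by rw [inner_sub_right, real_inner_comm s h]; ring
    rw [this]
    push_cast
    rw [add_mul, Complex.exp_add, Complex.exp_add]
    have : Complex.exp (-(‖x - h‖ : ℂ) ^ 2 / (4 * t)) = Complex.exp (-(4 * t : ℂ)⁻¹ * ‖x - h‖ ^ 2) := by
      congr 1; rw [div_eq_mul_inv]; ring
    rw [this, mul_comm (⟪s, x - h⟫ : ℂ)]
    ring
  simp_rw [e1]
  rw [integral_const_mul, integral_sub_right_eq_self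
    (fun x : E => Complex.exp (-((4 * t : ℝ)⁻¹ : ℂ) * ‖x‖ ^ 2 + Complex.I * ⟪s, x⟫)) h,
    GaussianFourier.integral_cexp_neg_mul_sq_norm_add (by
      rw [← Complex.ofReal_inv, Complex.ofReal_re]; positivity)]
  have e2 : ((Real.pi : ℂ) / ((4 * t : ℝ)⁻¹ : ℂ)) ^ ((finrank ℝ E : ℂ) / 2)
      = (((4 * Real.pi * t) ^ ((finrank ℝ E : ℝ) / 2) : ℝ) : ℂ) := by
    rw [Complex.ofReal_cpow (by positivity)]
    push_cast; congr 1; rw [div_inv_eq_mul]; ring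
  have e3 : ((4 * Real.pi * t) ^ (-(finrank ℝ E : ℝ) / 2) : ℝ)
      * ((4 * Real.pi * t) ^ ((finrank ℝ E : ℝ) / 2)) = 1 := by
    rw [← Real.rpow_add (by positivity)]; simp [neg_div]
  have e3' := congrArg (fun r : ℝ => (r : ℂ)) e3
  simp only [Complex.ofReal_mul, Complex.ofReal_one] at e3'
  have e4 : Complex.exp (-((‖Real.sqrt (2 * t) • s‖ : ℝ) : ℂ) ^ 2 / 2)
      = Complex.exp (Complex.I ^ 2 * ‖s‖ ^ 2 / (4 * ((4 * t : ℝ)⁻¹ : ℂ))) := by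
    congr 1
    rw [norm_smul, ← Complex.ofReal_pow, mul_pow, Real.norm_eq_abs, sq_abs,
      Real.sq_sqrt (by positivity), Complex.I_sq]
    push_cast
    have : (t : ℂ) ≠ 0 := by exact_mod_cast ht.ne'
    field_simp
  rw [e2, e4]
  linear_combination (-(Complex.exp (⟪h, s⟫ * Complex.I)
    * Complex.exp (Complex.I ^ 2 * ‖s‖ ^ 2 / (4 * ((4 * t : ℝ)⁻¹ : ℂ))))) * e3'

end HeatKernel

/-! ### One Langevin step: transition density, score and Tweedie's formula. -/

section GaussianStep

open Module Filter Topology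
open scoped RealInnerProductSpace

variable {E : Type*} [NormedAddCommGroup E] [InnerProductSpace ℝ E] [FiniteDimensional ℝ E]
  [MeasurableSpace E] [BorelSpace E]

lemma integrable_norm_pow_stdGaussian (k : ℕ) :
    Integrable (fun ξ : E => ‖ξ‖ ^ k) (stdGaussian E) := by
  have := (IsGaussian.memLp_id (stdGaussian E) k (by simp)).integrable_norm_pow'
  simpa using this

lemma integral_norm_sq_stdGaussian :
    ∫ ξ : E, ‖ξ‖ ^ 2 ∂(stdGaussian E) = finrank ℝ E := by
  have h1 : ∀ ξ : E, ‖ξ‖ ^ 2 = ∑ i, ⟪stdOrthonormalBasis ℝ E i, ξ⟫ ^ 2 := fun ξ =>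
    ((stdOrthonormalBasis ℝ E).sum_sq_inner_right ξ).symm
  have hint : ∀ i, Integrable (fun ξ : E => ⟪stdOrthonormalBasis ℝ E i, ξ⟫ ^ 2)
      (stdGaussian E) := by
    intro i
    refine (integrable_norm_pow_stdGaussian (E := E) 2).mono' (by fun_prop) (.of_forall fun ξ => ?_)
    rw [Real.norm_of_nonneg (sq_nonneg _), ← sq_abs]
    have := abs_real_inner_le_norm (stdOrthonormalBasis ℝ E i) ξ
    rw [(stdOrthonormalBasis ℝ E).norm_eq_one, one_mul] at this
    gcongr
  simp_rw [h1]
  rw [integral_finsetSum _ fun i _ => hint i]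
  have h2 : ∀ i, ∫ ξ : E, ⟪stdOrthonormalBasis ℝ E i, ξ⟫ ^ 2 ∂(stdGaussian E) = 1 := by
    intro i
    have hv := variance_dual_stdGaussian (innerSL ℝ (stdOrthonormalBasis ℝ E i))
    rw [variance_eq_integral (by fun_prop), integral_strongDual_stdGaussian] at hv
    simpa [(stdOrthonormalBasis ℝ E).norm_eq_one] using hv
  simp [h2]

/-- One step of length `t` of the Langevin scheme with drift `-b`: the pair of the starting point
and the standard Gaussian noise is sent to the end point. -/
noncomputable def langevinStep (b : E → E) (t : ℝ) (y : E × E) : E :=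
  y.1 - t • b y.1 + Real.sqrt (2 * t) • y.2

/-- The transition density of `langevinStep`. -/
noncomputable def stepKernel (b : E → E) (t : ℝ) (z x : E) : ℝ :=
  heatKernel t (x - (z - t • b z))

/-- The density of the law of `langevinStep` started from `μ`. -/
noncomputable def stepDensity (b : E → E) (μ : Measure E) (t : ℝ) (x : E) : ℝ :=
  ∫ z, stepKernel b t z x ∂μ

/-- The gradient of `stepDensity`. -/
noncomputable def stepDensityGrad (b : E → E) (μ : Measure E) (t : ℝ) (x : E) : E :=
  ∫ z, (-(stepKernel b t z x / (2 * t))) • (x - (z - t • b z)) ∂μ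

variable {b : E → E}

lemma stepKernel_pos {t : ℝ} (ht : 0 < t) (z x : E) : 0 < stepKernel b t z x :=
  heatKernel_pos ht _

lemma continuous_langevinStep (hb : Continuous b) :
    Continuous (fun y : ℝ × (E × E) => langevinStep b y.1 y.2) := by
  unfold langevinStep; fun_prop

lemma measurable_langevinStep (hb : Continuous b) (t : ℝ) : Measurable (langevinStep b t) :=
  ((continuous_langevinStep hb).comp (Continuous.prodMk_right t)).measurable

lemma measurable_stepKernel (hb : Continuous b) :
    Measurable (fun y : ℝ × E × E => stepKernel b y.1 y.2.1 y.2.2) := by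
  unfold stepKernel
  exact measurable_heatKernel.comp (f := fun y : ℝ × E × E => (y.1, y.2.2 - (y.2.1 - y.1 • b y.2.1)))
    (by have := hb.measurable; fun_prop)

lemma measurable_stepKernel_pair (hb : Continuous b) (t : ℝ) :
    Measurable (fun y : E × E => stepKernel b t y.1 y.2) :=
  (measurable_stepKernel hb).comp (f := fun y : E × E => (t, y)) (by fun_prop)

/-- The joint law of the starting point and the end point of `langevinStep`. -/
lemma map_prod_langevinStep (hb : Continuous b) {t : ℝ} (ht : 0 < t) (μ : Measure E)
    [SFinite μ] :
    (μ.prod (stdGaussian E)).map (fun y => (y.1, langevinStep b t y))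
      = (μ.prod volume).withDensity fun y => ENNReal.ofReal (stepKernel b t y.1 y.2) := by
  have hm : Measurable fun y : E × E => (y.1, langevinStep b t y) :=
    measurable_fst.prodMk (measurable_langevinStep hb t)
  ext s hs
  rw [Measure.map_apply hm hs, Measure.prod_apply (hm hs), withDensity_apply _ hs,
    ← lintegral_indicator hs, lintegral_prod _ (((measurable_stepKernel_pair hb
      t).ennreal_ofReal.indicator hs).aemeasurable)]
  refine lintegral_congr fun z => ?_
  have h1 : Prod.mk z ⁻¹' ((fun y : E × E => (y.1, langevinStep b t y)) ⁻¹' s)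
      = (fun ξ => (z - t • b z) + Real.sqrt (2 * t) • ξ) ⁻¹' (Prod.mk z ⁻¹' s) := rfl
  rw [h1, ← Measure.map_apply (by fun_prop) (measurable_prodMk_left hs),
    map_stdGaussian_eq_withDensity_heatKernel ht, withDensity_apply _ (measurable_prodMk_left hs),
    ← lintegral_indicator (measurable_prodMk_left hs)]
  rfl

lemma lintegral_langevinStep_pair (hb : Continuous b) {t : ℝ} (ht : 0 < t) (μ : Measure E)
    [SFinite μ] {f : E × E → ℝ≥0∞} (hf : Measurable f) :
    ∫⁻ y, f (y.1, langevinStep b t y) ∂(μ.prod (stdGaussian E))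
      = ∫⁻ z, (∫⁻ x, ENNReal.ofReal (stepKernel b t z x) * f (z, x)) ∂μ := by
  have hm : Measurable fun y : E × E => (y.1, langevinStep b t y) :=
    measurable_fst.prodMk (measurable_langevinStep hb t)
  have hk := (measurable_stepKernel_pair hb t).ennreal_ofReal
  rw [← lintegral_map hf hm, map_prod_langevinStep hb ht,
    lintegral_withDensity_eq_lintegral_mul _ hk hf, lintegral_prod _ (hk.mul hf).aemeasurable]
  rfl

lemma integrable_langevinStep_pair_iff (hb : Continuous b) {t : ℝ} (ht : 0 < t) (μ : Measure E)
    [SFinite μ] {f : E × E → ℝ} (hf : Measurable f) :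
    Integrable (fun y => f (y.1, langevinStep b t y)) (μ.prod (stdGaussian E))
      ↔ Integrable (fun y => stepKernel b t y.1 y.2 * f y) (μ.prod volume) := by
  have hm : Measurable fun y : E × E => (y.1, langevinStep b t y) :=
    measurable_fst.prodMk (measurable_langevinStep hb t)
  have h := integrable_map_measure (μ := μ.prod (stdGaussian E)) (f := fun y : E × E =>
    (y.1, langevinStep b t y)) hf.aestronglyMeasurable hm.aemeasurable
  rw [map_prod_langevinStep hb ht, integrable_withDensity_iff_integrable_smul'
    (measurable_stepKernel_pair hb t).ennreal_ofReal (by simp)] at h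
  rw [show (fun y : E × E => f (y.1, langevinStep b t y))
    = f ∘ fun y => (y.1, langevinStep b t y) from rfl, ← h]
  refine integrable_congr (.of_forall fun y => ?_)
  simp [ENNReal.toReal_ofReal (stepKernel_pos ht _ _).le]

lemma integral_langevinStep_pair (hb : Continuous b) {t : ℝ} (ht : 0 < t) (μ : Measure E)
    [SFinite μ] {f : E × E → ℝ} (hf : Measurable f) :
    ∫ y, f (y.1, langevinStep b t y) ∂(μ.prod (stdGaussian E))
      = ∫ y, stepKernel b t y.1 y.2 * f y ∂(μ.prod volume) := by
  have hm : Measurable fun y : E × E => (y.1, langevinStep b t y) :=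
    measurable_fst.prodMk (measurable_langevinStep hb t)
  rw [← integral_map (f := f) hm.aemeasurable hf.aestronglyMeasurable, map_prod_langevinStep hb ht,
    integral_withDensity_eq_integral_toReal_smul
    (measurable_stepKernel_pair hb t).ennreal_ofReal (by simp)]
  refine integral_congr_ae (.of_forall fun y => ?_)
  simp [ENNReal.toReal_ofReal (stepKernel_pos ht _ _).le]

section FiniteMeasure

variable (μ : Measure E) [IsFiniteMeasure μ]

lemma integrable_stepKernel (hb : Continuous b) {t : ℝ} (ht : 0 < t) (x : E) :
    Integrable (fun z => stepKernel b t z x) μ := by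
  refine Integrable.of_bound (C := (4 * Real.pi * t) ^ (-(finrank ℝ E : ℝ) / 2))
    ((measurable_stepKernel hb).comp (f := fun z : E => (t, z, x))
      (by fun_prop)).aestronglyMeasurable (.of_forall fun z => ?_)
  rw [Real.norm_of_nonneg (stepKernel_pos ht _ _).le]
  exact heatKernel_le ht _

lemma measurable_stepDensity (hb : Continuous b) :
    Measurable (fun y : ℝ × E => stepDensity b μ y.1 y.2) := by
  refine (StronglyMeasurable.integral_prod_right (f := fun (y : ℝ × E) (z : E) =>
    stepKernel b y.1 z y.2) ?_).measurable
  exact ((measurable_stepKernel hb).comp (f := fun y : (ℝ × E) × E => (y.1.1, y.2, y.1.2))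
    (by fun_prop)).stronglyMeasurable

lemma measurable_stepDensityGrad (hb : Continuous b) :
    Measurable (fun y : ℝ × E => stepDensityGrad b μ y.1 y.2) := by
  refine (StronglyMeasurable.integral_prod_right (f := fun (y : ℝ × E) (z : E) =>
    (-(stepKernel b y.1 z y.2 / (2 * y.1))) • (y.2 - (z - y.1 • b z))) ?_).measurable
  refine Measurable.stronglyMeasurable ?_
  have := (measurable_stepKernel hb).comp (f := fun y : (ℝ × E) × E => (y.1.1, y.2, y.1.2))
    (by fun_prop)
  have hbm := hb.measurable
  simp only [Function.comp_def] at this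
  fun_prop

lemma stepDensity_pos [NeZero μ] (hb : Continuous b) {t : ℝ} (ht : 0 < t) (x : E) :
    0 < stepDensity b μ t x := by
  unfold stepDensity
  rw [integral_pos_iff_support_of_nonneg (fun z => (stepKernel_pos ht z x).le)
    (integrable_stepKernel μ hb ht x)]
  have : Function.support (fun z => stepKernel b t z x) = Set.univ := by
    ext z; simp [(stepKernel_pos ht z x).ne']
  rw [this]
  exact (Measure.measure_univ_pos).2 (NeZero.ne μ)

lemma stepDensity_nonneg {t : ℝ} (ht : 0 < t) (x : E) : 0 ≤ stepDensity b μ t x :=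
  integral_nonneg fun z => (stepKernel_pos ht z x).le

lemma ofReal_stepDensity (hb : Continuous b) {t : ℝ} (ht : 0 < t) (x : E) :
    ENNReal.ofReal (stepDensity b μ t x) = ∫⁻ z, ENNReal.ofReal (stepKernel b t z x) ∂μ :=
  ofReal_integral_eq_lintegral_ofReal (integrable_stepKernel μ hb ht x)
    (.of_forall fun z => (stepKernel_pos ht z x).le)

lemma measurable_stepDensity_right (hb : Continuous b) (t : ℝ) :
    Measurable (stepDensity b μ t) :=
  (measurable_stepDensity μ hb).comp (f := fun x : E => (t, x)) (by fun_prop)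

lemma map_langevinStep (hb : Continuous b) {t : ℝ} (ht : 0 < t) :
    (μ.prod (stdGaussian E)).map (langevinStep b t)
      = volume.withDensity fun x => ENNReal.ofReal (stepDensity b μ t x) := by
  ext s hs
  have hk := (measurable_stepKernel_pair hb t).ennreal_ofReal
  rw [← lintegral_indicator_one hs, ← lintegral_indicator_one hs,
    lintegral_map (measurable_one.indicator hs) (measurable_langevinStep hb t),
    lintegral_langevinStep_pair hb ht μ (f := fun y => s.indicator 1 y.2)
      ((measurable_one.indicator hs).comp measurable_snd),
    lintegral_lintegral_swap, lintegral_withDensity_eq_lintegral_mul _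
      (measurable_stepDensity_right μ hb t).ennreal_ofReal (measurable_one.indicator hs)]
  · refine lintegral_congr fun x => ?_
    have hkx : Measurable fun z => ENNReal.ofReal (stepKernel b t z x) :=
      hk.comp (f := fun z => (z, x)) (by fun_prop)
    refine (lintegral_mul_const (s.indicator 1 x) hkx).trans ?_
    rw [Pi.mul_apply, ofReal_stepDensity μ hb ht]
  · exact (hk.mul ((measurable_one.indicator hs).comp measurable_snd)).aemeasurable

lemma integrable_langevinStep_iff (hb : Continuous b) {t : ℝ} (ht : 0 < t) {f : E → ℝ}
    (hf : Measurable f) :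
    Integrable (fun y => f (langevinStep b t y)) (μ.prod (stdGaussian E))
      ↔ Integrable (fun x => stepDensity b μ t x * f x) := by
  have h := integrable_map_measure (μ := μ.prod (stdGaussian E)) (f := langevinStep b t)
    hf.aestronglyMeasurable (measurable_langevinStep hb t).aemeasurable
  rw [map_langevinStep μ hb ht, integrable_withDensity_iff_integrable_smul'
    (measurable_stepDensity_right μ hb t).ennreal_ofReal (by simp)] at h
  rw [show (fun y : E × E => f (langevinStep b t y)) = f ∘ langevinStep b t from rfl, ← h]
  refine integrable_congr (.of_forall fun y => ?_)
  simp [ENNReal.toReal_ofReal (stepDensity_nonneg μ ht _)]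

lemma integral_langevinStep (hb : Continuous b) {t : ℝ} (ht : 0 < t) {f : E → ℝ}
    (hf : Measurable f) :
    ∫ y, f (langevinStep b t y) ∂(μ.prod (stdGaussian E))
      = ∫ x, stepDensity b μ t x * f x := by
  rw [← integral_map (f := f) (measurable_langevinStep hb t).aemeasurable hf.aestronglyMeasurable,
    map_langevinStep μ hb ht, integral_withDensity_eq_integral_toReal_smul
    (measurable_stepDensity_right μ hb t).ennreal_ofReal (by simp)]
  refine integral_congr_ae (.of_forall fun y => ?_)
  simp [ENNReal.toReal_ofReal (stepDensity_nonneg μ ht _)]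

lemma integrable_stepDensity (hb : Continuous b) {t : ℝ} (ht : 0 < t) :
    Integrable (stepDensity b μ t) := by
  simpa using (integrable_langevinStep_iff μ hb ht (f := fun _ => 1) measurable_const).1
    (integrable_const _)

lemma integral_stepDensity (hb : Continuous b) {t : ℝ} (ht : 0 < t) :
    ∫ x, stepDensity b μ t x = μ.real Set.univ := by
  have := integral_langevinStep μ hb ht (f := fun _ => 1) measurable_const
  simp only [mul_one] at this
  rw [← this]
  simp [measureReal_def, ← Set.univ_prod_univ, Measure.prod_prod]

lemma norm_stepKernel_smul_le {t : ℝ} (ht : 0 < t) (z x : E) :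
    ‖(-(stepKernel b t z x / (2 * t))) • (x - (z - t • b z))‖
      ≤ (4 * Real.pi * t) ^ (-(finrank ℝ E : ℝ) / 2) * (Real.sqrt t)⁻¹ := by
  rw [norm_smul, norm_neg, norm_div, Real.norm_of_nonneg (stepKernel_pos ht z x).le,
    Real.norm_of_nonneg (by positivity : (0 : ℝ) ≤ 2 * t)]
  refine le_trans (le_of_eq ?_) (norm_mul_heatKernel_le ht (x - (z - t • b z)))
  rw [stepKernel]; ring

lemma measurable_stepKernel_smul (hb : Continuous b) (t : ℝ) (x : E) :
    Measurable fun z => (-(stepKernel b t z x / (2 * t))) • (x - (z - t • b z)) := by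
  have := (measurable_stepKernel hb).comp (f := fun z : E => (t, z, x)) (by fun_prop)
  have hbm := hb.measurable
  simp only [Function.comp_def] at this
  fun_prop

lemma integrable_stepKernel_smul (hb : Continuous b) {t : ℝ} (ht : 0 < t) (x : E) :
    Integrable (fun z => (-(stepKernel b t z x / (2 * t))) • (x - (z - t • b z))) μ :=
  Integrable.of_bound (measurable_stepKernel_smul hb t x).aestronglyMeasurable _
    (.of_forall fun z => norm_stepKernel_smul_le ht z x)

/-- Differentiation under the integral sign. The dominating function is the uniform bound on the
gradient of the heat kernel, so `μ` needs no moments. -/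
lemma hasGradientAt_stepDensity (hb : Continuous b) {t : ℝ} (ht : 0 < t) (x : E) :
    HasGradientAt (stepDensity b μ t) (stepDensityGrad b μ t x) x := by
  rw [hasGradientAt_iff_hasFDerivAt]
  have h := hasFDerivAt_integral_of_dominated_of_fderiv_le (μ := μ) (𝕜 := ℝ)
    (F := fun x z => stepKernel b t z x) (x₀ := x) (s := Set.univ)
    (F' := fun x z => InnerProductSpace.toDual ℝ E
      ((-(stepKernel b t z x / (2 * t))) • (x - (z - t • b z))))
    (bound := fun _ => (4 * Real.pi * t) ^ (-(finrank ℝ E : ℝ) / 2) * (Real.sqrt t)⁻¹)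
    univ_mem (.of_forall fun x => (integrable_stepKernel μ hb ht x).aestronglyMeasurable)
    (integrable_stepKernel μ hb ht x)
    ((InnerProductSpace.toDual ℝ E).continuous.comp_aestronglyMeasurable
      (measurable_stepKernel_smul hb t x).aestronglyMeasurable)
    (.of_forall fun z x _ => by
      rw [LinearIsometryEquiv.norm_map]; exact norm_stepKernel_smul_le ht z x)
    (integrable_const _)
    (.of_forall fun z x _ => by
      have := (hasGradientAt_heatKernel t (x - (z - t • b z))).hasFDerivAt.comp x
        ((hasFDerivAt_id x).sub_const (z - t • b z))
      exact this)
  have e : ∫ z, InnerProductSpace.toDual ℝ E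
      ((-(stepKernel b t z x / (2 * t))) • (x - (z - t • b z))) ∂μ
      = InnerProductSpace.toDual ℝ E (stepDensityGrad b μ t x) :=
    ((InnerProductSpace.toDual ℝ E).toContinuousLinearEquiv.integral_comp_comm _)
  rw [e] at h
  exact h

lemma continuousOn_stepKernel (z : E) :
    ContinuousOn (fun y : ℝ × E => stepKernel b y.1 z y.2) (Set.Ioi 0 ×ˢ Set.univ) := by
  unfold stepKernel
  exact continuousOn_heatKernel.comp (f := fun y : ℝ × E => (y.1, y.2 - (z - y.1 • b z)))
    (by fun_prop) (fun y hy => ⟨hy.1, trivial⟩)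

lemma continuousOn_stepDensity (hb : Continuous b) :
    ContinuousOn (fun y : ℝ × E => stepDensity b μ y.1 y.2) (Set.Ioi 0 ×ˢ Set.univ) := by
  intro y₀ hy₀
  have h0 : (0 : ℝ) < y₀.1 := hy₀.1
  -- The kernel bound may blow up as `t → 0`, so domination is only local: for times above `y₀.1 /
  -- 2` the bound at `y₀.1 / 2` serves.
  have hU : Set.Ioi (y₀.1 / 2) ×ˢ (Set.univ : Set E) ∈ 𝓝 y₀ :=
    prod_mem_nhds (Ioi_mem_nhds (by linarith)) univ_mem
  refine ContinuousAt.continuousWithinAt (ContinuousOn.continuousAt ?_ hU)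
  refine continuousOn_of_dominated (bound := fun _ =>
    (4 * Real.pi * (y₀.1 / 2)) ^ (-(finrank ℝ E : ℝ) / 2)) ?_ ?_ (integrable_const _) ?_
  · exact fun y hy => (integrable_stepKernel μ hb ((half_pos h0).trans hy.1) y.2).aestronglyMeasurable
  · refine fun y hy => .of_forall fun z => ?_
    have hy1 : 0 < y.1 := (half_pos h0).trans hy.1
    rw [Real.norm_of_nonneg (stepKernel_pos hy1 _ _).le]
    refine (heatKernel_le hy1 _).trans ?_
    refine Real.rpow_le_rpow_of_nonpos (by positivity) ?_ ?_
    · have : y₀.1 / 2 < y.1 := hy.1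
      gcongr
    · exact div_nonpos_of_nonpos_of_nonneg (by simp) (by simp)
  · exact .of_forall fun z => (continuousOn_stepKernel (b := b) z).mono
      (Set.prod_mono (Set.Ioi_subset_Ioi (half_pos h0).le) subset_rfl)

lemma continuousOn_stepDensityGrad (hb : Continuous b) :
    ContinuousOn (fun y : ℝ × E => stepDensityGrad b μ y.1 y.2) (Set.Ioi 0 ×ˢ Set.univ) := by
  intro y₀ hy₀
  have h0 : (0 : ℝ) < y₀.1 := hy₀.1
  have hU : Set.Ioi (y₀.1 / 2) ×ˢ (Set.univ : Set E) ∈ 𝓝 y₀ :=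
    prod_mem_nhds (Ioi_mem_nhds (by linarith)) univ_mem
  refine ContinuousAt.continuousWithinAt (ContinuousOn.continuousAt ?_ hU)
  refine continuousOn_of_dominated (bound := fun _ =>
    (4 * Real.pi * (y₀.1 / 2)) ^ (-(finrank ℝ E : ℝ) / 2) * (Real.sqrt (y₀.1 / 2))⁻¹)
    ?_ ?_ (integrable_const _) ?_
  · exact fun y hy => (measurable_stepKernel_smul hb y.1 y.2).aestronglyMeasurable
  · refine fun y hy => .of_forall fun z => ?_
    have hy1 : 0 < y.1 := (half_pos h0).trans hy.1
    have hy2 : y₀.1 / 2 < y.1 := hy.1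
    refine (norm_stepKernel_smul_le hy1 _ _).trans ?_
    have h1 : 0 < Real.sqrt (y₀.1 / 2) := Real.sqrt_pos.2 (half_pos h0)
    gcongr ?_ * ?_
    · refine Real.rpow_le_rpow_of_nonpos (by positivity) (by gcongr) ?_
      exact div_nonpos_of_nonpos_of_nonneg (by simp) (by simp)
    · gcongr
  · refine .of_forall fun z => ?_
    have hk := (continuousOn_stepKernel (b := b) z).mono
      (Set.prod_mono (Set.Ioi_subset_Ioi (half_pos h0).le) (subset_refl (Set.univ : Set E)))
    refine ContinuousOn.smul (ContinuousOn.neg (hk.div (by fun_prop) ?_)) (by fun_prop)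
    intro y hy
    have hy1 : 0 < y.1 := (half_pos h0).trans hy.1
    positivity

/-- The score `∇ log` of `stepDensity`. -/
noncomputable def stepScore (b : E → E) (μ : Measure E) (t : ℝ) (x : E) : E :=
  (stepDensity b μ t x)⁻¹ • stepDensityGrad b μ t x

lemma hasGradientAt_log_stepDensity [NeZero μ] (hb : Continuous b) {t : ℝ} (ht : 0 < t) (x : E) :
    HasGradientAt (fun x => Real.log (stepDensity b μ t x)) (stepScore b μ t x) x := by
  have h := (hasGradientAt_stepDensity μ hb ht x).hasFDerivAt.log (stepDensity_pos μ hb ht x).ne'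
  rw [hasGradientAt_iff_hasFDerivAt]
  refine h.congr_fderiv ?_
  ext v
  simp [stepScore]

lemma measurable_stepScore (hb : Continuous b) :
    Measurable (fun y : ℝ × E => stepScore b μ y.1 y.2) :=
  (measurable_stepDensity μ hb).inv.smul (measurable_stepDensityGrad μ hb)

lemma measurable_stepScore_right (hb : Continuous b) (t : ℝ) : Measurable (stepScore b μ t) :=
  (measurable_stepScore μ hb).comp (f := fun x : E => (t, x)) (by fun_prop)

lemma continuousOn_stepScore [NeZero μ] (hb : Continuous b) :
    ContinuousOn (fun y : ℝ × E => stepScore b μ y.1 y.2) (Set.Ioi 0 ×ˢ Set.univ) :=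
  ((continuousOn_stepDensity μ hb).inv₀ fun y hy => (stepDensity_pos μ hb hy.1 y.2).ne').smul
    (continuousOn_stepDensityGrad μ hb)

lemma continuousOn_log_stepDensity [NeZero μ] (hb : Continuous b) :
    ContinuousOn (fun y : ℝ × E => Real.log (stepDensity b μ y.1 y.2))
      (Set.Ioi 0 ×ˢ Set.univ) :=
  (continuousOn_stepDensity μ hb).log fun y hy => (stepDensity_pos μ hb hy.1 y.2).ne'

/-- **Tweedie's formula**: the conditional mean of the noise given the end point of the step. -/
lemma integral_inner_noise_eq [NeZero μ] (hb : Continuous b) {t : ℝ} (ht : 0 < t) {f : E → E}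
    (hf : Measurable f)
    (hint : Integrable (fun y : E × E => ⟪f (langevinStep b t y), y.2⟫)
      (μ.prod (stdGaussian E))) :
    ∫ y, ⟪f (langevinStep b t y), (Real.sqrt (2 * t))⁻¹ • y.2⟫ ∂(μ.prod (stdGaussian E))
      = -∫ y, ⟪f (langevinStep b t y), stepScore b μ t (langevinStep b t y)⟫
          ∂(μ.prod (stdGaussian E)) := by
  have hs : 0 < Real.sqrt (2 * t) := Real.sqrt_pos.2 (by positivity)
  have hss : Real.sqrt (2 * t) * Real.sqrt (2 * t) = 2 * t := Real.mul_self_sqrt (by positivity)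
  have hbm := hb.measurable
  -- The rescaled noise is a function of the two ends of the step, namely minus the gradient, in the
  -- end point, of the logarithm of the transition density.
  set G : E × E → ℝ := fun y => ⟪f y.2, (2 * t)⁻¹ • (y.2 - (y.1 - t • b y.1))⟫ with hG
  have hGm : Measurable G := by
    refine Measurable.inner (by fun_prop) (by fun_prop)
  have e1 : ∀ y : E × E, ⟪f (langevinStep b t y), (Real.sqrt (2 * t))⁻¹ • y.2⟫
      = G (y.1, langevinStep b t y) := by
    intro y
    simp only [hG]
    congr 1
    rw [langevinStep, add_sub_cancel_left, smul_smul]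
    congr 1
    have : (2 * t)⁻¹ = (Real.sqrt (2 * t))⁻¹ * (Real.sqrt (2 * t))⁻¹ := by rw [← mul_inv, hss]
    rw [this, inv_mul_cancel_right₀ hs.ne']
  have hGi : Integrable (fun y => G (y.1, langevinStep b t y)) (μ.prod (stdGaussian E)) := by
    refine (hint.const_mul (Real.sqrt (2 * t))⁻¹).congr (.of_forall fun y => ?_)
    simp only [← e1, inner_smul_right]
  simp_rw [e1]
  rw [integral_langevinStep_pair hb ht μ hGm, integral_prod_symm _
      ((integrable_langevinStep_pair_iff hb ht μ hGm).1 hGi),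
    integral_langevinStep μ hb ht (f := fun x => ⟪f x, stepScore b μ t x⟫)
      (hf.inner (measurable_stepScore_right μ hb t)), ← integral_neg]
  refine integral_congr_ae (.of_forall fun x => ?_)
  have hq := (stepDensity_pos μ hb ht x).ne'
  simp only [hG, stepScore, inner_smul_right]
  -- The density times the score is the gradient of the density, that is, the kernel gradients
  -- averaged over the starting point.
  rw [mul_inv_cancel_left₀ hq, stepDensityGrad, ← integral_inner
    (integrable_stepKernel_smul μ hb ht x), ← integral_neg]
  refine integral_congr_ae (.of_forall fun z => ?_)
  simp only [inner_smul_right]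
  ring

end FiniteMeasure

end GaussianStep

/-! ### Growth bounds for compactly supported starting measures. -/

section CompactSupport

open Module Filter Topology
open scoped RealInnerProductSpace

variable {E : Type*} [NormedAddCommGroup E] [InnerProductSpace ℝ E] [FiniteDimensional ℝ E]

lemma continuous_of_norm_sub_le {F : Type*} [SeminormedAddCommGroup F] {b : E → F} {L : ℝ}
    (hb : ∀ x y, ‖b x - b y‖ ≤ L * ‖x - y‖) : Continuous b :=
  (LipschitzWith.of_dist_le' (K := L) fun x y => by
    simpa only [dist_eq_norm] using hb x y).continuous

lemma norm_le_of_norm_sub_le {b : E → E} {L : ℝ} (hb : ∀ x y, ‖b x - b y‖ ≤ L * ‖x - y‖) (x : E) :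
    ‖b x‖ ≤ ‖b 0‖ + L * ‖x‖ := by
  have h1 := hb x 0
  have h2 := norm_add_le (b x - b 0) (b 0)
  rw [sub_zero] at h1
  rw [sub_add_cancel] at h2
  linarith

/-- A function with Lipschitz gradient grows at most quadratically. -/
lemma exists_growth_of_gradient {V : E → ℝ} {V' : E → E} {L : ℝ} (hL : 0 ≤ L)
    (hV : ∀ x, HasGradientAt V (V' x) x) (hV' : ∀ x y, ‖V' x - V' y‖ ≤ L * ‖x - y‖) :
    ∃ C, 0 ≤ C ∧ ∀ x, |V x| ≤ C * (1 + ‖x‖ ^ 2) ∧ ‖V' x‖ ≤ C * (1 + ‖x‖) := by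
  have h1 := norm_le_of_norm_sub_le hV'
  have h2 : ∀ x, |V x - V 0| ≤ (‖V' 0‖ + L * ‖x‖) * ‖x‖ := by
    intro x
    have := (convex_closedBall (0 : E) ‖x‖).norm_image_sub_le_of_norm_hasFDerivWithin_le
      (f := V) (f' := fun x => InnerProductSpace.toDual ℝ E (V' x)) (C := ‖V' 0‖ + L * ‖x‖)
      (x := 0) (y := x) (fun z _ => (hV z).hasFDerivAt.hasFDerivWithinAt) (fun z hz => by
        rw [LinearIsometryEquiv.norm_map]
        refine (h1 z).trans ?_
        have : ‖z‖ ≤ ‖x‖ := by simpa using hz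
        gcongr) (by simp) (by simp)
    simpa using this
  refine ⟨|V 0| + ‖V' 0‖ + L, by positivity, fun x => ⟨?_, ?_⟩⟩
  · have h3 : |V x| ≤ |V x - V 0| + |V 0| := by
      simpa using abs_add_le (V x - V 0) (V 0)
    have h4 := h2 x
    nlinarith [norm_nonneg x, norm_nonneg (V' 0), abs_nonneg (V 0), sq_nonneg (‖x‖ - 1),
      mul_nonneg (norm_nonneg (V' 0)) (sq_nonneg (‖x‖ - 1)), mul_nonneg (abs_nonneg (V 0))
      (sq_nonneg ‖x‖), mul_nonneg (norm_nonneg (V' 0)) (sq_nonneg ‖x‖)]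
  · have := h1 x
    nlinarith [norm_nonneg x, norm_nonneg (V' 0), abs_nonneg (V 0),
      mul_nonneg (norm_nonneg (V' 0)) (norm_nonneg x), mul_nonneg (abs_nonneg (V 0))
      (norm_nonneg x)]

variable [MeasurableSpace E] [BorelSpace E]

/-- Uniformity over starting points in a ball and over bounded times leaves only the noise to
integrate, so that Gaussian moments suffice later. -/
lemma exists_growth_langevinStep {b : E → E} {L : ℝ} (hL : 0 ≤ L)
    (hb : ∀ x y, ‖b x - b y‖ ≤ L * ‖x - y‖) {R T : ℝ} (hR : 0 ≤ R) (hT : 0 ≤ T) :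
    ∃ A, 0 ≤ A ∧ ∀ z, ‖z‖ ≤ R → ‖b z‖ ≤ A ∧ (∀ r ∈ Set.Icc 0 T, ‖z - r • b z‖ ≤ A ∧
      ∀ ξ, ‖langevinStep b r (z, ξ)‖ ≤ A * (1 + ‖ξ‖)) := by
  set B := ‖b 0‖ + L * R with hB
  have hB0 : 0 ≤ B := by positivity
  refine ⟨R + T * B + B + Real.sqrt (2 * T), by positivity, fun z hz => ?_⟩
  have h1 : ‖b z‖ ≤ B := (norm_le_of_norm_sub_le hb z).trans (by rw [hB]; gcongr)
  have hT1 : 0 ≤ T * B := by positivity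
  have hs := Real.sqrt_nonneg (2 * T)
  refine ⟨by linarith, fun r hr => ?_⟩
  have h2 : ‖z - r • b z‖ ≤ R + T * B := by
    refine (norm_sub_le _ _).trans ?_
    rw [norm_smul, Real.norm_of_nonneg hr.1]
    have := hr.2
    gcongr
  refine ⟨by linarith, fun ξ => ?_⟩
  have h3 : ‖Real.sqrt (2 * r) • ξ‖ ≤ Real.sqrt (2 * T) * ‖ξ‖ := by
    rw [norm_smul, Real.norm_of_nonneg (Real.sqrt_nonneg _)]
    have := hr.2
    gcongr
  have h4 := norm_add_le (z - r • b z) (Real.sqrt (2 * r) • ξ)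
  simp only [langevinStep]
  nlinarith [norm_nonneg ξ, mul_nonneg hR (norm_nonneg ξ), mul_nonneg hT1 (norm_nonneg ξ),
    mul_nonneg hB0 (norm_nonneg ξ)]

variable {b : E → E} {L R : ℝ} {μ : Measure E} [IsFiniteMeasure μ]

/-- The logarithm of the density of a step started from a compactly supported measure grows at most
quadratically, and its gradient at most linearly, locally uniformly in the length of the step. -/
lemma exists_growth_stepDensity [NeZero μ] (hL : 0 ≤ L)
    (hb : ∀ x y, ‖b x - b y‖ ≤ L * ‖x - y‖) (hR : 0 ≤ R) (hμ : ∀ᵐ z ∂μ, ‖z‖ ≤ R) {a T : ℝ}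
    (ha : 0 < a) (haT : a ≤ T) :
    ∃ C, 0 ≤ C ∧ ∀ t ∈ Set.Icc a T, ∀ x, |Real.log (stepDensity b μ t x)| ≤ C * (1 + ‖x‖ ^ 2) ∧
      ‖stepScore b μ t x‖ ≤ C * (1 + ‖x‖) := by
  have hbc := continuous_of_norm_sub_le hb
  obtain ⟨A, hA0, hA⟩ := exists_growth_langevinStep hL hb hR (ha.le.trans haT)
  set m := μ.real Set.univ with hm
  have hm0 : 0 < m := by
    rw [hm, measureReal_def, ENNReal.toReal_pos_iff]
    exact ⟨(Measure.measure_univ_pos).2 (NeZero.ne μ), measure_lt_top _ _⟩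
  set n2 : ℝ := (finrank ℝ E : ℝ) / 2 with hn2
  have hn20 : 0 ≤ n2 := by positivity
  set K := n2 * (|Real.log (4 * Real.pi * a)| + |Real.log (4 * Real.pi * T)|) with hK
  have hK0 : 0 ≤ K := by positivity
  refine ⟨|Real.log m| + K + (1 + A ^ 2) / (2 * a) + (1 + A) / (2 * a), by positivity,
    fun t ht x => ?_⟩
  have ht0 : 0 < t := ha.trans_le ht.1
  -- The logarithm of the normalizing constant is monotone in `t`, hence controlled by its values at
  -- `a` and `T`.
  have hkap : ∃ κ, κ = Real.log ((4 * Real.pi * t) ^ (-(finrank ℝ E : ℝ) / 2)) ∧ |κ| ≤ K := by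
    refine ⟨_, rfl, ?_⟩
    rw [Real.log_rpow (by positivity), neg_div, neg_mul, abs_neg, abs_mul, ← hn2, abs_of_nonneg hn20,
      hK]
    gcongr
    rw [abs_le]
    have h1 : Real.log (4 * Real.pi * a) ≤ Real.log (4 * Real.pi * t) :=
      Real.log_le_log (by positivity) (by have := ht.1; gcongr)
    have h2 : Real.log (4 * Real.pi * t) ≤ Real.log (4 * Real.pi * T) :=
      Real.log_le_log (by positivity) (by have := ht.2; gcongr)
    constructor
    · linarith [neg_abs_le (Real.log (4 * Real.pi * a)), abs_nonneg (Real.log (4 * Real.pi * T))]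
    · linarith [le_abs_self (Real.log (4 * Real.pi * T)), abs_nonneg (Real.log (4 * Real.pi * a))]
  obtain ⟨κ, hκ, hκK⟩ := hkap
  have hc0 : 0 < (4 * Real.pi * t) ^ (-(finrank ℝ E : ℝ) / 2) := by positivity
  have hq := stepDensity_pos μ hbc ht0 x
  have hu : ∀ᵐ z ∂μ, ‖x - (z - t • b z)‖ ≤ ‖x‖ + A := by
    filter_upwards [hμ] with z hz
    exact (norm_sub_le _ _).trans (by
      have := ((hA z hz).2 t ⟨ht0.le, ht.2⟩).1
      gcongr)
  have hup : stepDensity b μ t x ≤ m * (4 * Real.pi * t) ^ (-(finrank ℝ E : ℝ) / 2) := by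
    have := integral_mono (integrable_stepKernel μ hbc ht0 x)
      (integrable_const ((4 * Real.pi * t) ^ (-(finrank ℝ E : ℝ) / 2)))
      (fun z => heatKernel_le ht0 (x - (z - t • b z)))
    simpa [stepDensity, hm] using this
  -- Almost every centre `z - t • b z` has norm at most `A`, so the kernel is at least its value at
  -- distance `‖x‖ + A`.
  have hlow : m * ((4 * Real.pi * t) ^ (-(finrank ℝ E : ℝ) / 2)
      * Real.exp (-(‖x‖ + A) ^ 2 / (4 * t))) ≤ stepDensity b μ t x := by
    have := integral_mono_ae (integrable_const ((4 * Real.pi * t) ^ (-(finrank ℝ E : ℝ) / 2)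
      * Real.exp (-(‖x‖ + A) ^ 2 / (4 * t)))) (integrable_stepKernel μ hbc ht0 x) (by
        filter_upwards [hu] with z hz
        simp only [stepKernel, heatKernel]
        gcongr)
    simpa [stepDensity, hm] using this
  have hsq : (‖x‖ + A) ^ 2 / (4 * t) ≤ (1 + A ^ 2) / (2 * a) * (1 + ‖x‖ ^ 2) := by
    calc (‖x‖ + A) ^ 2 / (4 * t) ≤ (‖x‖ + A) ^ 2 / (4 * a) := by
          have := ht.1
          gcongr
      _ ≤ (2 * ((1 + A ^ 2) * (1 + ‖x‖ ^ 2))) / (4 * a) := by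
          gcongr
          nlinarith [sq_nonneg (‖x‖ - A), sq_nonneg (‖x‖ * A)]
      _ = _ := by field_simp; ring
  constructor
  · have l1 : Real.log (stepDensity b μ t x) ≤ Real.log m + κ := by
      rw [hκ, ← Real.log_mul hm0.ne' hc0.ne']
      exact Real.log_le_log hq hup
    have l2 : Real.log m + κ - (‖x‖ + A) ^ 2 / (4 * t) ≤ Real.log (stepDensity b μ t x) := by
      have := Real.log_le_log (by positivity) hlow
      rw [Real.log_mul hm0.ne' (by positivity), Real.log_mul hc0.ne' (Real.exp_pos _).ne',
        Real.log_exp, ← hκ, neg_div] at this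
      linarith
    have l3 := abs_le.1 hκK
    have l4 : (|Real.log m| + K) * 1 ≤ (|Real.log m| + K) * (1 + ‖x‖ ^ 2) := by
      gcongr; nlinarith [norm_nonneg x]
    have l5 : 0 ≤ (1 + A) / (2 * a) * (1 + ‖x‖ ^ 2) := by positivity
    have l6 : 0 ≤ (1 + A ^ 2) / (2 * a) * (1 + ‖x‖ ^ 2) := by positivity
    rw [abs_le]
    constructor
    · linarith [neg_abs_le (Real.log m)]
    · linarith [le_abs_self (Real.log m)]
  -- The score is a kernel-weighted average of `-(x - (z - t • b z)) / (2t)`, and each of these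
  -- vectors has norm at most `(‖x‖ + A) / (2a)`.
  · have h1 : ‖stepDensityGrad b μ t x‖ ≤ (‖x‖ + A) / (2 * a) * stepDensity b μ t x := by
      unfold stepDensityGrad stepDensity
      rw [← integral_const_mul]
      refine norm_integral_le_of_norm_le ((integrable_stepKernel μ hbc ht0 x).const_mul _) ?_
      filter_upwards [hu] with z hz
      have hk := stepKernel_pos (b := b) ht0 z x
      rw [norm_smul, norm_neg, norm_div, Real.norm_of_nonneg hk.le,
        Real.norm_of_nonneg (by positivity : (0 : ℝ) ≤ 2 * t)]
      calc stepKernel b t z x / (2 * t) * ‖x - (z - t • b z)‖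
          ≤ stepKernel b t z x / (2 * a) * (‖x‖ + A) := by
            have := ht.1
            gcongr
        _ = _ := by ring
    have h2 : ‖stepScore b μ t x‖ ≤ (‖x‖ + A) / (2 * a) := by
      rw [stepScore, norm_smul, norm_inv, Real.norm_of_nonneg hq.le, inv_mul_le_iff₀ hq]
      linarith
    have h3 : (‖x‖ + A) / (2 * a) ≤ (1 + A) / (2 * a) * (1 + ‖x‖) := by
      rw [div_mul_eq_mul_div]
      gcongr
      nlinarith [norm_nonneg x, mul_nonneg hA0 (norm_nonneg x)]
    have h4 : 0 ≤ (|Real.log m| + K + (1 + A ^ 2) / (2 * a)) * (1 + ‖x‖) := by positivity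
    nlinarith

/-- Functions of quadratic growth in the noise are integrable. -/
lemma integrable_of_growth (hμ : ∀ᵐ z ∂μ, ‖z‖ ≤ R) {f : E × E → ℝ} {C : ℝ}
    (hf : Measurable f) (hC : ∀ y : E × E, ‖y.1‖ ≤ R → |f y| ≤ C * (1 + ‖y.2‖ ^ 2)) :
    Integrable f (μ.prod (stdGaussian E)) := by
  have h1 : Integrable (fun y : E × E => C * (1 + ‖y.2‖ ^ 2)) (μ.prod (stdGaussian E)) :=
    (((integrable_const 1).add (integrable_norm_pow_stdGaussian 2)).comp_snd μ).const_mul C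
  refine h1.mono' hf.aestronglyMeasurable ?_
  filter_upwards [Measure.quasiMeasurePreserving_fst.ae hμ] with y hy
  exact hC y hy

lemma continuousOn_integral_of_growth (hμ : ∀ᵐ z ∂μ, ‖z‖ ≤ R) {X : Type*} [TopologicalSpace X]
    [FirstCountableTopology X] {s : Set X} {f : X → E × E → ℝ} {C : ℝ}
    (hf : ∀ x ∈ s, Measurable (f x))
    (hC : ∀ x ∈ s, ∀ y : E × E, ‖y.1‖ ≤ R → |f x y| ≤ C * (1 + ‖y.2‖ ^ 2))
    (hcont : ∀ y, ContinuousOn (fun x => f x y) s) :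
    ContinuousOn (fun x => ∫ y, f x y ∂(μ.prod (stdGaussian E))) s := by
  have h1 : Integrable (fun y : E × E => C * (1 + ‖y.2‖ ^ 2)) (μ.prod (stdGaussian E)) :=
    (((integrable_const 1).add (integrable_norm_pow_stdGaussian 2)).comp_snd μ).const_mul C
  refine continuousOn_of_dominated (fun x hx => (hf x hx).aestronglyMeasurable) (fun x hx => ?_) h1
    (.of_forall hcont)
  filter_upwards [Measure.quasiMeasurePreserving_fst.ae hμ] with y hy
  exact hC x hx y hy

end CompactSupport

/-! ### Differential inequality for the free energy along a step. -/

section Dissipation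

open Module Filter Topology
open scoped RealInnerProductSpace

variable {E : Type*} [NormedAddCommGroup E] [InnerProductSpace ℝ E] [FiniteDimensional ℝ E]
  [MeasurableSpace E] [BorelSpace E]

/-- A drift `b` and a potential `V` with gradient `V'`, both `b` and `V'` being `L`-Lipschitz. -/
structure LipschitzDrift (b : E → E) (V : E → ℝ) (V' : E → E) (L : ℝ) : Prop where
  nonneg : 0 ≤ L
  drift : ∀ x y, ‖b x - b y‖ ≤ L * ‖x - y‖
  hasGradientAt : ∀ x, HasGradientAt V (V' x) x
  gradient : ∀ x y, ‖V' x - V' y‖ ≤ L * ‖x - y‖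

variable {b : E → E} {V : E → ℝ} {V' : E → E} {L R : ℝ} {μ : Measure E}

namespace LipschitzDrift

lemma continuous_drift (h : LipschitzDrift b V V' L) : Continuous b :=
  continuous_of_norm_sub_le h.drift

lemma continuous_gradient (h : LipschitzDrift b V V' L) : Continuous V' :=
  continuous_of_norm_sub_le h.gradient

lemma continuous_potential (h : LipschitzDrift b V V' L) : Continuous V :=
  continuous_iff_continuousAt.2 fun x => (h.hasGradientAt x).hasFDerivAt.continuousAt

end LipschitzDrift

/-- The velocity of the interpolation `r ↦ langevinStep b r y`. -/
noncomputable def stepVelocity (b : E → E) (r : ℝ) (y : E × E) : E :=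
  -b y.1 + (Real.sqrt (2 * r))⁻¹ • y.2

/-- With the noise held fixed the path is differentiable at positive times. Since `√(2r) ξ` has the
law of the Brownian increment at each single time, the ordinary chain rule along these paths does
the work of Itô's formula. -/
lemma hasDerivAt_langevinStep {r : ℝ} (hr : 0 < r) (y : E × E) :
    HasDerivAt (fun r => langevinStep b r y) (stepVelocity b r y) r := by
  have h1 : HasDerivAt (fun r : ℝ => Real.sqrt (2 * r)) (Real.sqrt (2 * r))⁻¹ r := by
    have := ((hasDerivAt_id r).const_mul 2).sqrt (by simp only [id]; positivity)
    simp only [id] at this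
    refine this.congr_deriv ?_
    have : 0 < Real.sqrt (2 * r) := Real.sqrt_pos.2 (by positivity)
    field_simp
  have h2 := (((hasDerivAt_id r).smul_const (b y.1)).const_sub y.1).add (h1.smul_const y.2)
  exact h2.congr_deriv (by simp [stepVelocity])

lemma measurable_stepVelocity (hb : Continuous b) (r : ℝ) : Measurable (stepVelocity b r) := by
  have := hb.measurable
  unfold stepVelocity; fun_prop

lemma continuousOn_stepVelocity (y : E × E) :
    ContinuousOn (fun r => stepVelocity b r y) (Set.Ioi 0) := by
  unfold stepVelocity
  refine continuousOn_const.add (ContinuousOn.smul (ContinuousOn.inv₀ (by fun_prop) ?_)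
    continuousOn_const)
  intro r hr
  have : (0 : ℝ) < r := hr
  positivity

variable [IsFiniteMeasure μ] [NeZero μ]

/-- Growth bounds in the noise for all the quantities evaluated along a step. -/
lemma LipschitzDrift.exists_growth (h : LipschitzDrift b V V' L) (hR : 0 ≤ R)
    (hμ : ∀ᵐ z ∂μ, ‖z‖ ≤ R) {a T : ℝ} (ha : 0 < a) (haT : a ≤ T) :
    ∃ C, 0 ≤ C ∧ ∀ t ∈ Set.Icc a T, ∀ r ∈ Set.Icc a T, ∀ y : E × E, ‖y.1‖ ≤ R →
      |Real.log (stepDensity b μ t (langevinStep b r y))| ≤ C * (1 + ‖y.2‖ ^ 2) ∧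
      |V (langevinStep b r y)| ≤ C * (1 + ‖y.2‖ ^ 2) ∧
      ‖stepScore b μ t (langevinStep b r y)‖ ≤ C * (1 + ‖y.2‖) ∧
      ‖V' (langevinStep b r y)‖ ≤ C * (1 + ‖y.2‖) ∧
      ‖stepVelocity b r y‖ ≤ C * (1 + ‖y.2‖) ∧ ‖b y.1‖ ≤ C := by
  obtain ⟨A, hA0, hA⟩ := exists_growth_langevinStep h.nonneg h.drift hR (ha.le.trans haT)
  obtain ⟨C₁, hC₁0, hC₁⟩ := exists_growth_of_gradient h.nonneg h.hasGradientAt h.gradient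
  obtain ⟨C₂, hC₂0, hC₂⟩ := exists_growth_stepDensity h.nonneg h.drift hR hμ ha haT
  set D := (Real.sqrt (2 * a))⁻¹ with hD
  have hD0 : 0 ≤ D := by positivity
  have hlin : ∀ r ∈ Set.Icc a T, ∀ y : E × E, ‖y.1‖ ≤ R →
      1 + ‖langevinStep b r y‖ ≤ (1 + A) * (1 + ‖y.2‖) := by
    intro r hr y hy
    have := ((hA y.1 hy).2 r ⟨ha.le.trans hr.1, hr.2⟩).2 y.2
    nlinarith [norm_nonneg y.2]
  have hquad : ∀ r ∈ Set.Icc a T, ∀ y : E × E, ‖y.1‖ ≤ R →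
      1 + ‖langevinStep b r y‖ ^ 2 ≤ (2 * (1 + A) ^ 2) * (1 + ‖y.2‖ ^ 2) := by
    intro r hr y hy
    have h1 := hlin r hr y hy
    have h2 : (1 + ‖langevinStep b r y‖) ^ 2 ≤ ((1 + A) * (1 + ‖y.2‖)) ^ 2 := by gcongr
    have h3 : (1 + ‖y.2‖) ^ 2 ≤ 2 * (1 + ‖y.2‖ ^ 2) := by nlinarith [sq_nonneg (1 - ‖y.2‖)]
    calc 1 + ‖langevinStep b r y‖ ^ 2 ≤ (1 + ‖langevinStep b r y‖) ^ 2 := by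
          nlinarith [norm_nonneg (langevinStep b r y)]
      _ ≤ ((1 + A) * (1 + ‖y.2‖)) ^ 2 := h2
      _ = (1 + A) ^ 2 * (1 + ‖y.2‖) ^ 2 := by ring
      _ ≤ (1 + A) ^ 2 * (2 * (1 + ‖y.2‖ ^ 2)) := by gcongr
      _ = _ := by ring
  set K := C₂ * (2 * (1 + A) ^ 2) + C₁ * (2 * (1 + A) ^ 2) + C₂ * (1 + A) + C₁ * (1 + A) + A + D
    with hK
  have k1 : 0 ≤ C₂ * (2 * (1 + A) ^ 2) := by positivity
  have k2 : 0 ≤ C₁ * (2 * (1 + A) ^ 2) := by positivity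
  have k3 : 0 ≤ C₂ * (1 + A) := by positivity
  have k4 : 0 ≤ C₁ * (1 + A) := by positivity
  refine ⟨K, by positivity, fun t ht r hr y hy => ⟨?_, ?_, ?_, ?_, ?_, ?_⟩⟩
  · calc _ ≤ C₂ * (1 + ‖langevinStep b r y‖ ^ 2) := (hC₂ t ht _).1
      _ ≤ C₂ * ((2 * (1 + A) ^ 2) * (1 + ‖y.2‖ ^ 2)) := by gcongr; exact hquad r hr y hy
      _ = (C₂ * (2 * (1 + A) ^ 2)) * (1 + ‖y.2‖ ^ 2) := by ring
      _ ≤ _ := by gcongr; linarith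
  · calc _ ≤ C₁ * (1 + ‖langevinStep b r y‖ ^ 2) := (hC₁ _).1
      _ ≤ C₁ * ((2 * (1 + A) ^ 2) * (1 + ‖y.2‖ ^ 2)) := by gcongr; exact hquad r hr y hy
      _ = (C₁ * (2 * (1 + A) ^ 2)) * (1 + ‖y.2‖ ^ 2) := by ring
      _ ≤ _ := by gcongr; linarith
  · calc _ ≤ C₂ * (1 + ‖langevinStep b r y‖) := (hC₂ t ht _).2
      _ ≤ C₂ * ((1 + A) * (1 + ‖y.2‖)) := by gcongr; exact hlin r hr y hy
      _ = (C₂ * (1 + A)) * (1 + ‖y.2‖) := by ring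
      _ ≤ _ := by gcongr; linarith
  · calc _ ≤ C₁ * (1 + ‖langevinStep b r y‖) := (hC₁ _).2
      _ ≤ C₁ * ((1 + A) * (1 + ‖y.2‖)) := by gcongr; exact hlin r hr y hy
      _ = (C₁ * (1 + A)) * (1 + ‖y.2‖) := by ring
      _ ≤ _ := by gcongr; linarith
  · have h1 : ‖(Real.sqrt (2 * r))⁻¹ • y.2‖ ≤ D * ‖y.2‖ := by
      rw [norm_smul, norm_inv, Real.norm_of_nonneg (Real.sqrt_nonneg _), hD]
      have := hr.1
      gcongr
    have h2 := norm_add_le (-b y.1) ((Real.sqrt (2 * r))⁻¹ • y.2)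
    rw [norm_neg] at h2
    have h3 := (hA y.1 hy).1
    calc _ ≤ A + D * ‖y.2‖ := by unfold stepVelocity; linarith
      _ ≤ (A + D) * (1 + ‖y.2‖) := by nlinarith [norm_nonneg y.2, mul_nonneg hA0 (norm_nonneg y.2)]
      _ ≤ _ := by gcongr; linarith
  · exact (hA y.1 hy).1.trans (by linarith)

/-- The time `t` of the frozen density and the time `r` of the law vary independently, and joint
continuity is needed near the diagonal. Around each point a compact square away from `0` carries a
single majorant. -/
lemma continuousOn_integral_two_parameters (hμ : ∀ᵐ z ∂μ, ‖z‖ ≤ R) {f : ℝ → ℝ → E × E → ℝ}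
    (hf : ∀ t r, 0 < t → 0 < r → Measurable (f t r))
    (hC : ∀ a T, 0 < a → a ≤ T → ∃ C, ∀ t ∈ Set.Icc a T, ∀ r ∈ Set.Icc a T, ∀ y : E × E,
      ‖y.1‖ ≤ R → |f t r y| ≤ C * (1 + ‖y.2‖ ^ 2))
    (hcont : ∀ y, ContinuousOn (fun p : ℝ × ℝ => f p.1 p.2 y) (Set.Ioi 0 ×ˢ Set.Ioi 0)) :
    ContinuousOn (fun p : ℝ × ℝ => ∫ y, f p.1 p.2 y ∂(μ.prod (stdGaussian E)))
      (Set.Ioi 0 ×ˢ Set.Ioi 0) := by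
  rintro ⟨t, r⟩ ⟨ht : 0 < t, hr : 0 < r⟩
  set a := min t r / 2 with ha
  set T := max t r + 1 with hT
  have hmin : 0 < min t r := lt_min ht hr
  have ha0 : 0 < a := half_pos hmin
  have hat : a < t := (half_lt_self hmin).trans_le (min_le_left _ _)
  have har : a < r := (half_lt_self hmin).trans_le (min_le_right _ _)
  have htT : t < T := (le_max_left _ _).trans_lt (lt_add_one _)
  have hrT : r < T := (le_max_right _ _).trans_lt (lt_add_one _)
  obtain ⟨C, hC⟩ := hC a T ha0 (hat.trans htT).le
  refine ContinuousAt.continuousWithinAt (ContinuousOn.continuousAt (s := Set.Icc a T ×ˢ Set.Icc a T)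
    ?_ (prod_mem_nhds (Icc_mem_nhds hat htT) (Icc_mem_nhds har hrT)))
  refine continuousOn_integral_of_growth (C := C) hμ (fun p hp => ?_) (fun p hp y hy => ?_)
    (fun y => ?_)
  · exact hf _ _ (ha0.trans_le hp.1.1) (ha0.trans_le hp.2.1)
  · exact hC _ hp.1 _ hp.2 y hy
  · exact (hcont y).mono (Set.prod_mono (fun x hx => ha0.trans_le hx.1)
      (fun x hx => ha0.trans_le hx.1))

lemma continuousOn_comp_langevinStep (hb : Continuous b) {F : Type*} [TopologicalSpace F]
    {f : ℝ → E → F} (hf : ContinuousOn (fun y : ℝ × E => f y.1 y.2) (Set.Ioi 0 ×ˢ Set.univ))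
    (y : E × E) :
    ContinuousOn (fun p : ℝ × ℝ => f p.1 (langevinStep b p.2 y)) (Set.Ioi 0 ×ˢ Set.Ioi 0) := by
  refine hf.comp (f := fun p : ℝ × ℝ => (p.1, langevinStep b p.2 y)) ?_ fun p hp => ⟨hp.1, trivial⟩
  have := (continuous_langevinStep hb).comp (f := fun r : ℝ => (r, y)) (by fun_prop)
  exact (continuous_fst.prodMk (this.comp continuous_snd)).continuousOn

/-- The free energy `∫ (log q_t + V)` along a step, the logarithmic density being frozen at time
`t` and the integral being with respect to the law at time `r`. -/
noncomputable def stepEnergy (b : E → E) (V : E → ℝ) (μ : Measure E) (t r : ℝ) : ℝ :=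
  ∫ y, (Real.log (stepDensity b μ t (langevinStep b r y)) + V (langevinStep b r y))
    ∂(μ.prod (stdGaussian E))

/-- The derivative of `stepEnergy` in `r`. -/
noncomputable def stepEnergyDeriv (b : E → E) (V' : E → E) (μ : Measure E) (t r : ℝ) : ℝ :=
  ∫ y, ⟪stepScore b μ t (langevinStep b r y) + V' (langevinStep b r y), stepVelocity b r y⟫
    ∂(μ.prod (stdGaussian E))

/-- The Fisher information of the law at time `t` of a step. -/
noncomputable def stepFisher (b : E → E) (V' : E → E) (μ : Measure E) (t : ℝ) : ℝ :=
  ∫ y, ‖stepScore b μ t (langevinStep b t y) + V' (langevinStep b t y)‖ ^ 2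
    ∂(μ.prod (stdGaussian E))

lemma mul_le_of_linear_growth {u v ξ C : ℝ} (hu0 : 0 ≤ u) (hv0 : 0 ≤ v)
    (hu : u ≤ C * (1 + ξ)) (hv : v ≤ C * (1 + ξ)) : u * v ≤ 2 * C ^ 2 * (1 + ξ ^ 2) := by
  have h0 := hu0.trans hu
  calc u * v ≤ (C * (1 + ξ)) * (C * (1 + ξ)) := by gcongr
    _ ≤ _ := by nlinarith [mul_nonneg (sq_nonneg C) (sq_nonneg (1 - ξ))]

namespace LipschitzDrift

lemma exists_bound_energy (h : LipschitzDrift b V V' L) (hR : 0 ≤ R) (hμ : ∀ᵐ z ∂μ, ‖z‖ ≤ R)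
    (a T : ℝ) (ha : 0 < a) (haT : a ≤ T) :
    ∃ C, ∀ t ∈ Set.Icc a T, ∀ r ∈ Set.Icc a T, ∀ y : E × E, ‖y.1‖ ≤ R →
      |Real.log (stepDensity b μ t (langevinStep b r y)) + V (langevinStep b r y)|
        ≤ C * (1 + ‖y.2‖ ^ 2) := by
  obtain ⟨C, hC0, hC⟩ := h.exists_growth hR hμ ha haT
  refine ⟨2 * C, fun t ht r hr y hy => ?_⟩
  obtain ⟨h1, h2, -⟩ := hC t ht r hr y hy
  exact (abs_add_le _ _).trans (by linarith)

lemma exists_bound_energyDeriv (h : LipschitzDrift b V V' L) (hR : 0 ≤ R)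
    (hμ : ∀ᵐ z ∂μ, ‖z‖ ≤ R) (a T : ℝ) (ha : 0 < a) (haT : a ≤ T) :
    ∃ C, ∀ t ∈ Set.Icc a T, ∀ r ∈ Set.Icc a T, ∀ y : E × E, ‖y.1‖ ≤ R →
      |⟪stepScore b μ t (langevinStep b r y) + V' (langevinStep b r y), stepVelocity b r y⟫|
        ≤ C * (1 + ‖y.2‖ ^ 2) := by
  obtain ⟨C, hC0, hC⟩ := h.exists_growth hR hμ ha haT
  refine ⟨2 * (2 * C) ^ 2, fun t ht r hr y hy => ?_⟩
  obtain ⟨-, -, h3, h4, h5, -⟩ := hC t ht r hr y hy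
  refine (abs_real_inner_le_norm _ _).trans (mul_le_of_linear_growth (norm_nonneg _) (norm_nonneg _)
    ((norm_add_le _ _).trans (by linarith)) ?_)
  have : 0 ≤ C * (1 + ‖y.2‖) := by positivity
  linarith

lemma exists_bound_fisher (h : LipschitzDrift b V V' L) (hR : 0 ≤ R)
    (hμ : ∀ᵐ z ∂μ, ‖z‖ ≤ R) (a T : ℝ) (ha : 0 < a) (haT : a ≤ T) :
    ∃ C, ∀ t ∈ Set.Icc a T, ∀ r ∈ Set.Icc a T, ∀ y : E × E, ‖y.1‖ ≤ R →
      |‖stepScore b μ t (langevinStep b r y) + V' (langevinStep b r y)‖ ^ 2|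
        ≤ C * (1 + ‖y.2‖ ^ 2) := by
  obtain ⟨C, hC0, hC⟩ := h.exists_growth hR hμ ha haT
  refine ⟨2 * (2 * C) ^ 2, fun t ht r hr y hy => ?_⟩
  obtain ⟨-, -, h3, h4, -⟩ := hC t ht r hr y hy
  have h5 := (norm_add_le (stepScore b μ t (langevinStep b r y)) (V' (langevinStep b r y)))
  rw [abs_of_nonneg (sq_nonneg _), sq]
  exact mul_le_of_linear_growth (norm_nonneg _) (norm_nonneg _) (by linarith) (by linarith)

lemma measurable_energy_integrand (h : LipschitzDrift b V V' L) (t r : ℝ) :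
    Measurable fun y => Real.log (stepDensity b μ t (langevinStep b r y))
      + V (langevinStep b r y) :=
  (((measurable_stepDensity_right μ h.continuous_drift t).comp
    (measurable_langevinStep h.continuous_drift r)).log).add
      (h.continuous_potential.measurable.comp (measurable_langevinStep h.continuous_drift r))

lemma measurable_score_integrand (h : LipschitzDrift b V V' L) (t r : ℝ) :
    Measurable fun y => stepScore b μ t (langevinStep b r y) + V' (langevinStep b r y) :=
  ((measurable_stepScore_right μ h.continuous_drift t).comp
    (measurable_langevinStep h.continuous_drift r)).add
      (h.continuous_gradient.measurable.comp (measurable_langevinStep h.continuous_drift r))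

lemma continuousOn_score_integrand (h : LipschitzDrift b V V' L) (y : E × E) :
    ContinuousOn (fun p : ℝ × ℝ => stepScore b μ p.1 (langevinStep b p.2 y)
      + V' (langevinStep b p.2 y)) (Set.Ioi 0 ×ˢ Set.Ioi 0) :=
  (continuousOn_comp_langevinStep h.continuous_drift
    (continuousOn_stepScore μ h.continuous_drift) y).add
    (continuousOn_comp_langevinStep (f := fun _ x => V' x) h.continuous_drift
      (h.continuous_gradient.comp continuous_snd).continuousOn y)

lemma continuousOn_stepEnergy (h : LipschitzDrift b V V' L) (hR : 0 ≤ R)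
    (hμ : ∀ᵐ z ∂μ, ‖z‖ ≤ R) :
    ContinuousOn (fun p : ℝ × ℝ => stepEnergy b V μ p.1 p.2) (Set.Ioi 0 ×ˢ Set.Ioi 0) :=
  continuousOn_integral_two_parameters hμ (fun t r _ _ => h.measurable_energy_integrand t r)
    (h.exists_bound_energy hR hμ) fun y =>
    (continuousOn_comp_langevinStep (f := fun t x => Real.log (stepDensity b μ t x))
      h.continuous_drift (continuousOn_log_stepDensity μ h.continuous_drift) y).add
    (continuousOn_comp_langevinStep (f := fun _ x => V x) h.continuous_drift
      (h.continuous_potential.comp continuous_snd).continuousOn y)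

lemma continuousOn_stepEnergyDeriv (h : LipschitzDrift b V V' L) (hR : 0 ≤ R)
    (hμ : ∀ᵐ z ∂μ, ‖z‖ ≤ R) :
    ContinuousOn (fun p : ℝ × ℝ => stepEnergyDeriv b V' μ p.1 p.2) (Set.Ioi 0 ×ˢ Set.Ioi 0) :=
  continuousOn_integral_two_parameters hμ
    (fun t r _ _ => (h.measurable_score_integrand t r).inner
      (measurable_stepVelocity h.continuous_drift r))
    (h.exists_bound_energyDeriv hR hμ) fun y => (h.continuousOn_score_integrand y).inner
      ((continuousOn_stepVelocity y).comp continuousOn_snd fun _ hp => hp.2)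

lemma continuousOn_stepFisher (h : LipschitzDrift b V V' L) (hR : 0 ≤ R)
    (hμ : ∀ᵐ z ∂μ, ‖z‖ ≤ R) : ContinuousOn (stepFisher b V' μ) (Set.Ioi 0) :=
  (continuousOn_integral_two_parameters hμ
    (f := fun t r y => ‖stepScore b μ t (langevinStep b r y) + V' (langevinStep b r y)‖ ^ 2)
    (fun t r _ _ => (h.measurable_score_integrand t r).norm.pow_const 2)
    (h.exists_bound_fisher hR hμ) fun y => (h.continuousOn_score_integrand y).norm.pow 2).comp
    (f := fun t : ℝ => (t, t)) (by fun_prop) fun t ht => ⟨ht, ht⟩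

/-- Gibbs' inequality, for the laws at two times of a step. -/
lemma stepEnergy_le (h : LipschitzDrift b V V' L) (hR : 0 ≤ R) (hμ : ∀ᵐ z ∂μ, ‖z‖ ≤ R)
    {t s : ℝ} (ht : 0 < t) (hs : 0 < s) : stepEnergy b V μ t s ≤ stepEnergy b V μ s s := by
  have hb := h.continuous_drift
  have hmin : 0 < min t s := lt_min ht hs
  obtain ⟨C, hC⟩ := h.exists_bound_energy hR hμ (min t s) (max t s) hmin
    ((min_le_left _ _).trans (le_max_left _ _))
  have htm : t ∈ Set.Icc (min t s) (max t s) := ⟨min_le_left _ _, le_max_left _ _⟩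
  have hsm : s ∈ Set.Icc (min t s) (max t s) := ⟨min_le_right _ _, le_max_right _ _⟩
  have i1 := integrable_of_growth hμ (h.measurable_energy_integrand t s) (hC t htm s hsm)
  have i2 := integrable_of_growth hμ (h.measurable_energy_integrand s s) (hC s hsm s hsm)
  have hmeas : Measurable fun x => Real.log (stepDensity b μ s x) + V x
      - (Real.log (stepDensity b μ t x) + V x) :=
    ((measurable_stepDensity_right μ hb s).log.add h.continuous_potential.measurable).sub
      ((measurable_stepDensity_right μ hb t).log.add h.continuous_potential.measurable)
  have i3 := (integrable_langevinStep_iff μ hb hs hmeas).1 (i2.sub i1)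
  have e3 := integral_langevinStep μ hb hs hmeas
  rw [integral_sub i2 i1] at e3
  -- This is `log u ≤ u - 1` at `u = q_t / q_s`, weighted by `q_s`. The potential cancels on the
  -- right, and the left side is `0` because both densities have the mass of `μ`.
  have hle : ∫ x, (stepDensity b μ s x - stepDensity b μ t x) ≤
      ∫ x, stepDensity b μ s x * (Real.log (stepDensity b μ s x) + V x
      - (Real.log (stepDensity b μ t x) + V x)) := by
    refine integral_mono ((integrable_stepDensity μ hb hs).sub (integrable_stepDensity μ hb ht)) i3
      fun x => ?_
    have h1 := stepDensity_pos μ hb hs x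
    have h2 := stepDensity_pos μ hb ht x
    have h3 := Real.log_le_sub_one_of_pos (div_pos h2 h1)
    rw [Real.log_div h2.ne' h1.ne'] at h3
    have h4 : stepDensity b μ s x * (stepDensity b μ t x / stepDensity b μ s x)
      = stepDensity b μ t x := mul_div_cancel₀ _ h1.ne'
    simp only
    nlinarith
  rw [integral_sub (integrable_stepDensity μ hb hs) (integrable_stepDensity μ hb ht),
    integral_stepDensity μ hb hs, integral_stepDensity μ hb ht, sub_self, ← e3] at hle
  exact sub_nonneg.1 hle

/-- With the logarithmic density frozen, only the path moves: no time derivative of the density is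
needed. -/
lemma hasDerivAt_stepEnergy (h : LipschitzDrift b V V' L) (hR : 0 ≤ R) (hμ : ∀ᵐ z ∂μ, ‖z‖ ≤ R)
    {t r : ℝ} (ht : 0 < t) (hr : 0 < r) :
    HasDerivAt (stepEnergy b V μ t) (stepEnergyDeriv b V' μ t r) r := by
  have hb := h.continuous_drift
  set a := min t r / 2 with ha
  set T := max t r + 1 with hT
  have hmin : 0 < min t r := lt_min ht hr
  have ha0 : 0 < a := half_pos hmin
  have hat : a < t := (half_lt_self hmin).trans_le (min_le_left _ _)
  have har : a < r := (half_lt_self hmin).trans_le (min_le_right _ _)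
  have htT : t < T := (le_max_left _ _).trans_lt (lt_add_one _)
  have hrT : r < T := (le_max_right _ _).trans_lt (lt_add_one _)
  obtain ⟨C₁, hC₁⟩ := h.exists_bound_energy hR hμ a T ha0 (hat.trans htT).le
  obtain ⟨C₂, hC₂⟩ := h.exists_bound_energyDeriv hR hμ a T ha0 (hat.trans htT).le
  have h1 : Integrable (fun y : E × E => C₂ * (1 + ‖y.2‖ ^ 2)) (μ.prod (stdGaussian E)) :=
    (((integrable_const 1).add (integrable_norm_pow_stdGaussian 2)).comp_snd μ).const_mul C₂
  refine (hasDerivAt_integral_of_dominated_loc_of_deriv_le (s := Set.Icc a T)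
    (bound := fun y => C₂ * (1 + ‖y.2‖ ^ 2)) (F := fun r y =>
      Real.log (stepDensity b μ t (langevinStep b r y)) + V (langevinStep b r y))
    (F' := fun r y => ⟪stepScore b μ t (langevinStep b r y) + V' (langevinStep b r y),
      stepVelocity b r y⟫) (Icc_mem_nhds har hrT)
    (.of_forall fun r => (h.measurable_energy_integrand t r).aestronglyMeasurable)
    (integrable_of_growth hμ (h.measurable_energy_integrand t r)
      (hC₁ t ⟨hat.le, htT.le⟩ r ⟨har.le, hrT.le⟩))
    ((h.measurable_score_integrand t r).inner (measurable_stepVelocity hb r)).aestronglyMeasurable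
    ?_ h1 ?_).2
  · filter_upwards [Measure.quasiMeasurePreserving_fst.ae hμ] with y hy r hr
    exact hC₂ t ⟨hat.le, htT.le⟩ r hr y hy
  · refine .of_forall fun y r hr => ?_
    have hr0 : 0 < r := ha0.trans_le hr.1
    have g1 := (hasGradientAt_log_stepDensity μ hb ht (langevinStep b r y)).hasFDerivAt.add
      (h.hasGradientAt (langevinStep b r y)).hasFDerivAt
    have g2 := g1.comp_hasDerivAt r (hasDerivAt_langevinStep hr0 y)
    refine g2.congr_deriv ?_
    simp [inner_add_left]

/-- The free energy along a step decreases at least at the rate given by `stepEnergyDeriv`. -/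
lemma stepEnergy_sub_le (h : LipschitzDrift b V V' L) (hR : 0 ≤ R) (hμ : ∀ᵐ z ∂μ, ‖z‖ ≤ R)
    {a T : ℝ} (ha : 0 < a) (haT : a ≤ T) :
    stepEnergy b V μ T T ≤ stepEnergy b V μ a a + ∫ r in a..T, stepEnergyDeriv b V' μ r r := by
  have hdiag : ContinuousOn (fun r => stepEnergyDeriv b V' μ r r) (Set.Ioi 0) :=
    (h.continuousOn_stepEnergyDeriv hR hμ).comp (f := fun t : ℝ => (t, t)) (by fun_prop)
      fun t ht => ⟨ht, ht⟩
  have hF : ContinuousOn (fun r => stepEnergy b V μ r r) (Set.Ioi 0) :=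
    (h.continuousOn_stepEnergy hR hμ).comp (f := fun t : ℝ => (t, t)) (by fun_prop)
      fun t ht => ⟨ht, ht⟩
  have hsub : Set.Icc a T ⊆ Set.Ioi 0 := fun x hx => ha.trans_le hx.1
  have hB : ∀ x ∈ Set.Icc a T, HasDerivAt (fun x => stepEnergy b V μ a a
      + ∫ r in a..x, stepEnergyDeriv b V' μ r r) (stepEnergyDeriv b V' μ x x) x := by
    intro x hx
    refine (intervalIntegral.integral_hasDerivAt_right ?_ ?_ ?_).const_add _
    · refine ContinuousOn.intervalIntegrable (hdiag.mono ?_)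
      rw [Set.uIcc_of_le hx.1]
      exact fun y hy => ha.trans_le hy.1
    · exact hdiag.stronglyMeasurableAtFilter isOpen_Ioi x (hsub hx)
    · exact hdiag.continuousAt (Ioi_mem_nhds (hsub hx))
  -- Differentiability of the energy on the diagonal is not available; a bound on its right
  -- difference quotients is enough for the comparison.
  refine image_le_of_liminf_slope_right_le_deriv_boundary (hF.mono hsub) (by simp)
    (fun x hx => (hB x hx).continuousAt.continuousWithinAt)
    (fun x hx => (hB x ⟨hx.1, hx.2.le⟩).hasDerivWithinAt) ?_ (Set.right_mem_Icc.2 haT)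
  intro x hx r hxr
  have hx0 : 0 < x := hsub ⟨hx.1, hx.2.le⟩
  have hcont : ContinuousAt (fun p : ℝ × ℝ => stepEnergyDeriv b V' μ p.1 p.2) (x, x) :=
    (h.continuousOn_stepEnergyDeriv hR hμ).continuousAt
      (prod_mem_nhds (Ioi_mem_nhds hx0) (Ioi_mem_nhds hx0))
  obtain ⟨ε, hε, hball⟩ := Metric.mem_nhds_iff.1 (hcont.eventually (gt_mem_nhds hxr))
  refine Eventually.frequently ?_
  filter_upwards [Ioo_mem_nhdsGT (lt_add_of_pos_right x hε)] with z hz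
  have hz0 : 0 < z := hx0.trans hz.1
  -- The mean value theorem is applied in the law variable, with the density frozen at the later
  -- time `z`. This choice makes Gibbs' inequality point the right way: the true increment from `x`
  -- to `z` is at most the frozen one.
  obtain ⟨ρ, hρ, hρs⟩ := exists_hasDerivAt_eq_slope (stepEnergy b V μ z)
    (stepEnergyDeriv b V' μ z) hz.1
    (fun y hy => (h.hasDerivAt_stepEnergy hR hμ hz0
      (hx0.trans_le hy.1)).continuousAt.continuousWithinAt)
    (fun y hy => h.hasDerivAt_stepEnergy hR hμ hz0 (hx0.trans hy.1))
  have hlt : stepEnergyDeriv b V' μ z ρ < r := by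
    have h1 := hz.2
    have h2 := hz.1
    have h3 := hρ.1
    have h4 := hρ.2
    have hm : (z, ρ) ∈ Metric.ball (x, x) ε := by
      rw [Metric.mem_ball, Prod.dist_eq, max_lt_iff, Real.dist_eq, Real.dist_eq, abs_lt, abs_lt]
      constructor <;> constructor <;> simp only <;> linarith
    exact hball hm
  refine lt_of_le_of_lt ?_ hlt
  rw [hρs, slope_def_field]
  have h1 := h.stepEnergy_le hR hμ hz0 hx0
  have h2 : 0 < z - x := sub_pos.2 hz.1
  gcongr

end LipschitzDrift

end Dissipation

/-! ### Quantitative dissipation rate. -/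

section DissipationBound

open Module Filter Topology
open scoped RealInnerProductSpace

variable {E : Type*} [NormedAddCommGroup E] [InnerProductSpace ℝ E] [FiniteDimensional ℝ E]
  [MeasurableSpace E] [BorelSpace E]

/-- Vector fields of linear growth in the noise, uniformly for starting points of norm at most
`R`. -/
structure LinearGrowth (R : ℝ) (u : E × E → E) : Prop where
  measurable : Measurable u
  bound : ∃ C, 0 ≤ C ∧ ∀ y, ‖y.1‖ ≤ R → ‖u y‖ ≤ C * (1 + ‖y.2‖)

namespace LinearGrowth

variable {R : ℝ} {u v : E × E → E} {μ : Measure E} [IsFiniteMeasure μ]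

lemma add (hu : LinearGrowth R u) (hv : LinearGrowth R v) :
    LinearGrowth R (fun y => u y + v y) := by
  obtain ⟨C, hC0, hC⟩ := hu.bound
  obtain ⟨D, hD0, hD⟩ := hv.bound
  refine ⟨hu.measurable.add hv.measurable, C + D, by positivity, fun y hy => ?_⟩
  exact (norm_add_le _ _).trans (by linarith [hC y hy, hD y hy])

lemma const_smul (hu : LinearGrowth R u) (c : ℝ) : LinearGrowth R (fun y => c • u y) := by
  obtain ⟨C, hC0, hC⟩ := hu.bound
  refine ⟨hu.measurable.const_smul c, |c| * C, by positivity, fun y hy => ?_⟩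
  rw [norm_smul, Real.norm_eq_abs, mul_assoc]
  gcongr
  exact hC y hy

lemma sub (hu : LinearGrowth R u) (hv : LinearGrowth R v) :
    LinearGrowth R (fun y => u y - v y) := by
  simpa [sub_eq_add_neg] using hu.add (hv.const_smul (-1))

lemma snd : LinearGrowth R (fun y : E × E => y.2) :=
  ⟨measurable_snd, 1, zero_le_one, fun y _ => by linarith [norm_nonneg y.2]⟩

lemma integrable_inner (hu : LinearGrowth R u) (hv : LinearGrowth R v)
    (hμ : ∀ᵐ z ∂μ, ‖z‖ ≤ R) :
    Integrable (fun y => ⟪u y, v y⟫) (μ.prod (stdGaussian E)) := by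
  obtain ⟨C, hC0, hC⟩ := hu.bound
  obtain ⟨D, hD0, hD⟩ := hv.bound
  refine integrable_of_growth (C := 2 * (C + D) ^ 2) hμ (hu.measurable.inner hv.measurable)
    fun y hy => (abs_real_inner_le_norm _ _).trans (mul_le_of_linear_growth (norm_nonneg _)
      (norm_nonneg _) ((hC y hy).trans ?_) ((hD y hy).trans ?_))
  · gcongr; linarith
  · gcongr; linarith

lemma integrable_norm_sq (hu : LinearGrowth R u) (hμ : ∀ᵐ z ∂μ, ‖z‖ ≤ R) :
    Integrable (fun y => ‖u y‖ ^ 2) (μ.prod (stdGaussian E)) := by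
  simpa only [real_inner_self_eq_norm_sq] using hu.integrable_inner hu hμ

/-- The noise is centered and independent of the starting point. -/
lemma integral_inner_noise {w : E → E} (hw : LinearGrowth R fun y : E × E => w y.1)
    (hμ : ∀ᵐ z ∂μ, ‖z‖ ≤ R) :
    ∫ y, ⟪w y.1, y.2⟫ ∂(μ.prod (stdGaussian E)) = 0 := by
  rw [integral_prod _ (hw.integrable_inner snd hμ)]
  have : ∀ z, ∫ ξ, ⟪w z, ξ⟫ ∂(stdGaussian E) = 0 := by
    intro z
    rw [integral_inner (f := fun ξ : E => ξ) IsGaussian.integrable_id, integral_id_stdGaussian,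
      inner_zero_right]
  simp [this]

end LinearGrowth

namespace LipschitzDrift

variable {b : E → E} {V : E → ℝ} {V' : E → E} {L R δ : ℝ} {μ : Measure E} [IsFiniteMeasure μ]
  [NeZero μ]

lemma prod_stdGaussian_real_univ :
    (μ.prod (stdGaussian E)).real Set.univ = μ.real Set.univ := by
  simp [measureReal_def, ← Set.univ_prod_univ, Measure.prod_prod]

lemma integral_norm_sq_noise :
    ∫ y, ‖y.2‖ ^ 2 ∂(μ.prod (stdGaussian E)) = μ.real Set.univ * finrank ℝ E := by
  rw [integral_fun_snd (f := fun ξ : E => ‖ξ‖ ^ 2), integral_norm_sq_stdGaussian, smul_eq_mul]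

lemma linearGrowth (h : LipschitzDrift b V V' L) (hR : 0 ≤ R) (hμ : ∀ᵐ z ∂μ, ‖z‖ ≤ R)
    {t : ℝ} (ht : 0 < t) :
    LinearGrowth R (fun y => stepScore b μ t (langevinStep b t y)) ∧
    LinearGrowth R (fun y => V' (langevinStep b t y)) ∧
    LinearGrowth R (fun y : E × E => b y.1) := by
  have hb := h.continuous_drift
  obtain ⟨C, hC0, hC⟩ := h.exists_growth hR hμ ht le_rfl
  have htt : t ∈ Set.Icc t t := ⟨le_rfl, le_rfl⟩
  refine ⟨⟨(measurable_stepScore_right μ hb t).comp (measurable_langevinStep hb t), C, hC0,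
    fun y hy => (hC t htt t htt y hy).2.2.1⟩,
    ⟨h.continuous_gradient.measurable.comp (measurable_langevinStep hb t), C, hC0,
      fun y hy => (hC t htt t htt y hy).2.2.2.1⟩,
    ⟨hb.measurable.comp measurable_fst, C, hC0, fun y hy => ?_⟩⟩
  refine (hC t htt t htt y hy).2.2.2.2.2.trans ?_
  nlinarith [norm_nonneg y.2]

/-- The second moment of the gradient of the potential is controlled by the Fisher information. -/
lemma integral_norm_sq_gradient_le (h : LipschitzDrift b V V' L) (hR : 0 ≤ R)
    (hμ : ∀ᵐ z ∂μ, ‖z‖ ≤ R) {t : ℝ} (ht : 0 < t) :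
    ∫ y, ‖V' (langevinStep b t y)‖ ^ 2 ∂(μ.prod (stdGaussian E))
      ≤ stepFisher b V' μ t + 2 * (L * (μ.real Set.univ * finrank ℝ E)) := by
  have hb := h.continuous_drift
  obtain ⟨gs, gv, gβ⟩ := h.linearGrowth hR hμ ht
  have hs0 : 0 < Real.sqrt (2 * t) := Real.sqrt_pos.2 (by positivity)
  have gξ : LinearGrowth R (fun y : E × E => y.2) := LinearGrowth.snd
  have gh : LinearGrowth R (fun y : E × E => V' (y.1 - t • b y.1)) := by
    obtain ⟨A, hA0, hA⟩ := exists_growth_langevinStep h.nonneg h.drift hR ht.le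
    refine ⟨h.continuous_gradient.measurable.comp (measurable_fst.sub
      ((hb.measurable.comp measurable_fst).const_smul t)), ‖V' 0‖ + L * A,
      by have := h.nonneg; positivity, fun y hy => ?_⟩
    have h1 := norm_le_of_norm_sub_le h.gradient (y.1 - t • b y.1)
    have h2 := ((hA y.1 hy).2 t ⟨ht.le, le_rfl⟩).1
    have h3 := mul_le_mul_of_nonneg_left h2 h.nonneg
    have h4 : 0 ≤ ‖V' 0‖ + L * A := by have := h.nonneg; positivity
    nlinarith [mul_nonneg h4 (norm_nonneg y.2)]
  -- Tweedie's formula stands in for an integration by parts: minus the correlation of `V'` with the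
  -- score becomes its correlation with the noise.
  have e1 := integral_inner_noise_eq (μ := μ) hb ht h.continuous_gradient.measurable
    (gv.integrable_inner gξ hμ)
  have e2 : ∫ y, ⟪V' (langevinStep b t y), (Real.sqrt (2 * t))⁻¹ • y.2⟫ ∂(μ.prod (stdGaussian E))
      ≤ L * (μ.real Set.univ * finrank ℝ E) := by
    have e3 := LinearGrowth.integral_inner_noise (w := fun z => V' (z - t • b z)) gh hμ
    -- As the noise is centred, the value of `V'` at the noiseless end point can be subtracted. The
    -- Lipschitz bound on the difference then brings a factor `√(2t)` that cancels the inverse one.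
    have e4 : ∫ y, ⟪V' (langevinStep b t y), (Real.sqrt (2 * t))⁻¹ • y.2⟫
          ∂(μ.prod (stdGaussian E))
        = ∫ y, ⟪V' (langevinStep b t y) - V' (y.1 - t • b y.1), (Real.sqrt (2 * t))⁻¹ • y.2⟫
          ∂(μ.prod (stdGaussian E)) := by
      simp only [inner_sub_left, inner_smul_right]
      rw [integral_const_mul, integral_const_mul, integral_sub (gv.integrable_inner gξ hμ)
        (gh.integrable_inner gξ hμ), e3, sub_zero]
    rw [e4, ← integral_norm_sq_noise (μ := μ), ← integral_const_mul]
    refine integral_mono ((gv.sub gh).integrable_inner (gξ.const_smul _) hμ)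
      ((gξ.integrable_norm_sq hμ).const_mul L) fun y => ?_
    refine (real_inner_le_norm _ _).trans ?_
    have h1 := h.gradient (langevinStep b t y) (y.1 - t • b y.1)
    rw [langevinStep, add_sub_cancel_left, norm_smul, Real.norm_of_nonneg hs0.le] at h1
    rw [norm_smul, norm_inv, Real.norm_of_nonneg hs0.le, langevinStep]
    calc _ ≤ (L * (Real.sqrt (2 * t) * ‖y.2‖)) * ((Real.sqrt (2 * t))⁻¹ * ‖y.2‖) := by gcongr
      _ = _ := by field_simp
  have e5 : stepFisher b V' μ t ≥ ∫ y, (‖V' (langevinStep b t y)‖ ^ 2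
      + 2 * ⟪V' (langevinStep b t y), stepScore b μ t (langevinStep b t y)⟫)
        ∂(μ.prod (stdGaussian E)) := by
    refine integral_mono ((gv.integrable_norm_sq hμ).add ((gv.integrable_inner gs hμ).const_mul 2))
      ((gs.add gv).integrable_norm_sq hμ) fun y => ?_
    simp only
    rw [norm_add_sq_real, real_inner_comm]
    nlinarith [sq_nonneg ‖stepScore b μ t (langevinStep b t y)‖]
  rw [integral_add (gv.integrable_norm_sq hμ) ((gv.integrable_inner gs hμ).const_mul 2),
    integral_const_mul] at e5
  linarith

/-- Dissipation of the free energy along a step. -/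
lemma stepEnergyDeriv_le (h : LipschitzDrift b V V' L) (hR : 0 ≤ R) (hμ : ∀ᵐ z ∂μ, ‖z‖ ≤ R)
    (hμ1 : μ.real Set.univ ≤ 1) (hδ : ∀ x, ‖b x - V' x‖ ≤ δ) {t : ℝ} (ht : 0 < t)
    (htL : t * L ≤ 1 / Real.sqrt 32) :
    stepEnergyDeriv b V' μ t t
      ≤ -(1 / 4) * stepFisher b V' μ t + (3 * δ ^ 2 + 6 * (finrank ℝ E * L ^ 2 * t)) := by
  have hb := h.continuous_drift
  have hL := h.nonneg
  obtain ⟨gs, gv, gβ⟩ := h.linearGrowth hR hμ ht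
  have hst : Real.sqrt (2 * t) ^ 2 = 2 * t := Real.sq_sqrt (by positivity)
  have gξ : LinearGrowth R (fun y : E × E => y.2) := LinearGrowth.snd
  set M := μ.prod (stdGaussian E) with hM
  set I := stepFisher b V' μ t with hI
  set J := ∫ y, ‖V' (langevinStep b t y)‖ ^ 2 ∂M with hJ
  set D := ∫ y, ‖V' (langevinStep b t y) - b y.1‖ ^ 2 ∂M with hD
  set Q := ∫ y, ‖Real.sqrt (2 * t) • y.2 - t • b y.1‖ ^ 2 ∂M with hQ
  set B := ∫ y, ‖b y.1‖ ^ 2 ∂M with hB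
  set c := μ.real Set.univ with hc
  set n : ℝ := (finrank ℝ E : ℝ) with hn
  have hc0 : 0 ≤ c := measureReal_nonneg
  have hn0 : 0 ≤ n := by positivity
  have hI0 : 0 ≤ I := integral_nonneg fun y => sq_nonneg _
  have hD0 : 0 ≤ D := integral_nonneg fun y => sq_nonneg _
  have hJI : J ≤ I + 2 * (L * (c * n)) := h.integral_norm_sq_gradient_le hR hμ ht
  have hBJ : B ≤ 2 * J + 2 * D := by
    rw [hB, hJ, hD, ← integral_const_mul, ← integral_const_mul,
      ← integral_add ((gv.integrable_norm_sq hμ).const_mul 2)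
        (((gv.sub gβ).integrable_norm_sq hμ).const_mul 2)]
    refine integral_mono (gβ.integrable_norm_sq hμ) (((gv.integrable_norm_sq hμ).const_mul 2).add
        (((gv.sub gβ).integrable_norm_sq hμ).const_mul 2)) fun y => ?_
    simp only
    have h1 : ‖b y.1‖ ≤ ‖V' (langevinStep b t y)‖ + ‖V' (langevinStep b t y) - b y.1‖ := by
      have := norm_sub_le (V' (langevinStep b t y)) (V' (langevinStep b t y) - b y.1)
      simpa using this
    nlinarith [norm_nonneg (b y.1),
      sq_nonneg (‖V' (langevinStep b t y)‖ - ‖V' (langevinStep b t y) - b y.1‖)]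
  have hQB : Q = t ^ 2 * B + 2 * t * (c * n) := by
    have e0 := LinearGrowth.integral_inner_noise (w := b) gβ hμ
    have e1 : ∀ y : E × E, ‖Real.sqrt (2 * t) • y.2 - t • b y.1‖ ^ 2
        = (t ^ 2 * ‖b y.1‖ ^ 2 + 2 * t * ‖y.2‖ ^ 2)
          + (-(2 * Real.sqrt (2 * t) * t)) * ⟪b y.1, y.2⟫ := by
      intro y
      rw [norm_sub_sq_real, norm_smul, norm_smul, mul_pow, mul_pow, Real.norm_eq_abs, sq_abs, hst,
        Real.norm_eq_abs, sq_abs, inner_smul_left, inner_smul_right, real_inner_comm]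
      simp only [conj_trivial]
      ring
    have i1 : Integrable (fun y : E × E => t ^ 2 * ‖b y.1‖ ^ 2 + 2 * t * ‖y.2‖ ^ 2) M :=
      ((gβ.integrable_norm_sq hμ).const_mul _).add ((gξ.integrable_norm_sq hμ).const_mul _)
    rw [hQ]
    simp_rw [e1]
    rw [integral_add i1 ((gβ.integrable_inner gξ hμ).const_mul _),
      integral_add ((gβ.integrable_norm_sq hμ).const_mul _)
        ((gξ.integrable_norm_sq hμ).const_mul _), integral_const_mul, integral_const_mul,
      integral_const_mul, e0, integral_norm_sq_noise]
    ring
  -- `V'(x_t) - b(z)` is `V'(x_t) - V'(z)`, Lipschitz in the displacement, plus `V'(z) - b(z)`, of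
  -- norm at most `δ`.
  have hDQ : D ≤ 2 * δ ^ 2 * c + 2 * L ^ 2 * Q := by
    have gq := (gξ.const_smul (Real.sqrt (2 * t))).sub (gβ.const_smul t)
    have e1 : ∫ _ : E × E, (2 * δ ^ 2) ∂M = 2 * δ ^ 2 * c := by
      rw [integral_const, hM, prod_stdGaussian_real_univ, smul_eq_mul, mul_comm]
    rw [hD, hQ, ← e1, ← integral_const_mul, ← integral_add (integrable_const _)
      ((gq.integrable_norm_sq hμ).const_mul _)]
    refine integral_mono ((gv.sub gβ).integrable_norm_sq hμ) ((integrable_const _).add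
      ((gq.integrable_norm_sq hμ).const_mul _)) fun y => ?_
    simp only
    have h1 := h.gradient (langevinStep b t y) y.1
    have h2 := hδ y.1
    have h3 : langevinStep b t y - y.1 = Real.sqrt (2 * t) • y.2 - t • b y.1 := by
      rw [langevinStep]; abel
    rw [h3] at h1
    have h4 : ‖V' (langevinStep b t y) - b y.1‖
        ≤ L * ‖Real.sqrt (2 * t) • y.2 - t • b y.1‖ + δ := by
      have := norm_sub_le (V' (langevinStep b t y) - V' y.1) (b y.1 - V' y.1)
      rw [sub_sub_sub_cancel_right] at this
      linarith
    have h5 : ‖V' (langevinStep b t y) - b y.1‖ ^ 2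
        ≤ (L * ‖Real.sqrt (2 * t) • y.2 - t • b y.1‖ + δ) ^ 2 := by gcongr
    nlinarith [sq_nonneg (L * ‖Real.sqrt (2 * t) • y.2 - t • b y.1‖ - δ)]
  -- Tweedie's formula replaces the noise part of the velocity by minus the score. The integrand
  -- becomes `-‖s + v‖² + ⟪s + v, v - β⟫`, and Young's inequality gives the two halves.
  have hH : stepEnergyDeriv b V' μ t t ≤ -(1 / 2) * I + 1 / 2 * D := by
    have e1 := integral_inner_noise_eq (μ := μ) hb ht
      ((measurable_stepScore_right μ hb t).add h.continuous_gradient.measurable)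
      ((gs.add gv).integrable_inner gξ hμ)
    simp only [Pi.add_apply] at e1
    have i1 : Integrable (fun y =>
        -⟪stepScore b μ t (langevinStep b t y) + V' (langevinStep b t y), b y.1⟫) M :=
      ((gs.add gv).integrable_inner gβ hμ).neg
    have e2 : stepEnergyDeriv b V' μ t t
        = ∫ y, (-⟪stepScore b μ t (langevinStep b t y) + V' (langevinStep b t y), b y.1⟫
          - ⟪stepScore b μ t (langevinStep b t y) + V' (langevinStep b t y),
            stepScore b μ t (langevinStep b t y)⟫) ∂M := by
      rw [integral_sub i1
        ((gs.add gv).integrable_inner gs hμ), sub_eq_add_neg, ← e1, stepEnergyDeriv,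
        ← integral_add i1
        ((gs.add gv).integrable_inner (gξ.const_smul _) hμ)]
      simp only [stepVelocity, inner_add_right, inner_neg_right, hM]
    rw [e2, hI, stepFisher, hD, ← integral_const_mul, ← integral_const_mul, ← hM,
      ← integral_add (((gs.add gv).integrable_norm_sq hμ).const_mul _)
        (((gv.sub gβ).integrable_norm_sq hμ).const_mul _)]
    refine integral_mono (i1.sub
        ((gs.add gv).integrable_inner gs hμ))
        ((((gs.add gv).integrable_norm_sq hμ).const_mul _).add
        (((gv.sub gβ).integrable_norm_sq hμ).const_mul _)) fun y => ?_
    simp only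
    generalize stepScore b μ t (langevinStep b t y) = s
    generalize V' (langevinStep b t y) = v
    generalize b y.1 = β
    have h1 := norm_sub_sq_real (s + v) (v - β)
    have h2 : ⟪s + v, v - β⟫ = ‖s + v‖ ^ 2 - ⟪s + v, β⟫ - ⟪s + v, s⟫ := by
      rw [← real_inner_self_eq_norm_sq, inner_sub_right, inner_add_right]
      ring
    nlinarith [sq_nonneg ‖s + v - (v - β)‖]
  -- The bounds are circular: `D` is controlled by `Q`, `Q` by `B`, and `B` by `I` and `D` again.
  -- With `τ² ≤ 1/32` they combine to `D ≤ 2δ² + (I + D)/8 + 6w`, so `D / 2` costs at most `I / 14`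
  -- and `-I/2` still leaves `-I/4`.
  set τ := t * L with hτ
  have hτ0 : 0 ≤ τ := by positivity
  have hτ2 : τ ^ 2 ≤ 1 / 32 := by
    calc τ ^ 2 ≤ (1 / Real.sqrt 32) ^ 2 := by gcongr
      _ = 1 / 32 := by rw [div_pow, Real.sq_sqrt (by norm_num)]; norm_num
  have hτ4 : τ ≤ 1 / 4 := by nlinarith
  set w := n * L ^ 2 * t with hw
  have hw0 : 0 ≤ w := by positivity
  have k1 : L ^ 2 * Q = τ ^ 2 * B + 2 * (w * c) := by rw [hQB, hτ, hw]; ring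
  have k2 : τ ^ 2 * B ≤ τ ^ 2 * (2 * I + 2 * D) + 4 * (τ * (w * c)) := by
    have : τ ^ 2 * B ≤ τ ^ 2 * (2 * (I + 2 * (L * (c * n))) + 2 * D) := by
      gcongr; linarith
    refine this.trans (le_of_eq ?_)
    rw [hτ, hw]; ring
  have k3 : τ ^ 2 * (2 * I + 2 * D) ≤ 1 / 32 * (2 * I + 2 * D) := by gcongr
  have k4 : w * c ≤ w := mul_le_of_le_one_right hw0 hμ1
  have k5 : τ * (w * c) ≤ 1 / 4 * w := by gcongr
  have k6 : δ ^ 2 * c ≤ δ ^ 2 := mul_le_of_le_one_right (sq_nonneg δ) hμ1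
  nlinarith [sq_nonneg δ]

end LipschitzDrift

end DissipationBound

/-! ### Entropy near time zero and the integrated inequality. -/

section InitialTime

open Module Filter Topology
open scoped RealInnerProductSpace

variable {E : Type*} [NormedAddCommGroup E] [InnerProductSpace ℝ E] [FiniteDimensional ℝ E]
  [MeasurableSpace E] [BorelSpace E] {b : E → E} {V : E → ℝ} {V' : E → E} {L R δ : ℝ}

lemma heatKernel_le_of_norm_le {t : ℝ} (ht : 0 < t) {u w : E} (h : ‖w‖ ≤ ‖u‖) :
    heatKernel t u ≤ heatKernel t w := by
  unfold heatKernel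
  gcongr

/-- Banach's fixed point theorem for `z ↦ x + t • b z`. The solution serves as the centre of the
transition density seen as a function of the starting point. -/
lemma exists_sub_smul_eq (hb : ∀ x y, ‖b x - b y‖ ≤ L * ‖x - y‖) {t : ℝ}
    (ht : 0 ≤ t) (htL : t * L < 1) (x : E) : ∃ z, z - t • b z = x := by
  have hc : ContractingWith (Real.toNNReal (t * L)) (fun z => x + t • b z) := by
    refine ⟨by rwa [Real.toNNReal_lt_one], LipschitzWith.of_dist_le' fun y z => ?_⟩
    rw [dist_eq_norm, dist_eq_norm, add_sub_add_left_eq_sub, ← smul_sub, norm_smul,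
      Real.norm_of_nonneg ht, mul_assoc]
    gcongr
    exact hb y z
  refine ⟨hc.fixedPoint, ?_⟩
  have := hc.fixedPoint_isFixedPt
  rw [sub_eq_iff_eq_add]
  exact this.symm

/-- The transition density has mass at most `(1 - t L)⁻ⁿ` in the starting point. -/
lemma lintegral_stepKernel_le (hb : ∀ x y, ‖b x - b y‖ ≤ L * ‖x - y‖) {t : ℝ}
    (ht : 0 < t) (htL : t * L < 1) (x : E) :
    ∫⁻ z, ENNReal.ofReal (stepKernel b t z x)
      ≤ ENNReal.ofReal (((1 - t * L) ^ finrank ℝ E)⁻¹) := by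
  obtain ⟨w, hw⟩ := exists_sub_smul_eq hb ht.le htL x
  have hk : 0 < 1 - t * L := by linarith
  -- The map `z ↦ z - t • b z` shrinks distances by a factor no smaller than `1 - t * L`.
  -- Integrating the rescaled heat kernel then produces the power of that factor.
  have h1 : ∀ z, stepKernel b t z x ≤ heatKernel t ((1 - t * L) • (z - w)) := by
    intro z
    refine heatKernel_le_of_norm_le ht ?_
    rw [norm_smul, Real.norm_of_nonneg hk.le, ← hw]
    have h2 : (w - t • b w) - (z - t • b z) = (w - z) - t • (b w - b z) := by
      rw [smul_sub]; abel
    have h3 := norm_sub_norm_le (w - z) (t • (b w - b z))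
    rw [norm_smul, Real.norm_of_nonneg ht.le] at h3
    have h4 := mul_le_mul_of_nonneg_left (hb w z) ht.le
    rw [h2, norm_sub_rev z w]
    nlinarith
  have hint : Integrable (fun z : E => heatKernel t ((1 - t * L) • z)) := by
    have := (integrable_heatKernel_sub ht (0 : E)).comp_smul hk.ne'
    simpa using this
  calc ∫⁻ z, ENNReal.ofReal (stepKernel b t z x)
      ≤ ∫⁻ z, ENNReal.ofReal (heatKernel t ((1 - t * L) • (z - w))) :=
        lintegral_mono fun z => ENNReal.ofReal_le_ofReal (h1 z)
    _ = ∫⁻ z : E, ENNReal.ofReal (heatKernel t ((1 - t * L) • z)) :=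
        lintegral_sub_right_eq_self (fun z => ENNReal.ofReal (heatKernel t ((1 - t * L) • z))) w
    _ = ENNReal.ofReal (∫ z : E, heatKernel t ((1 - t * L) • z)) :=
        (ofReal_integral_eq_lintegral_ofReal hint
          (.of_forall fun z => (heatKernel_pos ht _).le)).symm
    _ = _ := by
        have := integral_heatKernel_sub ht (0 : E)
        simp only [sub_zero] at this
        rw [Measure.integral_comp_smul, this, smul_eq_mul, mul_one, abs_of_pos (by positivity)]

variable {μ : Measure E} [IsFiniteMeasure μ] {q₀ : E → ℝ}

namespace LipschitzDrift

/-- The entropy of the law of a short step exceeds the initial entropy by at most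
`-n log (1 - t L)`. -/
lemma integral_log_stepDensity_le [NeZero μ] (h : LipschitzDrift b V V' L) (hR : 0 ≤ R)
    (hμ : ∀ᵐ z ∂μ, ‖z‖ ≤ R) (hq₀ : Measurable q₀)
    (hμq : μ = volume.withDensity fun x => ENNReal.ofReal (q₀ x))
    (hlog : Integrable (fun z => Real.log (q₀ z)) μ) {t : ℝ} (ht : 0 < t) (htL : t * L < 1) :
    ∫ y, Real.log (stepDensity b μ t (langevinStep b t y)) ∂(μ.prod (stdGaussian E))
      ≤ ∫ z, Real.log (q₀ z) ∂μ - μ.real Set.univ * (finrank ℝ E * Real.log (1 - t * L)) := by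
  have hb := h.continuous_drift
  have hk : 0 < 1 - t * L := by linarith
  set K := ((1 - t * L) ^ finrank ℝ E)⁻¹ with hK
  have hK0 : 0 < K := by positivity
  set q := stepDensity b μ t with hq
  have hqm : Measurable q := measurable_stepDensity_right μ hb t
  have hqpos : ∀ x, 0 < q x := stepDensity_pos μ hb ht
  have hkm := (measurable_stepKernel_pair hb t).ennreal_ofReal
  have hposμ : ∀ᵐ z ∂μ, 0 < q₀ z := by
    rw [hμq, ae_withDensity_iff hq₀.ennreal_ofReal]
    refine .of_forall fun z hz => ?_
    by_contra hn
    exact hz (ENNReal.ofReal_of_nonpos (not_lt.1 hn))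
  -- The entropies are compared through `log g ≤ g - 1`. In the mean of `g`, the factor `q₀` cancels
  -- against the density of `μ`, which leaves the mass of the kernel in the starting point, at most
  -- `K`.
  set g : E × E → ℝ := fun y => q (langevinStep b t y) / (K * q₀ y.1) with hg
  have hgm : Measurable g := (hqm.comp (measurable_langevinStep hb t)).div
    ((hq₀.comp measurable_fst).const_mul K)
  have hqint : ∫⁻ x, ENNReal.ofReal (q x) = ENNReal.ofReal (μ.real Set.univ) := by
    rw [← ofReal_integral_eq_lintegral_ofReal (integrable_stepDensity μ hb ht)
      (.of_forall fun x => (hqpos x).le), integral_stepDensity μ hb ht]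
  have hgl : ∫⁻ y, ENNReal.ofReal (g y) ∂(μ.prod (stdGaussian E))
      ≤ ENNReal.ofReal (μ.real Set.univ) := by
    have hf : Measurable fun y : E × E => ENNReal.ofReal (q y.2 / (K * q₀ y.1)) :=
      ((hqm.comp measurable_snd).div ((hq₀.comp measurable_fst).const_mul K)).ennreal_ofReal
    have e1 := lintegral_langevinStep_pair hb ht μ hf
    have hinner : Measurable fun z => ∫⁻ x, ENNReal.ofReal (stepKernel b t z x)
        * ENNReal.ofReal (q x / (K * q₀ z)) := (hkm.mul hf).lintegral_prod_right'
    have e2 : ∫⁻ z, (∫⁻ x, ENNReal.ofReal (stepKernel b t z x)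
        * ENNReal.ofReal (q x / (K * q₀ z))) ∂μ
        = ∫⁻ z, ENNReal.ofReal (q₀ z) * ∫⁻ x, ENNReal.ofReal (stepKernel b t z x)
        * ENNReal.ofReal (q x / (K * q₀ z)) := by
      conv_lhs => rw [hμq]
      rw [lintegral_withDensity_eq_lintegral_mul _ hq₀.ennreal_ofReal hinner]
      rfl
    have hKq : Measurable fun x => ENNReal.ofReal (q x / K) := (hqm.div_const K).ennreal_ofReal
    calc ∫⁻ y, ENNReal.ofReal (g y) ∂(μ.prod (stdGaussian E))
        = ∫⁻ z, ENNReal.ofReal (q₀ z) * ∫⁻ x, ENNReal.ofReal (stepKernel b t z x)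
          * ENNReal.ofReal (q x / (K * q₀ z)) := e1.trans e2
      _ ≤ ∫⁻ z, ∫⁻ x, ENNReal.ofReal (stepKernel b t z x) * ENNReal.ofReal (q x / K) := by
          refine lintegral_mono fun z => ?_
          -- There is no cancellation where `q₀ z ≤ 0`, but there the left side is `0`.
          rcases le_or_gt (q₀ z) 0 with hz | hz
          · simp [ENNReal.ofReal_of_nonpos hz]
          · have hx : Measurable fun x => ENNReal.ofReal (stepKernel b t z x)
              * ENNReal.ofReal (q x / (K * q₀ z)) :=
              (measurable_heatKernel_sub t (z - t • b z)).ennreal_ofReal.mul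
                (hqm.div_const _).ennreal_ofReal
            rw [← lintegral_const_mul _ hx]
            refine lintegral_mono fun x => le_of_eq ?_
            rw [mul_left_comm, ← ENNReal.ofReal_mul hz.le]
            congr 2
            field_simp
      _ = ∫⁻ x, ∫⁻ z, ENNReal.ofReal (stepKernel b t z x) * ENNReal.ofReal (q x / K) :=
          lintegral_lintegral_swap (hkm.mul (hKq.comp measurable_snd)).aemeasurable
      _ ≤ ∫⁻ x, ENNReal.ofReal (q x) := by
          refine lintegral_mono fun x => ?_
          have hx : Measurable fun z => ENNReal.ofReal (stepKernel b t z x) :=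
            ((measurable_stepKernel hb).comp (f := fun z : E => (t, z, x))
              (by fun_prop)).ennreal_ofReal
          rw [lintegral_mul_const _ hx]
          calc _ ≤ ENNReal.ofReal K * ENNReal.ofReal (q x / K) := by
                gcongr; exact lintegral_stepKernel_le h.drift ht htL x
            _ = _ := by rw [← ENNReal.ofReal_mul hK0.le, mul_div_cancel₀ _ hK0.ne']
      _ = _ := hqint
  have hg0 : 0 ≤ᵐ[μ.prod (stdGaussian E)] g := by
    filter_upwards [Measure.quasiMeasurePreserving_fst.ae hposμ] with y hy
    have := hqpos (langevinStep b t y)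
    simp only [Pi.zero_apply, hg]
    positivity
  have hgi : Integrable g (μ.prod (stdGaussian E)) := by
    refine ⟨hgm.aestronglyMeasurable, ?_⟩
    rw [hasFiniteIntegral_iff_ofReal hg0]
    exact hgl.trans_lt ENNReal.ofReal_lt_top
  have hgint : ∫ y, g y ∂(μ.prod (stdGaussian E)) ≤ μ.real Set.univ := by
    rw [integral_eq_lintegral_of_nonneg_ae hg0 hgm.aestronglyMeasurable]
    exact ENNReal.toReal_le_of_le_ofReal measureReal_nonneg hgl
  have i1 : Integrable (fun y : E × E => Real.log (q₀ y.1)) (μ.prod (stdGaussian E)) :=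
    hlog.comp_fst _
  have i2 : Integrable (fun y => Real.log (q (langevinStep b t y))) (μ.prod (stdGaussian E)) := by
    obtain ⟨C, hC0, hC⟩ := h.exists_growth hR hμ ht le_rfl
    exact integrable_of_growth hμ ((hqm.comp (measurable_langevinStep hb t)).log)
      fun y hy => (hC t ⟨le_rfl, le_rfl⟩ t ⟨le_rfl, le_rfl⟩ y hy).1
  have i3 : Integrable (fun y : E × E => Real.log (q₀ y.1)
      - Real.log (q (langevinStep b t y))) (μ.prod (stdGaussian E)) := i1.sub i2
  have key : ∫ y, (1 - g y) ∂(μ.prod (stdGaussian E))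
      ≤ ∫ y, (Real.log (q₀ y.1) - Real.log (q (langevinStep b t y)) + Real.log K)
        ∂(μ.prod (stdGaussian E)) := by
    refine integral_mono_ae ((integrable_const 1).sub hgi) (i3.add (integrable_const _)) ?_
    filter_upwards [Measure.quasiMeasurePreserving_fst.ae hposμ] with y hy
    have h1 := hqpos (langevinStep b t y)
    have hy' : 0 < q₀ y.1 := hy
    have h2 := Real.log_le_sub_one_of_pos (div_pos h1 (mul_pos hK0 hy'))
    rw [Real.log_div h1.ne' (mul_pos hK0 hy').ne', Real.log_mul hK0.ne' hy'.ne'] at h2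
    simp only [hg]
    linarith
  rw [integral_sub (integrable_const 1) hgi, integral_add i3 (integrable_const _),
    integral_sub i1 i2, integral_const, integral_const, prod_stdGaussian_real_univ,
    integral_fun_fst (f := fun z => Real.log (q₀ z))] at key
  have hlK : Real.log K = -(finrank ℝ E * Real.log (1 - t * L)) := by
    rw [hK, Real.log_inv, Real.log_pow]
  simp only [probReal_univ, smul_eq_mul, hlK, one_mul, mul_one] at key
  linarith

/-- The potential part of the free energy is continuous up to time `0` included, while the entropy
part is only bounded above there. -/
lemma continuousOn_integral_potential (h : LipschitzDrift b V V' L) (hR : 0 ≤ R)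
    (hμ : ∀ᵐ z ∂μ, ‖z‖ ≤ R) {T : ℝ} (hT : 0 ≤ T) :
    ContinuousOn (fun t => ∫ y, V (langevinStep b t y) ∂(μ.prod (stdGaussian E)))
      (Set.Icc 0 T) := by
  have hb := h.continuous_drift
  obtain ⟨A, hA0, hA⟩ := exists_growth_langevinStep h.nonneg h.drift hR hT
  obtain ⟨C, hC0, hC⟩ := exists_growth_of_gradient h.nonneg h.hasGradientAt h.gradient
  refine continuousOn_integral_of_growth (C := C * (1 + 2 * A ^ 2)) hμ
    (fun t _ => h.continuous_potential.measurable.comp (measurable_langevinStep hb t))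
    (fun t ht y hy => ?_) fun y => ?_
  · refine (hC _).1.trans ?_
    rw [mul_assoc]
    gcongr
    have h1 := ((hA y.1 hy).2 t ht).2 y.2
    have h2 : ‖langevinStep b t y‖ ^ 2 ≤ (A * (1 + ‖y.2‖)) ^ 2 := by gcongr
    nlinarith [sq_nonneg ‖y.2‖, mul_nonneg (sq_nonneg A) (sq_nonneg (1 - ‖y.2‖))]
  · exact (h.continuous_potential.comp ((continuous_langevinStep hb).comp
      (f := fun t : ℝ => (t, y)) (by fun_prop))).continuousOn

/-- The entropy dissipation inequality for a step started from a compactly supported measure of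
finite entropy. -/
lemma lintegral_stepFisher_le [NeZero μ] (h : LipschitzDrift b V V' L) (hR : 0 ≤ R)
    (hμ : ∀ᵐ z ∂μ, ‖z‖ ≤ R) (hμ1 : μ.real Set.univ ≤ 1) (hδ : ∀ x, ‖b x - V' x‖ ≤ δ)
    (hq₀ : Measurable q₀) (hμq : μ = volume.withDensity fun x => ENNReal.ofReal (q₀ x))
    (hlog : Integrable (fun z => Real.log (q₀ z)) μ) {T : ℝ} (hT : 0 < T)
    (hTL : T * L ≤ 1 / Real.sqrt 32) :
    0 ≤ 4 * ∫ z, (Real.log (q₀ z) + V z) ∂μ - 4 * stepEnergy b V μ T T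
        + 4 * T * (3 * δ ^ 2 + 6 * (finrank ℝ E * L ^ 2 * T)) ∧
    ∫⁻ t in Set.Ioc 0 T, ENNReal.ofReal (stepFisher b V' μ t)
      ≤ ENNReal.ofReal (4 * ∫ z, (Real.log (q₀ z) + V z) ∂μ - 4 * stepEnergy b V μ T T
        + 4 * T * (3 * δ ^ 2 + 6 * (finrank ℝ E * L ^ 2 * T))) := by
  have hb := h.continuous_drift
  have hL := h.nonneg
  set c := μ.real Set.univ with hc
  set W : ℝ := 3 * δ ^ 2 + 6 * (finrank ℝ E * L ^ 2 * T) with hW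
  have hW0 : 0 ≤ W := by positivity
  have hTL1 : T * L < 1 := by
    refine hTL.trans_lt ?_
    rw [div_lt_one (by positivity)]
    exact Real.lt_sqrt_of_sq_lt (by norm_num)
  set Φ : ℝ → ℝ := fun t => ∫ y, V (langevinStep b t y) ∂(μ.prod (stdGaussian E)) with hΦ
  -- An upper bound for the free energy at time `a` that tends to the initial free energy as `a →
  -- 0`. Dissipation is integrated from `a > 0` and the limit is taken last.
  set e : ℝ → ℝ := fun a => (∫ z, Real.log (q₀ z) ∂μ - c * (finrank ℝ E * Real.log (1 - a * L)))
    + Φ a with he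
  have hVint : Integrable V μ := by
    obtain ⟨C, hC0, hC⟩ := exists_growth_of_gradient hL h.hasGradientAt h.gradient
    refine Integrable.of_bound (C := C * (1 + R ^ 2))
      h.continuous_potential.aestronglyMeasurable ?_
    filter_upwards [hμ] with z hz
    refine (hC z).1.trans ?_
    gcongr
  have hΦ0 : Φ 0 = ∫ z, V z ∂μ := by
    simp only [hΦ, langevinStep, zero_smul, sub_zero, mul_zero, Real.sqrt_zero, add_zero]
    rw [integral_fun_fst (f := V)]
    simp
  have he0 : Tendsto e (𝓝[>] 0) (𝓝 (∫ z, (Real.log (q₀ z) + V z) ∂μ)) := by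
    have h1 : Tendsto Φ (𝓝[>] 0) (𝓝 (Φ 0)) :=
      ((h.continuousOn_integral_potential hR hμ hT.le) 0 ⟨le_rfl, hT.le⟩).mono_left
        (nhdsWithin_le_of_mem (by
          filter_upwards [Ioo_mem_nhdsGT hT] with x hx using ⟨hx.1.le, hx.2.le⟩))
    have h2 : Tendsto (fun a : ℝ => Real.log (1 - a * L)) (𝓝[>] 0) (𝓝 0) := by
      have : ContinuousAt (fun a : ℝ => Real.log (1 - a * L)) 0 :=
        ContinuousAt.log (by fun_prop) (by norm_num)
      have h3 := this.tendsto
      simp only [zero_mul, sub_zero, Real.log_one] at h3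
      exact h3.mono_left nhdsWithin_le_nhds
    have h4 := (((h2.const_mul (finrank ℝ E : ℝ)).const_mul c).const_sub
      (∫ z, Real.log (q₀ z) ∂μ)).add h1
    rw [integral_add hlog hVint, ← hΦ0]
    simpa using h4
  -- The sign of the bound is kept because the final energy must later be moved to the left side,
  -- and `ENNReal.ofReal` is additive only on nonnegative numbers.
  have hstep : ∀ a ∈ Set.Ioc 0 T, 0 ≤ 4 * e a - 4 * stepEnergy b V μ T T + 4 * T * W ∧ ∫⁻ t in Set.Ioc a T, ENNReal.ofReal (stepFisher b V' μ t)
      ≤ ENNReal.ofReal (4 * e a - 4 * stepEnergy b V μ T T + 4 * T * W) := by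
    rintro a ⟨ha, haT⟩
    have hcontI : ContinuousOn (stepFisher b V' μ) (Set.Icc a T) :=
      (h.continuousOn_stepFisher hR hμ).mono fun x hx => ha.trans_le hx.1
    have hintI : IntervalIntegrable (stepFisher b V' μ) volume a T :=
      ContinuousOn.intervalIntegrable (by rwa [Set.uIcc_of_le haT])
    have hintD : IntervalIntegrable (fun t => stepEnergyDeriv b V' μ t t) volume a T := by
      refine ContinuousOn.intervalIntegrable ?_
      rw [Set.uIcc_of_le haT]
      exact (h.continuousOn_stepEnergyDeriv hR hμ).comp (f := fun t : ℝ => (t, t)) (by fun_prop)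
        fun t ht => ⟨ha.trans_le ht.1, ha.trans_le ht.1⟩
    have h1 := h.stepEnergy_sub_le hR hμ ha haT
    have h2 : ∫ t in a..T, stepEnergyDeriv b V' μ t t
        ≤ ∫ t in a..T, (-(1 / 4) * stepFisher b V' μ t + W) := by
      refine intervalIntegral.integral_mono_on haT hintD
        ((hintI.const_mul _).add intervalIntegrable_const) fun t ht => ?_
      have ht0 : 0 < t := ha.trans_le ht.1
      refine (h.stepEnergyDeriv_le hR hμ hμ1 hδ ht0 ?_).trans ?_
      · exact (mul_le_mul_of_nonneg_right ht.2 hL).trans hTL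
      · have := ht.2
        rw [hW]
        gcongr
    rw [intervalIntegral.integral_add (hintI.const_mul _) intervalIntegrable_const,
      intervalIntegral.integral_const_mul, intervalIntegral.integral_const, smul_eq_mul] at h2
    have h3 : stepEnergy b V μ a a ≤ e a := by
      obtain ⟨C, hC0, hC⟩ := h.exists_growth hR hμ ha le_rfl
      have i1 := integrable_of_growth (μ := μ) hμ (f := fun y => Real.log (stepDensity b μ a
        (langevinStep b a y))) (((measurable_stepDensity_right μ hb a).comp
          (measurable_langevinStep hb a)).log)
        fun y hy => (hC a ⟨le_rfl, le_rfl⟩ a ⟨le_rfl, le_rfl⟩ y hy).1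
      have i2 := integrable_of_growth (μ := μ) hμ (f := fun y => V (langevinStep b a y))
        (h.continuous_potential.measurable.comp (measurable_langevinStep hb a))
        fun y hy => (hC a ⟨le_rfl, le_rfl⟩ a ⟨le_rfl, le_rfl⟩ y hy).2.1
      rw [stepEnergy, integral_add i1 i2]
      have haL : a * L < 1 := (mul_le_mul_of_nonneg_right haT hL).trans_lt hTL1
      have := h.integral_log_stepDensity_le hR hμ hq₀ hμq hlog ha haL
      simp only [he, hΦ]
      linarith
    have h4 : (T - a) * W ≤ T * W := by gcongr; linarith
    have h5 : 0 ≤ ∫ t in a..T, stepFisher b V' μ t :=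
      intervalIntegral.integral_nonneg haT fun t _ => integral_nonneg fun y => sq_nonneg _
    refine ⟨by linarith, ?_⟩
    rw [← ofReal_integral_eq_lintegral_ofReal
      ((intervalIntegrable_iff_integrableOn_Ioc_of_le haT).1 hintI)
      (.of_forall fun t => integral_nonneg fun y => sq_nonneg _),
      ← intervalIntegral.integral_of_le haT]
    refine ENNReal.ofReal_le_ofReal ?_
    linarith
  set a : ℕ → ℝ := fun k => T / (k + 1) with ha
  have ha0 : ∀ k, 0 < a k := fun k => by positivity
  have haT : ∀ k, a k ≤ T := fun k => by
    simp only [ha]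
    exact div_le_self hT.le (by linarith [(Nat.cast_nonneg k : (0 : ℝ) ≤ k)])
  have hlim : Tendsto a atTop (𝓝 0) := by
    have := tendsto_one_div_add_atTop_nhds_zero_nat (𝕜 := ℝ)
    simpa [ha, div_eq_mul_inv] using this.const_mul T
  have hanti : Antitone a := fun i j hij => by simp only [ha]; gcongr
  have hU : ⋃ k, Set.Ioc (a k) T = Set.Ioc 0 T := by
    ext x
    simp only [Set.mem_iUnion, Set.mem_Ioc, exists_and_right, and_congr_left_iff]
    refine fun _ => ⟨fun ⟨k, hk⟩ => (ha0 k).trans hk, fun hx => ?_⟩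
    exact ((hlim.eventually (gt_mem_nhds hx))).exists
  have hmeas : Tendsto (fun k => ∫⁻ t in Set.Ioc (a k) T, ENNReal.ofReal (stepFisher b V' μ t))
      atTop (𝓝 (∫⁻ t in Set.Ioc 0 T, ENNReal.ofReal (stepFisher b V' μ t))) := by
    have := tendsto_measure_iUnion_atTop
      (μ := volume.withDensity fun t => ENNReal.ofReal (stepFisher b V' μ t))
      (s := fun k => Set.Ioc (a k) T) (fun i j hij => Set.Ioc_subset_Ioc_left (hanti hij))
    rw [hU] at this
    simpa only [Function.comp_def, withDensity_apply _ measurableSet_Ioc] using this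
  have hlim' : Tendsto a atTop (𝓝[>] 0) :=
    tendsto_nhdsWithin_iff.2 ⟨hlim, .of_forall ha0⟩
  have hX := (((he0.comp hlim').const_mul 4).sub_const (4 * stepEnergy b V μ T T)).add_const
    (4 * T * W)
  exact ⟨ge_of_tendsto' hX fun k => (hstep (a k) ⟨ha0 k, haT k⟩).1,
    le_of_tendsto_of_tendsto' hmeas ((ENNReal.continuous_ofReal.tendsto _).comp hX)
      fun k => (hstep (a k) ⟨ha0 k, haT k⟩).2⟩

end LipschitzDrift

end InitialTime

/-! ### Removing the compact support by Fatou's lemma. -/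

section Truncation

open Module Filter Topology InformationTheory
open scoped RealInnerProductSpace

variable {E : Type*} [NormedAddCommGroup E] [InnerProductSpace ℝ E] [FiniteDimensional ℝ E]
  [MeasurableSpace E] [BorelSpace E] {b : E → E} {V : E → ℝ} {V' : E → E} {L R δ : ℝ}

/-- The measure with density `exp (-V)`. -/
noncomputable def gibbsMeasure (V : E → ℝ) : Measure E :=
  volume.withDensity fun x => ENNReal.ofReal (Real.exp (-V x))

/-- The law of `langevinStep b t` started from `μ`. -/
noncomputable def stepLaw (b : E → E) (μ : Measure E) (t : ℝ) : Measure E :=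
  (μ.prod (stdGaussian E)).map (langevinStep b t)

/-- The integrand of the Fisher information of `stepLaw b μ t` relative to `gibbsMeasure V`. -/
noncomputable def fisherIntegrand (b V' : E → E) (μ : Measure E) (t : ℝ) (x : E) : ℝ≥0∞ :=
  ENNReal.ofReal (‖stepScore b μ t x + V' x‖ ^ 2) * ENNReal.ofReal (stepDensity b μ t x)

/-- Joins the two separate applications of Fatou's lemma, to the entropy and to the Fisher
information, into one bound on the sum. -/
lemma add_le_liminf_add {u v : ℕ → ℝ≥0∞} {x y : ℝ≥0∞} (hx : x ≤ liminf u atTop)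
    (hy : y ≤ liminf v atTop) : x + y ≤ liminf (fun k => u k + v k) atTop := by
  rw [liminf_eq_iSup_iInf_of_nat] at hx hy ⊢
  refine (add_le_add hx hy).trans ?_
  rw [ENNReal.iSup_add_iSup_of_monotone
    (fun m n hmn => le_iInf₂ fun i hi => iInf₂_le i (le_trans hmn hi))
    (fun m n hmn => le_iInf₂ fun i hi => iInf₂_le i (le_trans hmn hi))]
  exact iSup_mono fun n => le_iInf₂ fun i hi => add_le_add (iInf₂_le i hi) (iInf₂_le i hi)

lemma tendsto_setIntegral_closedBall {F : Type*} [NormedAddCommGroup F] [NormedSpace ℝ F]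
    {ν : Measure E} {f : E → F} (hf : Integrable f ν) :
    Tendsto (fun k : ℕ => ∫ x in Metric.closedBall (0 : E) k, f x ∂ν) atTop (𝓝 (∫ x, f x ∂ν)) := by
  have hU : ⋃ k : ℕ, Metric.closedBall (0 : E) k = Set.univ := by
    refine Set.eq_univ_of_forall fun x => Set.mem_iUnion.2 ?_
    obtain ⟨k, hk⟩ := exists_nat_ge ‖x‖
    exact ⟨k, by simpa using hk⟩
  have := tendsto_setIntegral_of_monotone (f := f) (μ := ν)
    (s := fun k : ℕ => Metric.closedBall (0 : E) k)
    (fun k => Metric.isClosed_closedBall.measurableSet)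
    (fun i j hij => Metric.closedBall_subset_closedBall (by exact_mod_cast hij))
    (by rw [hU]; exact hf.integrableOn)
  rwa [hU, Measure.restrict_univ] at this

variable {μ : Measure E} [IsFiniteMeasure μ]

lemma measurable_fisherIntegrand (hb : Continuous b) (hV' : Continuous V') :
    Measurable (fun y : ℝ × E => fisherIntegrand b V' μ y.1 y.2) :=
  ((((measurable_stepScore μ hb).add (hV'.measurable.comp measurable_snd)).norm.pow_const
    2).ennreal_ofReal).mul (measurable_stepDensity μ hb).ennreal_ofReal

lemma measurable_lintegral_fisherIntegrand (hb : Continuous b) (hV' : Continuous V') :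
    Measurable fun t => ∫⁻ x, fisherIntegrand b V' μ t x := by
  have h : Measurable (fun y : ℝ × E => fisherIntegrand b V' μ y.1 y.2) :=
    measurable_fisherIntegrand hb hV'
  revert h
  generalize fisherIntegrand b V' μ = f
  intro h
  exact h.lintegral_prod_right'

lemma measurable_fisherIntegrand_right (hb : Continuous b) (hV' : Continuous V') (t : ℝ) :
    Measurable fun x => fisherIntegrand b V' μ t x := by
  have h : Measurable (fun y : ℝ × E => fisherIntegrand b V' μ y.1 y.2) :=
    measurable_fisherIntegrand hb hV'
  revert h
  generalize fisherIntegrand b V' μ = f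
  intro h
  exact h.comp measurable_prodMk_left

lemma withDensity_eq_gibbsMeasure_withDensity (hV : Measurable V) {q : E → ℝ} (hq : Measurable q) :
    volume.withDensity (fun x => ENNReal.ofReal (q x))
      = (gibbsMeasure V).withDensity fun x => ENNReal.ofReal (q x * Real.exp (V x)) := by
  rw [gibbsMeasure, ← withDensity_mul _ (by fun_prop) (by fun_prop)]
  congr 1
  ext x
  rw [Pi.mul_apply, ← ENNReal.ofReal_mul (Real.exp_pos _).le, mul_left_comm, ← Real.exp_add,
    neg_add_cancel, Real.exp_zero, mul_one]

/-- Puts the relative entropy in the form of a nonnegative integrand, to which Fatou's lemma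
applies. -/
lemma klDiv_withDensity_eq [IsProbabilityMeasure (gibbsMeasure V)] (hV : Measurable V) {q : E → ℝ}
    (hq : Measurable q) (hq0 : ∀ x, 0 ≤ q x)
    [IsFiniteMeasure (volume.withDensity fun x => ENNReal.ofReal (q x))] :
    klDiv (volume.withDensity fun x => ENNReal.ofReal (q x)) (gibbsMeasure V)
      = ∫⁻ x, ENNReal.ofReal (klFun (q x * Real.exp (V x))) ∂(gibbsMeasure V) := by
  have e := withDensity_eq_gibbsMeasure_withDensity hV hq
  rw [klDiv_eq_lintegral_klFun_of_ac (by rw [e]; exact withDensity_absolutelyContinuous _ _)]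
  rw [e]
  refine lintegral_congr_ae ?_
  filter_upwards [Measure.rnDeriv_withDensity (gibbsMeasure V)
    (f := fun x => ENNReal.ofReal (q x * Real.exp (V x))) (by fun_prop)] with x hx
  rw [hx, ENNReal.toReal_ofReal (mul_nonneg (hq0 x) (Real.exp_pos _).le)]

namespace LipschitzDrift

/-- The support bound makes the Bochner integral meaningful; the right side keeps its meaning for
every start and is the form that passes to the limit. -/
lemma ofReal_stepFisher [NeZero μ] (h : LipschitzDrift b V V' L) (hR : 0 ≤ R)
    (hμ : ∀ᵐ z ∂μ, ‖z‖ ≤ R) {t : ℝ} (ht : 0 < t) :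
    ENNReal.ofReal (stepFisher b V' μ t) = ∫⁻ x, fisherIntegrand b V' μ t x := by
  have hb := h.continuous_drift
  obtain ⟨C, hC⟩ := h.exists_bound_fisher hR hμ t t ht le_rfl
  have hm : Measurable fun x => ‖stepScore b μ t x + V' x‖ ^ 2 :=
    (((measurable_stepScore_right μ hb t).add h.continuous_gradient.measurable).norm.pow_const 2)
  have hi := integrable_of_growth hμ (hm.comp (measurable_langevinStep hb t))
    (hC t ⟨le_rfl, le_rfl⟩ t ⟨le_rfl, le_rfl⟩)
  have hi' := (integrable_langevinStep_iff μ hb ht hm).1 hi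
  rw [stepFisher, integral_langevinStep μ hb ht hm, ofReal_integral_eq_lintegral_ofReal hi'
    (.of_forall fun x => mul_nonneg (stepDensity_nonneg μ ht x) (sq_nonneg _))]
  refine lintegral_congr fun x => ?_
  rw [fisherIntegrand, mul_comm, ENNReal.ofReal_mul (sq_nonneg _)]

/-- The free energy at the end of a step in terms of the relative entropy integrand. -/
lemma ofReal_stepEnergy [NeZero μ] [IsProbabilityMeasure (gibbsMeasure V)]
    (h : LipschitzDrift b V V' L) (hR : 0 ≤ R) (hμ : ∀ᵐ z ∂μ, ‖z‖ ≤ R) {t : ℝ} (ht : 0 < t) :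
    0 ≤ stepEnergy b V μ t t + 1 - μ.real Set.univ ∧
    ∫⁻ x, ENNReal.ofReal (klFun (stepDensity b μ t x * Real.exp (V x))) ∂(gibbsMeasure V)
      = ENNReal.ofReal (stepEnergy b V μ t t + 1 - μ.real Set.univ) := by
  have hb := h.continuous_drift
  have hVm := h.continuous_potential.measurable
  have hqm := measurable_stepDensity_right μ hb t
  obtain ⟨C, hC⟩ := h.exists_bound_energy hR hμ t t ht le_rfl
  have hm : Measurable fun x => Real.log (stepDensity b μ t x) + V x := hqm.log.add hVm
  have hi := integrable_of_growth hμ (hm.comp (measurable_langevinStep hb t))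
    (hC t ⟨le_rfl, le_rfl⟩ t ⟨le_rfl, le_rfl⟩)
  have i1 := (integrable_langevinStep_iff μ hb ht hm).1 hi
  have e1 := integral_langevinStep μ hb ht hm
  have i2 := integrable_stepDensity μ hb ht
  have hexp : ∫⁻ x, ENNReal.ofReal (Real.exp (-V x)) = 1 := by
    have := measure_univ (μ := gibbsMeasure V)
    simpa [gibbsMeasure] using this
  have i3 : Integrable (fun x => Real.exp (-V x)) := by
    refine ⟨(by fun_prop : Measurable fun x => Real.exp (-V x)).aestronglyMeasurable, ?_⟩
    rw [hasFiniteIntegral_iff_ofReal (.of_forall fun x => (Real.exp_pos _).le), hexp]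
    exact ENNReal.one_lt_top
  have e3 : ∫ x, Real.exp (-V x) = 1 := by
    rw [integral_eq_lintegral_of_nonneg_ae (.of_forall fun x => (Real.exp_pos _).le)
      i3.aestronglyMeasurable, hexp, ENNReal.toReal_one]
  -- `klFun u = u log u + 1 - u`. As `μ` need not have mass one, the last two terms integrate to `1
  -- - μ.real Set.univ`.
  have hfun : ∀ x, Real.exp (-V x) * klFun (stepDensity b μ t x * Real.exp (V x))
      = stepDensity b μ t x * (Real.log (stepDensity b μ t x) + V x) + Real.exp (-V x)
        - stepDensity b μ t x := by
    intro x
    rw [klFun_apply, Real.log_mul (stepDensity_pos μ hb ht x).ne' (Real.exp_pos _).ne',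
      Real.log_exp]
    have : Real.exp (-V x) * Real.exp (V x) = 1 := by
      rw [← Real.exp_add, neg_add_cancel, Real.exp_zero]
    linear_combination (stepDensity b μ t x * (Real.log (stepDensity b μ t x) + V x)
      - stepDensity b μ t x) * this
  have hnn : ∀ x, 0 ≤ Real.exp (-V x) * klFun (stepDensity b μ t x * Real.exp (V x)) := fun x =>
    mul_nonneg (Real.exp_pos _).le (klFun_nonneg (mul_nonneg (stepDensity_nonneg μ ht x)
      (Real.exp_pos _).le))
  have hint : ∫ x, Real.exp (-V x) * klFun (stepDensity b μ t x * Real.exp (V x))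
      = stepEnergy b V μ t t + 1 - μ.real Set.univ := by
    simp_rw [hfun]
    have i4 : Integrable fun x => stepDensity b μ t x * (Real.log (stepDensity b μ t x) + V x)
      + Real.exp (-V x) := i1.add i3
    rw [integral_sub i4 i2, integral_add i1 i3, e3, integral_stepDensity μ hb ht, ← e1]
    rfl
  refine ⟨hint ▸ integral_nonneg hnn, ?_⟩
  have hkm : Measurable fun x =>
      ENNReal.ofReal (klFun (stepDensity b μ t x * Real.exp (V x))) :=
    (measurable_klFun.comp (hqm.mul hVm.exp)).ennreal_ofReal
  rw [← hint, ofReal_integral_eq_lintegral_ofReal ?_ (.of_forall hnn), gibbsMeasure,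
    lintegral_withDensity_eq_lintegral_mul _ (by fun_prop) hkm]
  · refine lintegral_congr fun x => ?_
    rw [ENNReal.ofReal_mul (Real.exp_pos _).le]
    rfl
  · simp_rw [hfun]
    exact (i1.add i3).sub i2

/-- **One step of the Langevin scheme**: the relative entropy to the target plus the integrated
Fisher information is controlled by the initial relative entropy. -/
theorem klDiv_stepLaw_add_lintegral_fisher_le [IsProbabilityMeasure (gibbsMeasure V)]
    (h : LipschitzDrift b V V' L) (hδ : ∀ x, ‖b x - V' x‖ ≤ δ) (ν : Measure E)
    [IsProbabilityMeasure ν] {T : ℝ} (hT : 0 < T) (hTL : T * L ≤ 1 / Real.sqrt 32) :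
    4 * klDiv (stepLaw b ν T) (gibbsMeasure V)
      + ∫⁻ t in Set.Ioc 0 T, ∫⁻ x, fisherIntegrand b V' ν t x
      ≤ 4 * klDiv ν (gibbsMeasure V)
        + ENNReal.ofReal (4 * T * (3 * δ ^ 2 + 6 * (finrank ℝ E * L ^ 2 * T))) := by
  by_cases hkl : klDiv ν (gibbsMeasure V) = ∞
  · rw [hkl, ENNReal.mul_top (by norm_num), top_add]; exact le_top
  obtain ⟨hac, hllr⟩ := klDiv_ne_top_iff.1 hkl
  have hb := h.continuous_drift
  have hVm := h.continuous_potential.measurable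
  set W : ℝ := 3 * δ ^ 2 + 6 * (finrank ℝ E * L ^ 2 * T) with hW
  have hW0 : 0 ≤ W := by positivity
  set ρ : E → ℝ := fun x => (ν.rnDeriv (gibbsMeasure V) x).toReal with hρ
  have hρm : Measurable ρ := (Measure.measurable_rnDeriv _ _).ennreal_toReal
  set q₀ : E → ℝ := fun x => ρ x * Real.exp (-V x) with hq₀
  have hq₀m : Measurable q₀ := by fun_prop
  have hνq : ν = volume.withDensity fun x => ENNReal.ofReal (q₀ x) := by
    rw [withDensity_eq_gibbsMeasure_withDensity hVm hq₀m]
    conv_lhs => rw [← Measure.withDensity_rnDeriv_eq _ _ hac]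
    refine withDensity_congr_ae ?_
    filter_upwards [Measure.rnDeriv_ne_top ν (gibbsMeasure V)] with x hx
    rw [hq₀, mul_assoc, ← Real.exp_add, neg_add_cancel, Real.exp_zero, mul_one, hρ,
      ENNReal.ofReal_toReal hx]
  set ball : ℕ → Set E := fun k => Metric.closedBall 0 k with hball
  have hballm : ∀ k, MeasurableSet (ball k) := fun k => Metric.isClosed_closedBall.measurableSet
  have hmono : Monotone ball := fun i j hij =>
    Metric.closedBall_subset_closedBall (by exact_mod_cast hij)
  have hU : ⋃ k, ball k = Set.univ := by
    refine Set.eq_univ_of_forall fun x => Set.mem_iUnion.2 ?_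
    obtain ⟨k, hk⟩ := exists_nat_ge ‖x‖
    exact ⟨k, by simpa [hball] using hk⟩
  -- The restrictions are not renormalized: their step densities are then set integrals converging
  -- pointwise, and the missing mass vanishes in the limit.
  set νk : ℕ → Measure E := fun k => ν.restrict (ball k) with hνk
  have hνkR : ∀ k : ℕ, ∀ᵐ z ∂(νk k), ‖z‖ ≤ (k : ℝ) := fun k => by
    filter_upwards [ae_restrict_mem (hballm k)] with z hz
    simpa [hball] using hz
  have hmass : Tendsto (fun k => (νk k).real Set.univ) atTop (𝓝 1) := by
    have := tendsto_measure_iUnion_atTop (μ := ν) hmono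
    rw [hU, measure_univ] at this
    have h2 := (ENNReal.tendsto_toReal ENNReal.one_ne_top).comp this
    simpa [hνk, measureReal_def, Function.comp_def] using h2
  have hmass1 : ∀ k, (νk k).real Set.univ ≤ 1 := fun k => by
    simp only [hνk, measureReal_restrict_apply MeasurableSet.univ, Set.univ_inter]
    exact measureReal_le_one
  have hq : ∀ t x, 0 < t → Tendsto (fun k => stepDensity b (νk k) t x) atTop
      (𝓝 (stepDensity b ν t x)) := fun t x ht => tendsto_setIntegral_closedBall (integrable_stepKernel ν hb ht x)
  have hs : ∀ t x, 0 < t → Tendsto (fun k => stepScore b (νk k) t x) atTop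
      (𝓝 (stepScore b ν t x)) := fun t x ht =>
    ((hq t x ht).inv₀ (stepDensity_pos ν hb ht x).ne').smul
      (tendsto_setIntegral_closedBall (integrable_stepKernel_smul ν hb ht x))
  -- lower semicontinuity of the relative entropy
  have hlow1 : klDiv (stepLaw b ν T) (gibbsMeasure V) ≤ liminf (fun k => ∫⁻ x, ENNReal.ofReal
      (klFun (stepDensity b (νk k) T x * Real.exp (V x))) ∂(gibbsMeasure V)) atTop := by
    have hlaw := map_langevinStep ν hb hT
    have : IsFiniteMeasure
        (volume.withDensity fun x => ENNReal.ofReal (stepDensity b ν T x)) := by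
      rw [← hlaw]; infer_instance
    rw [stepLaw, hlaw, klDiv_withDensity_eq hVm (measurable_stepDensity_right ν hb T)
      (fun x => stepDensity_nonneg ν hT x)]
    refine le_trans (le_of_eq ?_) (lintegral_liminf_le fun k => (measurable_klFun.comp
      ((measurable_stepDensity_right (νk k) hb T).mul hVm.exp)).ennreal_ofReal)
    refine lintegral_congr fun x => ?_
    refine Eq.symm (Tendsto.liminf_eq ?_)
    exact (ENNReal.continuous_ofReal.tendsto _).comp ((continuous_klFun.tendsto _).comp
      ((hq T x hT).mul_const _))
  -- lower semicontinuity of the integrated Fisher information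
  have hlow2 : ∫⁻ t in Set.Ioc 0 T, ∫⁻ x, fisherIntegrand b V' ν t x
      ≤ liminf (fun k => ∫⁻ t in Set.Ioc 0 T, ∫⁻ x, fisherIntegrand b V' (νk k) t x) atTop := by
    have hm₁ : ∀ k, Measurable fun t => ∫⁻ x, fisherIntegrand b V' (νk k) t x := fun k =>
      measurable_lintegral_fisherIntegrand hb h.continuous_gradient
    have hm₂ : ∀ t k, Measurable fun x => fisherIntegrand b V' (νk k) t x := fun t k =>
      measurable_fisherIntegrand_right hb h.continuous_gradient t
    refine le_trans ?_ (lintegral_liminf_le hm₁)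
    refine setLIntegral_mono' measurableSet_Ioc fun t ht => ?_
    refine le_trans (le_of_eq ?_) (lintegral_liminf_le (hm₂ t))
    refine lintegral_congr fun x => Eq.symm (Tendsto.liminf_eq ?_)
    refine ENNReal.Tendsto.mul ?_ (Or.inr ENNReal.ofReal_ne_top) ?_ (Or.inr ENNReal.ofReal_ne_top)
    · exact (ENNReal.continuous_ofReal.tendsto _).comp (((hs t x ht.1).add_const _).norm.pow 2)
    · exact (ENNReal.continuous_ofReal.tendsto _).comp (hq t x ht.1)
  have hlow := add_le_liminf_add (u := fun k => 4 * ∫⁻ x, ENNReal.ofReal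
      (klFun (stepDensity b (νk k) T x * Real.exp (V x))) ∂(gibbsMeasure V))
      (x := 4 * klDiv (stepLaw b ν T) (gibbsMeasure V)) (by
    rw [ENNReal.liminf_const_mul_of_ne_top (by norm_num)]
    gcongr) hlow2
  have hlog_eq : ∀ᵐ z ∂ν, Real.log (q₀ z) + V z = llr ν (gibbsMeasure V) z := by
    filter_upwards [Measure.rnDeriv_pos hac, hac (Measure.rnDeriv_ne_top ν (gibbsMeasure V))]
      with z hz hz2
    have hz' : 0 < ρ z := ENNReal.toReal_pos hz.ne' hz2
    simp only [hq₀]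
    rw [Real.log_mul hz'.ne' (Real.exp_pos _).ne', Real.log_exp, llr]
    simp [hρ]
  have hint : Integrable (fun z => Real.log (q₀ z) + V z) ν := hllr.congr (by
    filter_upwards [hlog_eq] with z hz using hz.symm)
  have hupper : ∀ᶠ k in atTop, (4 * ∫⁻ x, ENNReal.ofReal
      (klFun (stepDensity b (νk k) T x * Real.exp (V x))) ∂(gibbsMeasure V))
      + ∫⁻ t in Set.Ioc 0 T, ∫⁻ x, fisherIntegrand b V' (νk k) t x
      ≤ ENNReal.ofReal (4 * ∫ z, (Real.log (q₀ z) + V z) ∂(νk k)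
        + 4 * (1 - (νk k).real Set.univ) + 4 * T * W) := by
    -- For large `k` the truncated measure is nonzero, so that its step density is positive.
    filter_upwards [hmass.eventually (lt_mem_nhds zero_lt_one)] with k hk
    have : NeZero (νk k) := ⟨fun h0 => by simp [h0] at hk⟩
    set qk : E → ℝ := (ball k).indicator q₀ with hqk
    have hqkm : Measurable qk := hq₀m.indicator (hballm k)
    have hνkq : νk k = volume.withDensity fun x => ENNReal.ofReal (qk x) := by
      simp only [hνk]
      conv_lhs => rw [hνq]
      rw [restrict_withDensity (hballm k), ← withDensity_indicator (hballm k)]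
      congr 1
      ext x
      by_cases hx : x ∈ ball k <;> simp [hqk, hx]
    have hqk_eq : ∀ᵐ z ∂(νk k), qk z = q₀ z := by
      filter_upwards [ae_restrict_mem (hballm k)] with z hz
      exact Set.indicator_of_mem hz _
    have hVk : Integrable V (νk k) := by
      obtain ⟨C, hC0, hC⟩ := exists_growth_of_gradient h.nonneg h.hasGradientAt h.gradient
      refine Integrable.of_bound (C := C * (1 + (k : ℝ) ^ 2))
        h.continuous_potential.aestronglyMeasurable ?_
      filter_upwards [hνkR k] with z hz
      refine (hC z).1.trans ?_
      gcongr
    -- On the ball this is `(log q₀ + V) - V`: the first term is integrable by finiteness of the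
    -- relative entropy, the second is bounded there.
    have hlogk : Integrable (fun z => Real.log (qk z)) (νk k) := by
      refine ((hint.restrict (s := ball k)).sub hVk).congr ?_
      filter_upwards [hqk_eq] with z hz
      simp [hz]
    obtain ⟨hX0, hX⟩ := h.lintegral_stepFisher_le (Nat.cast_nonneg k) (hνkR k) (hmass1 k) hδ hqkm
      hνkq hlogk hT hTL
    obtain ⟨hY0, hY⟩ := h.ofReal_stepEnergy (Nat.cast_nonneg k) (hνkR k) hT
    have e1 : ∫ z, (Real.log (qk z) + V z) ∂(νk k) = ∫ z, (Real.log (q₀ z) + V z) ∂(νk k) :=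
      integral_congr_ae (by filter_upwards [hqk_eq] with z hz; rw [hz])
    have e2 : ∫⁻ t in Set.Ioc 0 T, ∫⁻ x, fisherIntegrand b V' (νk k) t x
        = ∫⁻ t in Set.Ioc 0 T, ENNReal.ofReal (stepFisher b V' (νk k) t) :=
      setLIntegral_congr_fun measurableSet_Ioc fun t ht =>
        (h.ofReal_stepFisher (Nat.cast_nonneg k) (hνkR k) ht.1).symm
    rw [hY, e2]
    refine (add_le_add_right hX _).trans (le_of_eq ?_)
    rw [show (4 : ℝ≥0∞) = ENNReal.ofReal 4 by norm_num, ← ENNReal.ofReal_mul (by norm_num),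
      ← ENNReal.ofReal_add (by linarith) hX0, e1]
    congr 1
    ring
  refine hlow.trans ((liminf_le_liminf hupper).trans (le_of_eq ?_))
  have hlim : Tendsto (fun k => 4 * ∫ z, (Real.log (q₀ z) + V z) ∂(νk k)
        + 4 * (1 - (νk k).real Set.univ) + 4 * T * W) atTop
      (𝓝 (4 * ∫ z, (Real.log (q₀ z) + V z) ∂ν + 4 * (1 - 1) + 4 * T * W)) :=
    (((tendsto_setIntegral_closedBall hint).const_mul 4).add ((hmass.const_sub 1).const_mul 4)).add_const _
  rw [(ENNReal.tendsto_ofReal hlim).liminf_eq, integral_congr_ae hlog_eq,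
    ← toReal_klDiv_of_measure_eq hac (by simp), sub_self, mul_zero, add_zero,
    ENNReal.ofReal_add (by positivity) (by positivity), ENNReal.ofReal_mul (by norm_num),
    ENNReal.ofReal_toReal hkl]
  norm_num

end LipschitzDrift

end Truncation

/-! ### The posterior as a Gibbs measure and the PMC-RED drift. -/

section Posterior

open Module Filter Topology InformationTheory
open scoped RealInnerProductSpace

variable {n : ℕ}

lemma contDiff_one_of_hasGradientAt {E : Type*} [NormedAddCommGroup E] [InnerProductSpace ℝ E]
    [CompleteSpace E] {f : E → ℝ} {f' : E → E} (hf : ∀ x, HasGradientAt f (f' x) x)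
    (hf' : Continuous f') : ContDiff ℝ 1 f := by
  rw [contDiff_one_iff_fderiv]
  refine ⟨fun x => (hf x).differentiableAt, ?_⟩
  have : fderiv ℝ f = fun x => InnerProductSpace.toDual ℝ E (f' x) :=
    funext fun x => (hf x).hasFDerivAt.fderiv
  rw [this]
  fun_prop

/-- The Fisher information of `stepLaw b ν t` relative to a Gibbs measure. -/
lemma LipschitzDrift.fisherInfo_stepLaw_le {b : Rn n → Rn n} {V : Rn n → ℝ} {V' : Rn n → Rn n}
    {L : ℝ} (h : LipschitzDrift b V V' L) (ν : Measure (Rn n)) [IsProbabilityMeasure ν] {t : ℝ}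
    (ht : 0 < t) :
    fisherInfo (stepLaw b ν t) (gibbsMeasure V) ≤ ∫⁻ x, fisherIntegrand b V' ν t x := by
  have hb := h.continuous_drift
  have hq := measurable_stepDensity_right ν hb t
  have hcg : Continuous (stepDensityGrad b ν t) := by
    refine continuous_iff_continuousAt.2 fun x => ?_
    exact ContinuousAt.comp (g := fun y : ℝ × Rn n => stepDensityGrad b ν y.1 y.2)
      (f := fun x : Rn n => (t, x))
      ((continuousOn_stepDensityGrad ν hb).continuousAt
        ((isOpen_Ioi.prod isOpen_univ).mem_nhds ⟨ht, trivial⟩)) (by fun_prop)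
  have hlaw : stepLaw b ν t
      = (gibbsMeasure V).withDensity fun x =>
        ENNReal.ofReal (stepDensity b ν t x * Real.exp (V x)) := by
    rw [stepLaw, map_langevinStep ν hb ht,
      withDensity_eq_gibbsMeasure_withDensity h.continuous_potential.measurable hq]
  have hV1 : ContDiff ℝ 1 V := contDiff_one_of_hasGradientAt h.hasGradientAt h.continuous_gradient
  have hq1 : ContDiff ℝ 1 (stepDensity b ν t) :=
    contDiff_one_of_hasGradientAt (hasGradientAt_stepDensity ν hb ht) hcg
  have hgrad : ∀ x, _root_.gradient (fun z => Real.log (stepDensity b ν t z * Real.exp (V z))) x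
      = stepScore b ν t x + V' x := by
    intro x
    have e : (fun z => Real.log (stepDensity b ν t z * Real.exp (V z)))
        = fun z => Real.log (stepDensity b ν t z) + V z := by
      ext z
      rw [Real.log_mul (stepDensity_pos ν hb ht z).ne' (Real.exp_pos _).ne', Real.log_exp]
    rw [e]
    refine HasGradientAt.gradient ?_
    rw [hasGradientAt_iff_hasFDerivAt, map_add]
    exact (hasGradientAt_log_stepDensity ν hb ht x).hasFDerivAt.add (h.hasGradientAt x).hasFDerivAt
  unfold fisherInfo
  -- One admissible density suffices to bound the infimum.
  refine (iInf_le _ fun x => stepDensity b ν t x * Real.exp (V x)).trans ?_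
  refine (iInf_le _ (hq1.mul hV1.exp)).trans ?_
  refine (iInf_le _ fun x => mul_pos (stepDensity_pos ν hb ht x) (Real.exp_pos _)).trans ?_
  refine (iInf_le _ hlaw).trans (le_of_eq ?_)
  have hm : Measurable fun x => ENNReal.ofReal (‖stepScore b ν t x + V' x‖ ^ 2) :=
    ((((measurable_stepScore_right ν hb t).add
      h.continuous_gradient.measurable).norm.pow_const 2)).ennreal_ofReal
  simp_rw [hgrad]
  rw [stepLaw, map_langevinStep ν hb ht, lintegral_withDensity_eq_lintegral_mul _
    hq.ennreal_ofReal hm]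
  refine lintegral_congr fun x => ?_
  rw [fisherIntegrand, Pi.mul_apply, mul_comm]

/-- The negative log-density of the posterior. -/
noncomputable def posteriorPotential (ℓ p : Rn n → ℝ) (x : Rn n) : ℝ :=
  -Real.log (ℓ x) - Real.log (p x) + Real.log (∫ z, ℓ z * p z)

lemma hasGradientAt_log_score {q : Rn n → ℝ} (hq : Differentiable ℝ fun x => Real.log (q x))
    (x : Rn n) : HasGradientAt (fun x => Real.log (q x)) (score q x) x :=
  (hq x).hasGradientAt

lemma hasGradientAt_posteriorPotential {ℓ p : Rn n → ℝ}
    (hℓ : Differentiable ℝ fun x => Real.log (ℓ x)) (hp : Differentiable ℝ fun x => Real.log (p x))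
    (x : Rn n) :
    HasGradientAt (posteriorPotential ℓ p) (-score ℓ x - score p x) x := by
  rw [hasGradientAt_iff_hasFDerivAt, map_sub, map_neg]
  exact ((hasGradientAt_log_score hℓ x).hasFDerivAt.neg.sub
    (hasGradientAt_log_score hp x).hasFDerivAt).add_const _

lemma pmcRedDrift_eq {ℓ : Rn n → ℝ} (S : Rn n → ℝ → Rn n) (σ : ℝ)
    (hℓ : Differentiable ℝ fun x => Real.log (ℓ x)) (x : Rn n) :
    pmcRedDrift ℓ S σ x = -score ℓ x - S x σ := by
  have h : HasGradientAt (fun z => -Real.log (ℓ z)) (-score ℓ x) x := by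
    rw [hasGradientAt_iff_hasFDerivAt, map_neg]
    exact (hasGradientAt_log_score hℓ x).hasFDerivAt.neg
  rw [pmcRedDrift, h.gradient]

/-- Drift and potential gradient share the likelihood score; the maximum gives the network and the
prior score a common constant. -/
lemma lipschitzDrift_posterior {ℓ p : Rn n → ℝ} {S : Rn n → ℝ → Rn n} {Lg Lp Lσ σ : ℝ}
    (hLg : 0 ≤ Lg) (hℓ_diff : Differentiable ℝ (fun x => Real.log (ℓ x)))
    (hℓ_lip : ∀ x₁ x₂, ‖score ℓ x₁ - score ℓ x₂‖ ≤ Lg * ‖x₁ - x₂‖)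
    (hLp : 0 ≤ Lp) (hp_diff : Differentiable ℝ (fun x => Real.log (p x)))
    (hp_lip : ∀ x₁ x₂, ‖score p x₁ - score p x₂‖ ≤ Lp * ‖x₁ - x₂‖)
    (hS_lip : ∀ x₁ x₂, ‖S x₁ σ - S x₂ σ‖ ≤ Lσ * ‖x₁ - x₂‖) :
    LipschitzDrift (pmcRedDrift ℓ S σ) (posteriorPotential ℓ p) (fun x => -score ℓ x - score p x)
      (Lg + max Lσ Lp) where
  nonneg := add_nonneg hLg (hLp.trans (le_max_right _ _))
  drift x y := by
    rw [pmcRedDrift_eq S σ hℓ_diff, pmcRedDrift_eq S σ hℓ_diff,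
      show -score ℓ x - S x σ - (-score ℓ y - S y σ)
        = -(score ℓ x - score ℓ y) - (S x σ - S y σ) by abel, add_mul]
    refine (norm_sub_le _ _).trans (add_le_add ((norm_neg _).trans_le (hℓ_lip x y))
      ((hS_lip x y).trans ?_))
    gcongr
    exact le_max_left _ _
  hasGradientAt := hasGradientAt_posteriorPotential hℓ_diff hp_diff
  gradient x y := by
    rw [show -score ℓ x - score p x - (-score ℓ y - score p y)
        = -(score ℓ x - score ℓ y) - (score p x - score p y) by abel, add_mul]
    refine (norm_sub_le _ _).trans (add_le_add ((norm_neg _).trans_le (hℓ_lip x y))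
      ((hp_lip x y).trans ?_))
    gcongr
    exact le_max_right _ _

lemma integral_likelihood_mul_prior_pos {ℓ p : Rn n → ℝ} (hℓ : ∀ x, 0 < ℓ x) (hp : ∀ x, 0 < p x)
    (hπ : Integrable fun x => ℓ x * p x) : 0 < ∫ x, ℓ x * p x := by
  refine (integral_pos_iff_support_of_nonneg (fun x => (mul_pos (hℓ x) (hp x)).le) hπ).2 ?_
  have : Function.support (fun x => ℓ x * p x) = Set.univ :=
    Set.eq_univ_of_forall fun x => (mul_pos (hℓ x) (hp x)).ne'
  rw [this]
  exact NeZero.pos _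

lemma posteriorMeasure_eq_gibbsMeasure {ℓ p : Rn n → ℝ} (hℓ : ∀ x, 0 < ℓ x) (hp : ∀ x, 0 < p x)
    (hπ : Integrable fun x => ℓ x * p x) :
    posteriorMeasure ℓ p = gibbsMeasure (posteriorPotential ℓ p) := by
  have hZ := integral_likelihood_mul_prior_pos hℓ hp hπ
  rw [posteriorMeasure, gibbsMeasure]
  congr 1
  ext x
  rw [posteriorPotential, show -(-Real.log (ℓ x) - Real.log (p x) + Real.log (∫ z, ℓ z * p z))
    = Real.log (ℓ x) + Real.log (p x) - Real.log (∫ z, ℓ z * p z) by ring, Real.exp_sub,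
    Real.exp_add, Real.exp_log (hℓ x), Real.exp_log (hp x), Real.exp_log hZ]

lemma isProbabilityMeasure_posteriorMeasure {ℓ p : Rn n → ℝ} (hℓ : ∀ x, 0 < ℓ x)
    (hp : ∀ x, 0 < p x) (hπ : Integrable fun x => ℓ x * p x) :
    IsProbabilityMeasure (posteriorMeasure ℓ p) := by
  have hZ := integral_likelihood_mul_prior_pos hℓ hp hπ
  refine ⟨?_⟩
  rw [posteriorMeasure, withDensity_apply _ MeasurableSet.univ, Measure.restrict_univ,
    ← ofReal_integral_eq_lintegral_ofReal (hπ.div_const _)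
      (.of_forall fun x => div_nonneg (mul_pos (hℓ x) (hp x)).le hZ.le),
    integral_div, div_self hZ.ne', ENNReal.ofReal_one]

/-- The likelihood scores cancel, and the score of the smoothed prior is the intermediate point of a
triangle inequality. -/
lemma norm_pmcRedDrift_sub_le {ℓ p : Rn n → ℝ} {S : Rn n → ℝ → Rn n} {σ εσ C : ℝ}
    (hℓ_diff : Differentiable ℝ (fun x => Real.log (ℓ x)))
    (hS_err : ∀ x, ‖S x σ - score (smoothedPrior p σ) x‖ ≤ εσ)
    (hmis : ∀ x, ‖score (smoothedPrior p σ) x - score p x‖ ≤ σ * C) (x : Rn n) :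
    ‖pmcRedDrift ℓ S σ x - (-score ℓ x - score p x)‖ ≤ εσ + σ * C := by
  rw [pmcRedDrift_eq S σ hℓ_diff, show -score ℓ x - S x σ - (-score ℓ x - score p x)
    = -((S x σ - score (smoothedPrior p σ) x) + (score (smoothedPrior p σ) x - score p x)) by abel,
    norm_neg]
  exact norm_add_le_of_le (hS_err x) (hmis x)

end Posterior

/-! ### Laws of the interpolated process driven by Brownian motion. -/

section Brownian

open Module Filter Topology InformationTheory

variable {n : ℕ} {Ω : Type*} [MeasurableSpace Ω] {P : Measure Ω} [IsProbabilityMeasure P]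

/-- The joint law of all the pairs is a product over `i` of products, and regrouping the factors
separates the two families. This lifts independence of past and increment from each coordinate to
`ℝⁿ`. -/
lemma indepFun_pi_of_iIndepFun_prodMk {ι α β : Type*} [Fintype ι] [MeasurableSpace α]
    [MeasurableSpace β] {X : ι → Ω → α} {Y : ι → Ω → β} (hX : ∀ i, AEMeasurable (X i) P)
    (hY : ∀ i, AEMeasurable (Y i) P) (h : iIndepFun (fun i ω => (X i ω, Y i ω)) P)
    (hXY : ∀ i, IndepFun (X i) (Y i) P) :
    IndepFun (fun ω i => X i ω) (fun ω i => Y i ω) P := by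
  have hX' : AEMeasurable (fun ω i => X i ω) P := aemeasurable_pi_lambda _ hX
  have hY' : AEMeasurable (fun ω i => Y i ω) P := aemeasurable_pi_lambda _ hY
  have hm : ∀ i, AEMeasurable (fun ω => (X i ω, Y i ω)) P := fun i => (hX i).prodMk (hY i)
  have := fun i => Measure.isProbabilityMeasure_map (hX i)
  have := fun i => Measure.isProbabilityMeasure_map (hY i)
  rw [indepFun_iff_map_prod_eq_prod_map_map hX' hY',
    (iIndepFun_iff_map_fun_eq_pi_map hX).1 (h.comp (fun _ => Prod.fst) fun _ => measurable_fst),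
    (iIndepFun_iff_map_fun_eq_pi_map hY).1 (h.comp (fun _ => Prod.snd) fun _ => measurable_snd),
    ← (measurePreserving_arrowProdEquivProdArrow α β ι (fun i => P.map (X i))
      (fun i => P.map (Y i))).map_eq]
  have e : (fun i => (P.map (X i)).prod (P.map (Y i))) = fun i => P.map fun ω => (X i ω, Y i ω) :=
    funext fun i => ((indepFun_iff_map_prod_eq_prod_map_map (hX i) (hY i)).1 (hXY i)).symm
  rw [e, ← (iIndepFun_iff_map_fun_eq_pi_map hm).1 h, AEMeasurable.map_map_of_aemeasurable
    (MeasurableEquiv.measurable _).aemeasurable (aemeasurable_pi_lambda _ hm)]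
  rfl

/-- The two independences make the joint law a threefold product, and associativity regroups it. -/
lemma IndepFun.prodMk_left_of_prodMk_right {α β δ : Type*} [MeasurableSpace α] [MeasurableSpace β]
    [MeasurableSpace δ] {X : Ω → α} {Y : Ω → β} {Z : Ω → δ} (hX : AEMeasurable X P)
    (hY : AEMeasurable Y P) (hZ : AEMeasurable Z P) (h : IndepFun X (fun ω => (Y ω, Z ω)) P)
    (h' : IndepFun Y Z P) : IndepFun (fun ω => (X ω, Y ω)) Z P := by
  have := Measure.isProbabilityMeasure_map hX
  have := Measure.isProbabilityMeasure_map hY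
  have := Measure.isProbabilityMeasure_map hZ
  have hXY : IndepFun X Y P := h.comp measurable_id measurable_fst
  rw [indepFun_iff_map_prod_eq_prod_map_map (hX.prodMk hY) hZ,
    (indepFun_iff_map_prod_eq_prod_map_map hX hY).1 hXY]
  have e := (indepFun_iff_map_prod_eq_prod_map_map hX (hY.prodMk hZ)).1 h
  rw [(indepFun_iff_map_prod_eq_prod_map_map hY hZ).1 h'] at e
  rw [← (measurePreserving_prodAssoc (P.map X) (P.map Y) (P.map Z)).symm.map_eq, ← e,
    AEMeasurable.map_map_of_aemeasurable (MeasurableEquiv.measurable _).aemeasurable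
      (hX.prodMk (hY.prodMk hZ))]
  rfl

variable {B : ℝ≥0 → Ω → Rn n}

namespace IsBrownianRn

lemma aemeasurable (hB : IsBrownianRn B P) (t : ℝ≥0) : AEMeasurable (B t) P := by
  have h : AEMeasurable (fun ω => WithLp.toLp 2 fun i => B t ω i) P :=
    (WithLp.measurable_toLp 2 _).comp_aemeasurable
      (aemeasurable_pi_lambda _ fun i => (hB.coord i).aemeasurable t)
  exact h

/-- The law of an increment of Brownian motion. -/
lemma map_sub (hB : IsBrownianRn B P) {s t : ℝ≥0} (hst : s ≤ t) :
    P.map (fun ω => B t ω - B s ω)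
      = (stdGaussian (Rn n)).map fun z => Real.sqrt (t - s) • z := by
  have hD : ∀ i, HasLaw (fun ω => B t ω i - B s ω i) (gaussianReal 0 (t - s)) P := fun i => by
    have := (hB.coord i).toIsPreBrownianReal.hasLaw_sub t s
    have e : nndist (t : ℝ) s = t - s := by
      ext
      rw [coe_nndist, Real.dist_eq, NNReal.coe_sub hst,
        abs_of_nonneg (sub_nonneg.2 (NNReal.coe_le_coe.2 hst))]
    rw [← e]
    exact this
  have hind : iIndepFun (fun i ω => B t ω i - B s ω i) P :=
    hB.indep.comp (fun _ f => f t - f s) fun _ => by fun_prop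
  have h1 := (iIndepFun_iff_map_fun_eq_pi_map fun i => (hD i).aemeasurable).1 hind
  simp_rw [fun i => (hD i).map_eq] at h1
  have h2 : (fun _ : Fin n => gaussianReal 0 (t - s))
      = fun _ => (gaussianReal 0 1).map fun x => Real.sqrt (t - s) * x := by
    ext1 i
    rw [gaussianReal_map_const_mul]
    congr 1
    · simp
    · ext
      rw [NNReal.coe_sub hst]
      simp [Real.sq_sqrt (sub_nonneg.2 (NNReal.coe_le_coe.2 hst))]
  have h3 : P.map (fun ω => B t ω - B s ω)
      = (P.map fun ω i => B t ω i - B s ω i).map (WithLp.toLp 2) := by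
    rw [AEMeasurable.map_map_of_aemeasurable (WithLp.measurable_toLp 2 _).aemeasurable
      (aemeasurable_pi_lambda _ fun i => (hD i).aemeasurable)]
    rfl
  rw [h3, h1, h2, ← Measure.pi_map_pi (fun _ => by fun_prop), ← map_pi_eq_stdGaussian,
    Measure.map_map (by fun_prop) (by fun_prop), Measure.map_map (by fun_prop) (by fun_prop)]
  rfl

/-- The increments of Brownian motion are independent of the past. -/
lemma indepFun_sub (hB : IsBrownianRn B P) {κ : Type*} [Countable κ] {τ : κ → ℝ≥0} {s t : ℝ≥0}
    (hτ : ∀ j, τ j ≤ s) (hst : s ≤ t) :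
    IndepFun (fun ω j => B (τ j) ω) (fun ω => B t ω - B s ω) P := by
  have hX : ∀ i, AEMeasurable (fun ω j => B (τ j) ω i) P := fun i =>
    aemeasurable_pi_lambda _ fun j => (hB.coord i).aemeasurable (τ j)
  have hY : ∀ i, AEMeasurable (fun ω => B t ω i - B s ω i) P := fun i =>
    ((hB.coord i).aemeasurable t).sub ((hB.coord i).aemeasurable s)
  have hXY : ∀ i, IndepFun (fun ω j => B (τ j) ω i) (fun ω => B t ω i - B s ω i) P := by
    intro i
    have h := ((hB.coord i).toIsPreBrownianReal.indepFun_shift s).symm.comp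
      (φ := fun (f : Set.Iic s → ℝ) (j : κ) => f ⟨τ j, hτ j⟩) (ψ := fun f : ℝ≥0 → ℝ => f (t - s))
      (by fun_prop) (measurable_pi_apply (t - s) : Measurable fun f : ℝ≥0 → ℝ => f (t - s))
    simpa [Function.comp_def, add_tsub_cancel_of_le hst] using h
  have hind : iIndepFun (fun i ω => (fun j => B (τ j) ω i, B t ω i - B s ω i)) P :=
    hB.indep.comp (fun _ f => (fun j => f (τ j), f t - f s)) fun _ => by fun_prop
  exact (indepFun_pi_of_iIndepFun_prodMk hX hY hind hXY).comp
    (φ := fun (f : Fin n → κ → ℝ) (j : κ) => (WithLp.toLp 2 fun i => f i j : Rn n))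
    (ψ := WithLp.toLp 2) (by fun_prop) (by fun_prop)

/-- The increments of Brownian motion are independent of the past, including an independent
initial condition. -/
lemma indepFun_prodMk_sub (hB : IsBrownianRn B P) {X₀ : Ω → Rn n} (hX₀ : Measurable X₀)
    (hX₀B : IndepFun X₀ (fun ω t => B t ω) P) {κ : Type*} [Countable κ] {τ : κ → ℝ≥0}
    {s t : ℝ≥0} (hτ : ∀ j, τ j ≤ s) (hst : s ≤ t) :
    IndepFun (fun ω => (X₀ ω, fun j => B (τ j) ω)) (fun ω => B t ω - B s ω) P := by
  refine IndepFun.prodMk_left_of_prodMk_right hX₀.aemeasurable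
    (aemeasurable_pi_lambda _ fun j => hB.aemeasurable (τ j))
    ((hB.aemeasurable t).sub (hB.aemeasurable s)) ?_ (hB.indepFun_sub hτ hst)
  exact hX₀B.comp (φ := id) (ψ := fun f : ℝ≥0 → Rn n => (fun j => f (τ j), f t - f s))
    measurable_id (by fun_prop)

end IsBrownianRn

/-- The passage from Brownian increments to the Gaussian step: `√2 √h = √(2h)`. -/
lemma map_add_sqrt_smul_eq_stepLaw {b : Rn n → Rn n} (hb : Continuous b) {X D : Ω → Rn n} {h : ℝ}
    (hX : AEMeasurable X P) (hD : AEMeasurable D P) (hXD : IndepFun X D P)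
    (hlaw : P.map D = (stdGaussian (Rn n)).map fun z => Real.sqrt h • z) :
    P.map (fun ω => X ω - h • b (X ω) + Real.sqrt 2 • D ω) = stepLaw b (P.map X) h := by
  have := Measure.isProbabilityMeasure_map hX
  have hm : Measurable fun y : Rn n × Rn n => y.1 - h • b y.1 + Real.sqrt 2 • y.2 := by
    have := hb.measurable
    fun_prop
  have e : P.map (fun ω => X ω - h • b (X ω) + Real.sqrt 2 • D ω)
      = (P.map fun ω => (X ω, D ω)).map fun y => y.1 - h • b y.1 + Real.sqrt 2 • y.2 := by
    rw [AEMeasurable.map_map_of_aemeasurable hm.aemeasurable (hX.prodMk hD)]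
    rfl
  rw [e, (indepFun_iff_map_prod_eq_prod_map_map hX hD).1 hXD, hlaw, stepLaw]
  nth_rw 1 [← Measure.map_id (μ := P.map X)]
  rw [Measure.map_prod_map _ _ measurable_id (by fun_prop),
    Measure.map_map hm (by fun_prop)]
  congr 1
  ext1 y
  simp [langevinStep, smul_smul, Real.sqrt_mul]

/-- The iterates are functions of the initial condition and of the past of the noise. -/
lemma exists_pmcRedIterate_eq {ℓ : Rn n → ℝ} {S : Rn n → ℝ → Rn n} {σ : ℝ}
    (hb : Measurable (pmcRedDrift ℓ S σ)) (γ : ℝ) (X₀ : Ω → Rn n) (B : ℝ≥0 → Ω → Rn n) (k : ℕ) :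
    ∃ Φ : Rn n × (Fin (k + 1) → Rn n) → Rn n, Measurable Φ ∧
      ∀ ω, pmcRedIterate ℓ S σ γ X₀ (brownianNoise B γ) k ω
        = Φ (X₀ ω, fun j => B (Real.toNNReal ((j : ℕ) * γ)) ω) := by
  induction k with
  | zero => exact ⟨Prod.fst, measurable_fst, fun ω => rfl⟩
  | succ k ih =>
    obtain ⟨Φ, hΦ, h⟩ := ih
    let Ψ : Rn n × (Fin (k + 2) → Rn n) → Rn n := fun y => Φ (y.1, fun j => y.2 j.castSucc)
    have hΨ : Measurable Ψ := hΦ.comp (by fun_prop)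
    refine ⟨fun y => Ψ y - γ • pmcRedDrift ℓ S σ (Ψ y) + Real.sqrt (2 * γ) •
      (Real.sqrt γ)⁻¹ • (y.2 (Fin.last (k + 1)) - y.2 (Fin.last k).castSucc), ?_, fun ω => ?_⟩
    · have := hb.comp hΨ
      simp only [Function.comp_def] at this
      fun_prop
    · simp only [pmcRedIterate, brownianNoise, h ω, Ψ]
      simp

/-- Since `√(2γ) / √γ = √2`, the next iterate is the interpolation formula at the right end of the
interval. -/
lemma pmcRedIterate_succ_brownianNoise {ℓ : Rn n → ℝ} {S : Rn n → ℝ → Rn n} {σ γ : ℝ} (hγ : 0 < γ)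
    (X₀ : Ω → Rn n) (B : ℝ≥0 → Ω → Rn n) (k : ℕ) (ω : Ω) :
    pmcRedIterate ℓ S σ γ X₀ (brownianNoise B γ) (k + 1) ω
      = pmcRedIterate ℓ S σ γ X₀ (brownianNoise B γ) k ω
        - γ • pmcRedDrift ℓ S σ (pmcRedIterate ℓ S σ γ X₀ (brownianNoise B γ) k ω)
        + Real.sqrt 2 • (B (Real.toNNReal ((k + 1 : ℝ) * γ)) ω - B (Real.toNNReal (k * γ)) ω) := by
  simp only [pmcRedIterate, brownianNoise]
  rw [smul_smul, Real.sqrt_mul (by norm_num), mul_assoc,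
    mul_inv_cancel₀ (Real.sqrt_pos.2 hγ).ne', mul_one]

section Laws

variable {ℓ : Rn n → ℝ} {S : Rn n → ℝ → Rn n} {σ γ : ℝ} {X₀ : Ω → Rn n}

lemma aemeasurable_pmcRedIterate (hb : Continuous (pmcRedDrift ℓ S σ)) (γ : ℝ)
    (hB : IsBrownianRn B P) (hX₀ : Measurable X₀) (k : ℕ) :
    AEMeasurable (pmcRedIterate ℓ S σ γ X₀ (brownianNoise B γ) k) P := by
  obtain ⟨Φ, hΦ, h⟩ := exists_pmcRedIterate_eq hb.measurable γ X₀ B k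
  rw [funext h]
  exact hΦ.comp_aemeasurable (hX₀.aemeasurable.prodMk
    (aemeasurable_pi_lambda _ fun j => hB.aemeasurable _))

lemma map_pmcRedIterate_add (hb : Continuous (pmcRedDrift ℓ S σ)) (hγ : 0 < γ)
    (hB : IsBrownianRn B P) (hX₀ : Measurable X₀) (hX₀B : IndepFun X₀ (fun ω t => B t ω) P) (k : ℕ)
    {t : ℝ} (ht : k * γ ≤ t) :
    P.map (fun ω => pmcRedIterate ℓ S σ γ X₀ (brownianNoise B γ) k ω
        - (t - k * γ) • pmcRedDrift ℓ S σ (pmcRedIterate ℓ S σ γ X₀ (brownianNoise B γ) k ω)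
        + Real.sqrt 2 • (B (Real.toNNReal t) ω - B (Real.toNNReal (k * γ)) ω))
      = stepLaw (pmcRedDrift ℓ S σ)
        (P.map (pmcRedIterate ℓ S σ γ X₀ (brownianNoise B γ) k)) (t - k * γ) := by
  have hk : 0 ≤ k * γ := by positivity
  have hst : Real.toNNReal (k * γ) ≤ Real.toNNReal t := Real.toNNReal_le_toNNReal ht
  refine map_add_sqrt_smul_eq_stepLaw hb (aemeasurable_pmcRedIterate hb γ hB hX₀ k)
    ((hB.aemeasurable _).sub (hB.aemeasurable _)) ?_ ?_
  · obtain ⟨Φ, hΦ, h⟩ := exists_pmcRedIterate_eq hb.measurable γ X₀ B k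
    rw [funext h]
    refine (hB.indepFun_prodMk_sub hX₀ hX₀B (τ := fun j : Fin (k + 1) =>
      Real.toNNReal ((j : ℕ) * γ)) (fun j => Real.toNNReal_le_toNNReal ?_) hst).comp hΦ
      measurable_id
    gcongr
    exact Nat.lt_succ_iff.1 j.2
  · rw [hB.map_sub hst, Real.coe_toNNReal _ hk, Real.coe_toNNReal _ (hk.trans ht)]

lemma map_pmcRedIterate_succ (hb : Continuous (pmcRedDrift ℓ S σ)) (hγ : 0 < γ)
    (hB : IsBrownianRn B P) (hX₀ : Measurable X₀) (hX₀B : IndepFun X₀ (fun ω t => B t ω) P)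
    (k : ℕ) :
    P.map (pmcRedIterate ℓ S σ γ X₀ (brownianNoise B γ) (k + 1))
      = stepLaw (pmcRedDrift ℓ S σ)
        (P.map (pmcRedIterate ℓ S σ γ X₀ (brownianNoise B γ) k)) γ := by
  have h := map_pmcRedIterate_add hb hγ hB hX₀ hX₀B k (t := (k + 1 : ℝ) * γ) (by nlinarith)
  rw [show (k + 1 : ℝ) * γ - k * γ = γ by ring] at h
  rw [← h, funext (pmcRedIterate_succ_brownianNoise hγ X₀ B k)]

/-- The right end is excluded because the floor of `t / γ` jumps to `k + 1` there. -/
lemma map_pmcRedInterp (hb : Continuous (pmcRedDrift ℓ S σ)) (hγ : 0 < γ)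
    (hB : IsBrownianRn B P) (hX₀ : Measurable X₀) (hX₀B : IndepFun X₀ (fun ω t => B t ω) P) {k : ℕ}
    {t : ℝ} (ht : k * γ ≤ t) (ht' : t < (k + 1) * γ) :
    P.map (pmcRedInterp ℓ S σ γ X₀ B t)
      = stepLaw (pmcRedDrift ℓ S σ)
        (P.map (pmcRedIterate ℓ S σ γ X₀ (brownianNoise B γ) k)) (t - k * γ) := by
  have hk : ⌊t / γ⌋₊ = k := by
    have : 0 ≤ t := le_trans (by positivity) ht
    rw [Nat.floor_eq_iff (by positivity)]
    exact ⟨(le_div_iff₀ hγ).2 ht, (div_lt_iff₀ hγ).2 ht'⟩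
  rw [← map_pmcRedIterate_add hb hγ hB hX₀ hX₀B k ht]
  unfold pmcRedInterp
  rw [hk]

/-- Summing the one-step estimates. -/
lemma klDiv_pmcRedIterate_add_lintegral_fisherInfo_le {V : Rn n → ℝ} {V' : Rn n → Rn n} {L δ : ℝ}
    [IsProbabilityMeasure (gibbsMeasure V)]
    (h : LipschitzDrift (pmcRedDrift ℓ S σ) V V' L)
    (hδ : ∀ x, ‖pmcRedDrift ℓ S σ x - V' x‖ ≤ δ) (hγ : 0 < γ) (hγL : γ * L ≤ 1 / Real.sqrt 32)
    (hB : IsBrownianRn B P) (hX₀ : Measurable X₀) (hX₀B : IndepFun X₀ (fun ω t => B t ω) P)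
    (N : ℕ) :
    4 * klDiv (P.map (pmcRedIterate ℓ S σ γ X₀ (brownianNoise B γ) N)) (gibbsMeasure V)
      + ∫⁻ t in Set.Ico (0 : ℝ) (N * γ),
        fisherInfo (P.map (pmcRedInterp ℓ S σ γ X₀ B t)) (gibbsMeasure V)
      ≤ 4 * klDiv (P.map X₀) (gibbsMeasure V)
        + ENNReal.ofReal (N * (4 * γ * (3 * δ ^ 2 + 6 * (n * L ^ 2 * γ)))) := by
  have hb := h.continuous_drift
  set K : ℝ := 4 * γ * (3 * δ ^ 2 + 6 * (n * L ^ 2 * γ)) with hK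
  have hK0 : 0 ≤ K := by positivity
  induction N with
  | zero => simp [pmcRedIterate]
  | succ k ih =>
    set νk := P.map (pmcRedIterate ℓ S σ γ X₀ (brownianNoise B γ) k) with hνk
    have : IsProbabilityMeasure νk :=
      Measure.isProbabilityMeasure_map (aemeasurable_pmcRedIterate hb γ hB hX₀ k)
    have hstep := h.klDiv_stepLaw_add_lintegral_fisher_le hδ νk hγ hγL
    rw [finrank_euclideanSpace_fin, ← map_pmcRedIterate_succ hb hγ hB hX₀ hX₀B k] at hstep
    have hkγ : 0 ≤ k * γ := by positivity
    have hk1 : k * γ ≤ ((k + 1 : ℕ) : ℝ) * γ := by push_cast; nlinarith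
    have hI : ∫⁻ t in Set.Ico (k * γ) (((k + 1 : ℕ) : ℝ) * γ),
          fisherInfo (P.map (pmcRedInterp ℓ S σ γ X₀ B t)) (gibbsMeasure V)
        ≤ ∫⁻ t in Set.Ioc 0 γ, ∫⁻ x, fisherIntegrand (pmcRedDrift ℓ S σ) V' νk t x := by
      -- The end points are null. Inside, the elapsed time `t - k * γ` is positive, so the law has a
      -- smooth density, and a time shift reduces to one step.
      rw [Measure.restrict_congr_set Ioo_ae_eq_Ico.symm, Measure.restrict_congr_set Ioo_ae_eq_Ioc.symm]
      have hpre : Set.Ioo (k * γ) (((k + 1 : ℕ) : ℝ) * γ)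
          = (fun t => t - k * γ) ⁻¹' Set.Ioo 0 γ := by
        rw [Set.preimage_sub_const_Ioo, zero_add]
        congr 1
        push_cast
        ring
      rw [← (measurePreserving_sub_right volume (k * γ)).setLIntegral_comp_preimage_emb
        (MeasurableEquiv.subRight (k * γ)).measurableEmbedding
        (fun t => ∫⁻ x, fisherIntegrand (pmcRedDrift ℓ S σ) V' νk t x) (Set.Ioo 0 γ), ← hpre]
      refine setLIntegral_mono' measurableSet_Ioo fun t ht => ?_
      rw [map_pmcRedInterp hb hγ hB hX₀ hX₀B ht.1.le (by exact_mod_cast ht.2)]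
      exact h.fisherInfo_stepLaw_le νk (sub_pos.2 ht.1)
    rw [← Set.Ico_union_Ico_eq_Ico hkγ hk1]
    calc _ ≤ 4 * klDiv (P.map (pmcRedIterate ℓ S σ γ X₀ (brownianNoise B γ) (k + 1)))
            (gibbsMeasure V)
          + ((∫⁻ t in Set.Ico (0 : ℝ) (k * γ),
            fisherInfo (P.map (pmcRedInterp ℓ S σ γ X₀ B t)) (gibbsMeasure V))
          + ∫⁻ t in Set.Ioc 0 γ, ∫⁻ x, fisherIntegrand (pmcRedDrift ℓ S σ) V' νk t x) := by
          gcongr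
          exact (lintegral_union_le _ _ _).trans (by gcongr)
      _ ≤ (4 * klDiv νk (gibbsMeasure V) + ENNReal.ofReal K)
          + ∫⁻ t in Set.Ico (0 : ℝ) (k * γ),
            fisherInfo (P.map (pmcRedInterp ℓ S σ γ X₀ B t)) (gibbsMeasure V) := by
          rw [add_comm (∫⁻ t in Set.Ico (0 : ℝ) (k * γ), _), ← add_assoc]
          gcongr
      _ ≤ (4 * klDiv (P.map X₀) (gibbsMeasure V) + ENNReal.ofReal (k * K))
          + ENNReal.ofReal K := by
          rw [add_right_comm]
          gcongr
      _ = _ := by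
          rw [add_assoc, ← ENNReal.ofReal_add (by positivity) hK0]
          congr 2
          push_cast
          ring

end Laws

end Brownian

/-! ### The averaged Fisher information bound. -/

theorem theorem1 {n : ℕ} {Ω : Type*} [MeasurableSpace Ω] (P : Measure Ω) [IsProbabilityMeasure P]
    -- likelihood `x ↦ ℓ(y | x)`, prior density, score network
    (ℓ p : Rn n → ℝ) (S : Rn n → ℝ → Rn n)
    (Lg Lp Lσ C εσ σ γ : ℝ) (N : ℕ)
    -- positive likelihood, positive prior probability density, normalizable posterior
    (hℓ_pos : ∀ x, 0 < ℓ x) (hp_pos : ∀ x, 0 < p x) (hp_one : ∫ x, p x = 1)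
    (hπ : Integrable (fun x => ℓ x * p x))
    -- differentiable log-likelihood with Lipschitz gradient
    (hLg : 0 < Lg) (hℓ_diff : Differentiable ℝ (fun x => Real.log (ℓ x)))
    (hℓ_lip : ∀ x₁ x₂, ‖score ℓ x₁ - score ℓ x₂‖ ≤ Lg * ‖x₁ - x₂‖)
    -- differentiable log-prior with Lipschitz gradient
    (hLp : 0 < Lp) (hp_diff : Differentiable ℝ (fun x => Real.log (p x)))
    (hp_lip : ∀ x₁ x₂, ‖score p x₁ - score p x₂‖ ≤ Lp * ‖x₁ - x₂‖)
    -- the score network at level `σ` is Lipschitz and has error at most `εσ`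
    (hσ : 0 < σ) (hLσ : 0 < Lσ)
    (hS_lip : ∀ x₁ x₂, ‖S x₁ σ - S x₂ σ‖ ≤ Lσ * ‖x₁ - x₂‖)
    (hS_err : ∀ x, ‖S x σ - score (smoothedPrior p σ) x‖ ≤ εσ)
    -- score mismatch of the smoothed prior
    (hmis : ∀ x, ‖score (smoothedPrior p σ) x - score p x‖ ≤ σ * C)
    -- number of iterations and step size
    (hN : 0 < N) (hγ : 0 < γ)
    (hγL : γ * (Lg + max Lσ Lp) ≤ 1 / Real.sqrt 32)
    -- initialization, and driving Brownian motion independent of it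
    (X₀ : Ω → Rn n) (hX₀ : Measurable X₀)
    (B : ℝ≥0 → Ω → Rn n) (hB : IsBrownianRn B P)
    (hX₀B : IndepFun X₀ (fun ω t => B t ω) P) :
    (∫⁻ t in Set.Icc (0 : ℝ) (N * γ),
        fisherInfo (P.map (pmcRedInterp ℓ S σ γ X₀ B t)) (posteriorMeasure ℓ p))
        / ENNReal.ofReal (N * γ)
      ≤ 4 * InformationTheory.klDiv (P.map X₀) (posteriorMeasure ℓ p) / ENNReal.ofReal (N * γ)
        + ENNReal.ofReal (24 * n * (Lg + max Lσ Lp) ^ 2 * γ + 24 * C ^ 2 * σ ^ 2 + 24 * εσ ^ 2) := by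
  set L : ℝ := Lg + max Lσ Lp with hL
  have hdrift : LipschitzDrift (pmcRedDrift ℓ S σ) (posteriorPotential ℓ p) _ L :=
    lipschitzDrift_posterior hLg.le hℓ_diff hℓ_lip hLp.le hp_diff hp_lip hS_lip
  have hδ := norm_pmcRedDrift_sub_le hℓ_diff hS_err hmis
  have hprob := isProbabilityMeasure_posteriorMeasure hℓ_pos hp_pos hπ
  rw [posteriorMeasure_eq_gibbsMeasure hℓ_pos hp_pos hπ] at hprob ⊢
  have h := klDiv_pmcRedIterate_add_lintegral_fisherInfo_le hdrift hδ hγ hγL hB hX₀ hX₀B N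
  have hNγ : 0 < N * γ := mul_pos (Nat.cast_pos.2 hN) hγ
  -- `(εσ + σ * C)² ≤ 2 εσ² + 2 σ² C²` turns the factor `4 · 3` into `24`.
  have hK : N * (4 * γ * (3 * (εσ + σ * C) ^ 2 + 6 * (n * L ^ 2 * γ)))
      ≤ N * γ * (24 * n * L ^ 2 * γ + 24 * C ^ 2 * σ ^ 2 + 24 * εσ ^ 2) := by
    rw [show N * (4 * γ * (3 * (εσ + σ * C) ^ 2 + 6 * (n * L ^ 2 * γ)))
      = N * γ * (12 * (εσ + σ * C) ^ 2 + 24 * n * L ^ 2 * γ) by ring]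
    refine mul_le_mul_of_nonneg_left ?_ hNγ.le
    nlinarith [sq_nonneg (εσ - σ * C)]
  -- The relative entropy of the last iterate is nonnegative and is dropped.
  have hle := le_add_self.trans (h.trans (add_le_add_right (ENNReal.ofReal_le_ofReal hK) _))
  have h0 : ENNReal.ofReal (N * γ) ≠ 0 := (ENNReal.ofReal_pos.2 hNγ).ne'
  rw [← Measure.restrict_congr_set Ico_ae_eq_Icc]
  refine (ENNReal.div_le_div_right hle _).trans (le_of_eq ?_)
  rw [ENNReal.add_div, ENNReal.ofReal_mul hNγ.le, mul_comm (ENNReal.ofReal (N * γ)),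
    ENNReal.mul_div_cancel_right h0 ENNReal.ofReal_ne_top]
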